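/- For $n\ge 1$, the random graph process on $[n]=\{1,\dots,n\}$ starts with no edges, and in each step a new edge, chosen uniformly at random among the missing ones, is added; $G(n,m)$ is the graph after $m$ steps. The hitting time of a graph property is the first time $m$ at which $G(n,m)$ has the property, and $\tau_d$ is the hitting time of the property "the minimum degree is at least $d$". For a graph $G=(V,E)$ and $A,B\subseteq V$ let $G[A,B]$ be the graph with vertex set $A\cup B$ whose edges are the edges of $G$ with one endpoint in $A$ and the other in $B$. A strong $d$-rigid partition of $G$ is a partition $V=V_1\cup\dots\cup V_d$ into nonempty, pairwise disjoint sets such that $G[V_i,V_j]$ is connected for all $1\le i\le j\le d$. A graph $G=(V,E)$ with $|V|\ge d+1$ is $d$-rigid if there is an injective map $\mathbf p:V\to\mathbb R^d$ whose rigidity matrix has rank $d|V|-\binom{d+1}{2}$; here the rigidity matrix is the $|E|\times d|V|$ matrix whose row indexed by $\{u,v\}\in E$ equals $\mathbf p(u)-\mathbf p(v)$ on the $d$ coordinates of $u$, equals $\mathbf p(v)-\mathbf p(u)$ on the $d$ coordinates of $v$, and is $0$ elsewhere. **Theorem.** There exists $c>0$ such that the following holds for every sequence of integers $d=d(n)$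 with $1\le d(n)\le c\log n/\log\log n$ for all sufficiently large $n$. With probability tending to $1$ as $n\to\infty$, the graph $G(n,\tau_d)$ admits a strong $d$-rigid partition. Moreover, with probability tending to $1$ as $n\to\infty$, the hitting time of $d$-rigidity in the random graph process on $[n]$ is equal to $\tau_d$. -/

import Mathlib

open Filter Topology

noncomputable section

namespace RigidPartition

/-! ### Strong rigid partitions -/

/-- The graph `G[A, B]`: its vertex set is `A ∪ B`, and its edges are the edges of `G` that have
one endpoint in `A` and the other one in `B`. The sets `A` and `B` need not be disjoint, and
`G[A, A]` is the induced subgraph on `A`. -/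
def between {V : Type*} (G : SimpleGraph V) (A B : Set V) : G.Subgraph where
  verts := A ∪ B
  Adj u v := G.Adj u v ∧ ((u ∈ A ∧ v ∈ B) ∨ (u ∈ B ∧ v ∈ A))
  adj_sub h := h.1
  edge_vert h := h.2.elim (fun h => Or.inl h.1) (fun h => Or.inr h.1)
  symm := ⟨fun _ _ h => ⟨h.1.symm, h.2.elim (fun h => Or.inr ⟨h.2, h.1⟩)
    (fun h => Or.inl ⟨h.2, h.1⟩)⟩⟩

/-- `P 0, …, P (d - 1)` is a partition of the vertex set into nonempty, pairwise disjoint sets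
such that `G[P i, P j]` is connected for all `i ≤ j` (including `i = j`). -/
structure IsStrongRigidPartition {V : Type*} (G : SimpleGraph V) (d : ℕ)
    (P : Fin d → Set V) : Prop where
  nonempty : ∀ i, (P i).Nonempty
  disjoint : ∀ i j, i ≠ j → Disjoint (P i) (P j)
  cover : ⋃ i, P i = Set.univ
  connected : ∀ i j, i ≤ j → (between G (P i) (P j)).Connected

/-- `G` admits a (type I) strong `d`-rigid partition. -/
def AdmitsStrongRigidPartition {V : Type*} (G : SimpleGraph V) (d : ℕ) : Prop :=
  ∃ P : Fin d → Set V, IsStrongRigidPartition G d P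

/-! ### Rigidity -/

open Classical in
/-- The row of the rigidity matrix that belongs to the pair `{u, v}`: it equals `p u - p v` on the
`d` coordinates of `u`, `p v - p u` on the `d` coordinates of `v`, and `0` elsewhere. -/
def rigidityRow {V : Type*} {d : ℕ} (p : V → Fin d → ℝ) : Sym2 V → V × Fin d → ℝ :=
  Sym2.lift ⟨fun u v w =>
    (if w.1 = u then p u w.2 - p v w.2 else 0) + (if w.1 = v then p v w.2 - p u w.2 else 0),
    fun _ _ => funext fun _ => add_comm _ _⟩

/-- The rigidity matrix of the framework `(G, p)`. -/
def rigidityMatrix {V : Type*} {d : ℕ} (G : SimpleGraph V) (p : V → Fin d → ℝ) :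
    Matrix G.edgeSet (V × Fin d) ℝ :=
  Matrix.of fun e => rigidityRow p (e : Sym2 V)

/-- The rank that the rigidity matrix of an infinitesimally rigid framework on `n` vertices in
`ℝ ^ d` has: `d n - (d + 1 choose 2)` if `n ≥ d + 1` (the natural number subtraction does not
truncate then), with the usual convention `n choose 2` for fewer vertices. -/
def fullRigidityRank (n d : ℕ) : ℕ :=
  if d + 1 ≤ n then d * n - (d + 1).choose 2 else n.choose 2

/-- The framework `(G, p)` is infinitesimally rigid. -/
def InfinitesimallyRigid {V : Type*} [Fintype V] {d : ℕ} (G : SimpleGraph V)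
    (p : V → Fin d → ℝ) : Prop :=
  (rigidityMatrix G p).rank = fullRigidityRank (Fintype.card V) d

/-- `G` is `d`-rigid: some embedding of its vertices into `ℝ ^ d` is infinitesimally rigid. -/
def IsRigid {V : Type*} [Fintype V] (G : SimpleGraph V) (d : ℕ) : Prop :=
  ∃ p : V → Fin d → ℝ, Function.Injective p ∧ InfinitesimallyRigid G p

open Classical in
/-- Every vertex of `G` has degree at least `d` (for a nonempty vertex set). -/
def HasMinDegree {V : Type*} [Fintype V] (G : SimpleGraph V) (d : ℕ) : Prop :=
  d ≤ G.minDegree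

/-! ### The random graph process -/

/-- The edges of the complete graph on the vertex set `{0, …, n - 1}`. -/
abbrev Edge (n : ℕ) : Type := (⊤ : SimpleGraph (Fin n)).edgeSet

/-- The sample space of the random graph process: the orderings of all `n choose 2` possible edges,
with the uniform distribution. The `i`-th edge is the one that is added in step `i + 1`. -/
abbrev EdgeOrdering (n : ℕ) : Type := Fin (n.choose 2) ≃ Edge n

theorem nonempty_edgeOrdering (n : ℕ) : Nonempty (EdgeOrdering n) := by
  classical
  refine ⟨(Fintype.equivFinOfCardEq ?_).symm⟩
  rw [← SimpleGraph.edgeFinset_card, SimpleGraph.card_edgeFinset_top_eq_card_choose_two,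
    Fintype.card_fin]

/-- The graph `G(n, m)`: the state of the process after `m` steps (the complete graph if `m` is at
least the number of possible edges). -/
def processGraph {n : ℕ} (σ : EdgeOrdering n) (m : ℕ) : SimpleGraph (Fin n) :=
  SimpleGraph.fromEdgeSet {e | ∃ i : Fin (n.choose 2), (i : ℕ) < m ∧ (σ i : Sym2 (Fin n)) = e}

/-- The probability of the event `A` for a uniformly random ordering of the edges. -/
def processProb (n : ℕ) (A : EdgeOrdering n → Prop) : ℝ :=
  (Nat.card {σ : EdgeOrdering n // A σ} : ℝ) / (Nat.card (EdgeOrdering n) : ℝ)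

/-- In each step the process adds an edge that is uniformly distributed on the missing edges:
given the first `m` edges, any two missing edges are equally likely to come next. -/
theorem processProb_next_edge {n : ℕ} (m : Fin (n.choose 2)) (ρ : EdgeOrdering n) (e e' : Edge n)
    (he : ∀ i < m, ρ i ≠ e) (he' : ∀ i < m, ρ i ≠ e') :
    processProb n (fun σ => (∀ i < m, σ i = ρ i) ∧ σ m = e) =
      processProb n (fun σ => (∀ i < m, σ i = ρ i) ∧ σ m = e') := by
  classical
  have key : ∀ (a b : Edge n), (∀ i < m, ρ i ≠ a) → (∀ i < m, ρ i ≠ b) →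
      ∀ σ : EdgeOrdering n, ((∀ i < m, σ i = ρ i) ∧ σ m = a) →
        ((∀ i < m, (σ.trans (Equiv.swap a b)) i = ρ i) ∧ (σ.trans (Equiv.swap a b)) m = b) := by
    intro a b ha hb σ h
    refine ⟨fun i hi => ?_, ?_⟩
    · rw [Equiv.trans_apply, h.1 i hi, Equiv.swap_apply_of_ne_of_ne (ha i hi) (hb i hi)]
    · rw [Equiv.trans_apply, h.2, Equiv.swap_apply_left]
  unfold processProb
  congr 2
  refine Nat.card_congr
    ⟨fun σ => ⟨σ.1.trans (Equiv.swap e e'), key e e' he he' σ.1 σ.2⟩,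
     fun σ => ⟨σ.1.trans (Equiv.swap e' e), key e' e he' he σ.1 σ.2⟩, ?_, ?_⟩
  · intro σ
    apply Subtype.ext
    ext i
    simp [Equiv.swap_comm e' e]
  · intro σ
    apply Subtype.ext
    ext i
    simp [Equiv.swap_comm e' e]

/-- `τ` is the hitting time of the graph property `Q` in the process `σ`: the first time at which
the process has the property. -/
def IsHittingTime {n : ℕ} (σ : EdgeOrdering n) (Q : SimpleGraph (Fin n) → Prop) (τ : ℕ) : Prop :=
  IsLeast {m : ℕ | Q (processGraph σ m)} τ

/-- The event `A n` of the random graph process on `n` vertices holds with high probability. -/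
def Whp (A : (n : ℕ) → EdgeOrdering n → Prop) : Prop :=
  Tendsto (fun n => processProb n (A n)) atTop (𝓝 1)

end RigidPartition

end

noncomputable section

namespace RigidPartition

/-! ### Rank and rigidity -/

section Rank

variable {m n : Type*} [Fintype n]

/-! A strong partition forces rigidity. Put a vertex `v` of class `i` at `(1 + t x_v) e_i` with
distinct numbers `x_v`, and divide the rows of edges inside a class by `t`. As `t → 0` the matrix
has a limit. In the kernel of the limit, connectedness of `G[V_i, V_i]` makes coordinate `i`
constant on `V_i`, and connectedness of `G[V_i, V_j]` makes the difference of coordinates `i` and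
`j` constant on `V_i ∪ V_j`. One constant for each pair `i ≤ j` leaves a kernel of dimension at most
`(d + 1).choose 2`. Rank is lower semicontinuous, so small `t > 0` gives full rank
(`AdmitsStrongRigidPartition.isRigid`). Conversely, a vertex of degree below `d` can move
independently of the rest (`IsRigid.hasMinDegree`). Hence a partition at time `τ_d` settles both
claims.

The partition comes from a colouring that gives every vertex neighbours of all `d` colours, and
gives `4κ` of each colour to every vertex outside a set `S` of low-degree vertices. Since members of
`S` are at distance at least 5, their neighbourhoods can be coloured by hand, and the local lemma
colours the rest (`exists_rich_coloring`). A union of components of some `G[V_i, V_j]` then has many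
internal edges, so it is large because small sets are sparse. Two complementary large unions would
be joined by an edge of the right colours, so there is only one component
(`admitsStrongRigidPartition_of_pseudorandom`).

It remains to find this structure at the random time `τ_d`. With high probability `τ_d` lies between
`m₀ ≈ (3/8) n log n`, when isolated vertices still exist, and `m₁ ≈ n log n`, when the minimum
degree exceeds `d`. Each required property is monotone: lower degree bounds and edges between large
sets are checked at `m₀`; upper degree bounds, sparsity and absence of short paths between
low-degree vertices are checked at `m₁` (`exists_hittingTime_partition`). The failure probabilities
are union bounds in the uniform edge ordering, where edges are revealed one at a time by
exchangeability (`processProb_reveal`), together with a second moment bound for isolated vertices.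
-/

/-- Lower semicontinuity of rank: a maximal independent family of rows stays independent under small
perturbations, because linear independence is an open condition. -/
theorem eventually_rank_le {X : Type*} [TopologicalSpace X] [Finite m]
    {M : X → Matrix m n ℝ} {x₀ : X} (hM : ContinuousAt M x₀) :
    ∀ᶠ x in 𝓝 x₀, (M x₀).rank ≤ (M x).rank := by
  cases nonempty_fintype m
  obtain ⟨f, hf, -, hli⟩ :=
    Submodule.exists_fun_fin_finrank_span_eq ℝ (Set.range (M x₀).row)
  choose g hg using hf
  have hcont : ContinuousAt (fun x i => (M x).row (g i)) x₀ := by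
    refine continuousAt_pi.2 fun i => ?_
    exact (continuousAt_pi.1 hM) (g i)
  have hopen : IsOpen {f : Fin (Module.finrank ℝ (Submodule.span ℝ (Set.range (M x₀).row))) →
      (n → ℝ) | LinearIndependent ℝ f} := isOpen_setOfPred_linearIndependent
  have hmem : (fun i => (M x₀).row (g i)) ∈
      {f : Fin (Module.finrank ℝ (Submodule.span ℝ (Set.range (M x₀).row))) →
      (n → ℝ) | LinearIndependent ℝ f} := by
    have : (fun i => (M x₀).row (g i)) = f := funext hg
    simpa [this] using hli
  filter_upwards [hcont.eventually_mem (hopen.mem_nhds hmem)] with x hx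
  have hx' : LinearIndependent ℝ (fun i => (M x).row (g i)) := hx
  rw [Matrix.rank_eq_finrank_span_row, Matrix.rank_eq_finrank_span_row]
  have h1 := finrank_span_eq_card hx'
  rw [Fintype.card_fin] at h1
  rw [← h1]
  exact Submodule.finrank_mono (Submodule.span_mono (by rintro _ ⟨i, rfl⟩; exact ⟨g i, rfl⟩))

theorem rank_add_finrank_ker [Finite m] (M : Matrix m n ℝ) :
    M.rank + Module.finrank ℝ (LinearMap.ker M.mulVecLin) = Fintype.card n := by
  rw [Matrix.rank, LinearMap.finrank_range_add_finrank_ker, Module.finrank_fintype_fun_eq_card]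

theorem rank_add_finrank_le [Finite m] (M : Matrix m n ℝ) {W : Type*} [AddCommGroup W]
    [Module ℝ W] [Module.Finite ℝ W] (f : W →ₗ[ℝ] (n → ℝ)) (hf : Function.Injective f)
    (h : ∀ w, M.mulVec (f w) = 0) : M.rank + Module.finrank ℝ W ≤ Fintype.card n := by
  rw [← rank_add_finrank_ker M]
  have : Module.finrank ℝ W ≤ Module.finrank ℝ (LinearMap.ker M.mulVecLin) :=
    LinearMap.finrank_le_finrank_of_injective
      (f := f.codRestrict (LinearMap.ker M.mulVecLin) fun w => by simpa using h w)
      (fun a b hab => hf (by simpa using congrArg Subtype.val hab))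
  omega

/-- The functional `f` is a normalisation: if it is injective on the kernel, the kernel has
dimension at most that of `W`. -/
theorem card_le_rank_add_finrank [Finite m] (M : Matrix m n ℝ) {W : Type*} [AddCommGroup W]
    [Module ℝ W] [Module.Finite ℝ W] (f : (n → ℝ) →ₗ[ℝ] W)
    (h : ∀ x, M.mulVec x = 0 → f x = 0 → x = 0) :
    Fintype.card n ≤ M.rank + Module.finrank ℝ W := by
  rw [← rank_add_finrank_ker M]
  have : Module.finrank ℝ (LinearMap.ker M.mulVecLin) ≤ Module.finrank ℝ W := by
    refine LinearMap.finrank_le_finrank_of_injective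
      (f := f.domRestrict (LinearMap.ker M.mulVecLin)) ?_
    rw [injective_iff_map_eq_zero]
    rintro ⟨x, hx⟩ hfx
    exact Subtype.ext (h x (by simpa using hx) (by simpa using hfx))
  omega

theorem rank_le_rank_of_ker_le [Finite m] {M M' : Matrix m n ℝ}
    (h : ∀ x, M'.mulVec x = 0 → M.mulVec x = 0) : M.rank ≤ M'.rank := by
  have h1 := rank_add_finrank_ker M
  have h2 := rank_add_finrank_ker M'
  have h3 : Module.finrank ℝ (LinearMap.ker M'.mulVecLin) ≤
      Module.finrank ℝ (LinearMap.ker M.mulVecLin) :=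
    Submodule.finrank_mono fun x hx => by simpa using h x (by simpa using hx)
  omega

end Rank

/-! ### Infinitesimal motions and isometries. -/

section Motions

variable {V : Type*} {d : ℕ}

theorem sum_rigidityRow_mul [Fintype V] (p : V → Fin d → ℝ) (u v : V) (x : V × Fin d → ℝ) :
    ∑ w, rigidityRow p s(u, v) w * x w = ∑ k, (p u k - p v k) * (x (u, k) - x (v, k)) := by
  classical
  simp only [rigidityRow, Sym2.lift_mk, Fintype.sum_prod_type, add_mul, Finset.sum_add_distrib,
    ite_mul, zero_mul]
  rw [Finset.sum_comm]
  conv_lhs => enter [2]; rw [Finset.sum_comm]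
  simp only [Finset.sum_ite_eq', Finset.mem_univ, if_true]
  rw [← Finset.sum_add_distrib]
  exact Finset.sum_congr rfl fun k _ => by ring

theorem rigidityMatrix_mulVec_eq_zero_iff [Fintype V] (G : SimpleGraph V) (p : V → Fin d → ℝ)
    (x : V × Fin d → ℝ) : (rigidityMatrix G p).mulVec x = 0 ↔
      ∀ u v, G.Adj u v → ∑ k, (p u k - p v k) * (x (u, k) - x (v, k)) = 0 := by
  constructor
  · intro h u v huv
    rw [← sum_rigidityRow_mul]
    exact congrFun h ⟨s(u, v), huv⟩
  · rintro h
    funext ⟨e, he⟩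
    induction e with
    | h u v => exact (sum_rigidityRow_mul p u v x).trans (h u v he)

/-- The sign of the entry `(k, j)` of a skew-symmetric matrix in terms of the upper triangle. -/
def skewSign (k j : Fin d) : ℝ := if k < j then 1 else if j < k then -1 else 0

theorem skewSign_swap (k j : Fin d) : skewSign j k = -skewSign k j := by
  unfold skewSign
  rcases lt_trichotomy k j with h | h | h
  · simp [h, h.not_gt]
  · simp [h]
  · simp [h, h.not_gt]

theorem skewSign_ne_zero {k j : Fin d} (h : k ≠ j) : skewSign k j ≠ 0 := by
  unfold skewSign
  rcases lt_or_gt_of_ne h with h | h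
  · simp [h]
  · simp [h, h.not_gt]

/-- The velocities at the points `p v` of the infinitesimal isometry of `ℝ ^ d` with translation
part `k ↦ w s(k, k)` and skew-symmetric linear part given by the other values of `w`. -/
def isometryMotion (p : V → Fin d → ℝ) : (Sym2 (Fin d) → ℝ) →ₗ[ℝ] (V × Fin d → ℝ) where
  toFun w x := w s(x.2, x.2) + ∑ j, skewSign x.2 j * w s(x.2, j) * p x.1 j
  map_add' w w' := by
    funext x
    simp only [Pi.add_apply, mul_add, add_mul, Finset.sum_add_distrib]
    ring
  map_smul' c w := by
    funext x
    simp only [Pi.smul_apply, smul_eq_mul, RingHom.id_apply, mul_add, Finset.mul_sum]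
    congr 1
    exact Finset.sum_congr rfl fun j _ => by ring

/-- Translations cancel in differences, and the quadratic form of a skew-symmetric matrix vanishes:
exchanging the summation indices gives `S = -S`. -/
theorem rigidityMatrix_mulVec_isometryMotion [Fintype V] (G : SimpleGraph V)
    (p : V → Fin d → ℝ) (w : Sym2 (Fin d) → ℝ) :
    (rigidityMatrix G p).mulVec (isometryMotion p w) = 0 := by
  rw [rigidityMatrix_mulVec_eq_zero_iff]
  intro u v _
  have h1 : ∀ k, (p u k - p v k) * (isometryMotion p w (u, k) - isometryMotion p w (v, k)) =
      ∑ j, (p u k - p v k) * (skewSign k j * w s(k, j)) * (p u j - p v j) := by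
    intro k
    have : isometryMotion p w (u, k) - isometryMotion p w (v, k) =
        ∑ j, skewSign k j * w s(k, j) * (p u j - p v j) := by
      simp only [isometryMotion, LinearMap.coe_mk, AddHom.coe_mk, mul_sub, Finset.sum_sub_distrib]
      ring
    rw [this, Finset.mul_sum]
    exact Finset.sum_congr rfl fun j _ => by ring
  simp only [h1]
  set S := ∑ k, ∑ j, (p u k - p v k) * (skewSign k j * w s(k, j)) * (p u j - p v j) with hS
  have h2 : S = -S := by
    conv_lhs => rw [hS, Finset.sum_comm]
    rw [hS, ← Finset.sum_neg_distrib]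
    refine Finset.sum_congr rfl fun k _ => ?_
    rw [← Finset.sum_neg_distrib]
    refine Finset.sum_congr rfl fun j _ => ?_
    rw [skewSign_swap k j, Sym2.eq_swap]
    ring
  linarith

/-- An infinitesimal isometry is determined by its linear part and its translation part. -/
theorem eq_zero_of_isometry_coeffs {w : Sym2 (Fin d) → ℝ} (h0 : ∀ k, w s(k, k) = 0)
    (h1 : ∀ k j, skewSign k j * w s(k, j) = 0) : w = 0 := by
  funext e
  induction e with
  | h k j =>
    by_cases hkj : k = j
    · subst hkj; exact h0 k
    · exact (mul_eq_zero.1 (h1 k j)).resolve_left (skewSign_ne_zero hkj)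

theorem finrank_sym2_fun : Module.finrank ℝ (Sym2 (Fin d) → ℝ) = (d + 1).choose 2 := by
  rw [Module.finrank_fintype_fun_eq_card, Sym2.card, Fintype.card_fin]

/-- Guarantees that the natural number subtraction in `fullRigidityRank` does not truncate. -/
theorem isRigid_rank_arith {n d : ℕ} (h : d + 1 ≤ n) : (d + 1).choose 2 ≤ d * n := by
  rw [Nat.choose_two_right, Nat.add_sub_cancel]
  calc (d + 1) * d / 2 ≤ (d + 1) * d := Nat.div_le_self _ _
    _ ≤ n * d := Nat.mul_le_mul_right _ h
    _ = d * n := mul_comm _ _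

end Motions

/-! ### Rigidity forces minimum degree `d`. -/

section MinDegree

variable {V : Type*} {d : ℕ}

theorem continuous_rigidityMatrix (G : SimpleGraph V) (p q : V → Fin d → ℝ) :
    Continuous fun t : ℝ => rigidityMatrix G (p + t • q) := by
  classical
  refine continuous_pi fun e => continuous_pi fun w => ?_
  obtain ⟨e, he⟩ := e
  induction e with
  | h u v =>
    simp only [rigidityMatrix, rigidityRow, Matrix.of_apply, Sym2.lift_mk, Pi.add_apply,
      Pi.smul_apply, smul_eq_mul]
    refine Continuous.add ?_ ?_ <;> split_ifs <;> fun_prop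

/-- The determinant is the characteristic polynomial of `-D` evaluated at `t`, which has finitely
many roots. -/
theorem eventually_det_add_smul_one_ne_zero (D : Matrix (Fin d) (Fin d) ℝ) :
    ∀ᶠ t : ℝ in 𝓝[≠] 0, (D + t • (1 : Matrix (Fin d) (Fin d) ℝ)).det ≠ 0 := by
  have hfin : {t : ℝ | (-D).charpoly.IsRoot t}.Finite :=
    Polynomial.finite_setOfPred_isRoot (Matrix.charpoly_monic _).ne_zero
  have := nhdsNE_le_cofinite (0 : ℝ) hfin.compl_mem_cofinite
  filter_upwards [this] with t ht h0
  refine ht ?_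
  simp only [Set.mem_ofPred_eq, Polynomial.IsRoot, Matrix.eval_charpoly]
  rw [← h0]
  congr 1
  rw [sub_neg_eq_add, add_comm, Matrix.scalar_apply, Matrix.smul_one_eq_diagonal]

/-- An infinitesimal isometry vanishing at `d + 1` affinely independent points is zero: differences
kill the linear part, and then the translation vanishes too. -/
theorem isometryMotion_coeffs_of_det_ne_zero {p : V → Fin d → ℝ} {w : Sym2 (Fin d) → ℝ}
    {z : Fin (d + 1) → V}
    (hdet : (Matrix.of fun i k : Fin d => p (z i.succ) k - p (z 0) k).det ≠ 0)
    (h : ∀ i k, isometryMotion p w (z i, k) = 0) : w = 0 := by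
  have h1 : ∀ k j, skewSign k j * w s(k, j) = 0 := by
    intro k
    have := Matrix.eq_zero_of_mulVec_eq_zero hdet (v := fun j => skewSign k j * w s(k, j)) (by
      funext i
      have e1 := h i.succ k
      have e0 := h 0 k
      simp only [isometryMotion, LinearMap.coe_mk, AddHom.coe_mk] at e1 e0
      simp only [Matrix.mulVec, dotProduct, Matrix.of_apply, sub_mul, Finset.sum_sub_distrib,
        Pi.zero_apply]
      simp only [mul_comm (p _ _)]
      linarith)
    exact fun j => congrFun this j
  refine eq_zero_of_isometry_coeffs (fun k => ?_) h1
  have e0 := h 0 k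
  simp only [isometryMotion, LinearMap.coe_mk, AddHom.coe_mk, h1, zero_mul,
    Finset.sum_const_zero, add_zero] at e0
  exact e0

/-- If `v` has degree below `d`, some velocity of `v` alone preserves all edge lengths to first
order. Together with the isometries it makes the kernel too large, provided that it is not itself an
isometry. This proviso needs the other vertices to span affinely, which a small perturbation ensures
without lowering the rank. -/
theorem IsRigid.hasMinDegree [Fintype V] {G : SimpleGraph V} (hn : d + 2 ≤ Fintype.card V)
    (hG : IsRigid G d) : HasMinDegree G d := by
  classical
  obtain ⟨p₀, -, hp₀⟩ := hG
  have : Nonempty V := Fintype.card_pos_iff.1 (by omega)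
  unfold HasMinDegree
  by_contra hlt
  rw [not_le] at hlt
  obtain ⟨v, hv⟩ := G.exists_minimal_degree_vertex
  rw [hv] at hlt
  -- This is where `d + 2` vertices are needed: `d + 1` of them must differ from `v`.
  have hcard : Fintype.card (Fin (d + 1)) ≤ Fintype.card {u // u ≠ v} := by
    rw [Fintype.card_fin, Fintype.card_subtype_compl, Fintype.card_subtype_eq]
    omega
  obtain ⟨z⟩ := Function.Embedding.nonempty_of_card_le hcard
  have hz0 : ∀ i : Fin d, z i.succ ≠ z 0 := fun i h => Fin.succ_ne_zero i (z.injective h)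
  -- Pushing `z k.succ` along the `k`-th axis changes the matrix of differences from `D` to `D + t •
  -- 1`.
  let q : V → Fin d → ℝ := fun u k => if u = z k.succ then 1 else 0
  have hcont := (continuous_rigidityMatrix G p₀ q).continuousAt (x := 0)
  have hev := (eventually_rank_le hcont).filter_mono (nhdsWithin_le_nhds (s := {0}ᶜ))
  obtain ⟨t, hrank, hdet⟩ := (hev.and (eventually_det_add_smul_one_ne_zero
    (Matrix.of fun i k : Fin d => p₀ (z i.succ) k - p₀ (z 0) k))).exists
  set p := p₀ + t • q with hp
  have hdet' : (Matrix.of fun i k : Fin d => p (z i.succ) k - p (z 0) k).det ≠ 0 := by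
    convert hdet using 2
    ext i k
    have h1 : ((z 0 : V) = z k.succ) = False := by
      simpa [Subtype.val_inj] using (hz0 k).symm
    have h2 : ((z i.succ : V) = z k.succ) = (i = k) := by
      simp [Subtype.val_inj]
    simp only [hp, q, Matrix.of_apply, Pi.add_apply, Pi.smul_apply, smul_eq_mul, h1, h2,
      Matrix.add_apply, Matrix.smul_apply, Matrix.one_apply, if_false]
    ring
  -- Fewer than `d` linear conditions on a vector of `ℝ ^ d` have a nonzero solution.
  obtain ⟨y, hy, hy0⟩ : ∃ y : Fin d → ℝ, (∀ u, G.Adj v u → ∑ k, (p v k - p u k) * y k = 0) ∧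
      y ≠ 0 := by
    let A : Matrix (G.neighborFinset v) (Fin d) ℝ := Matrix.of fun u k => p v k - p u k
    have : LinearMap.ker A.mulVecLin ≠ ⊥ := by
      apply LinearMap.ker_ne_bot_of_finrank_lt
      simp only [Module.finrank_fintype_fun_eq_card, Fintype.card_fin, Fintype.card_coe]
      exact hlt
    obtain ⟨y, hy, hy0⟩ := Submodule.exists_mem_ne_zero_of_ne_bot this
    refine ⟨y, fun u hu => ?_, hy0⟩
    exact congrFun (show A.mulVec y = 0 by simpa using hy) ⟨u, by simpa using hu⟩
  let f : ((Sym2 (Fin d) → ℝ) × ℝ) →ₗ[ℝ] (V × Fin d → ℝ) :=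
    (isometryMotion p).coprod
      (LinearMap.toSpanSingleton ℝ _ fun x => if x.1 = v then y x.2 else 0)
  have hfapp : ∀ w s x, f (w, s) x = isometryMotion p w x + s * if x.1 = v then y x.2 else 0 := by
    intro w s x
    simp [f]
  have hf : Function.Injective f := by
    rw [injective_iff_map_eq_zero]
    rintro ⟨w, s⟩ h0
    have hw : w = 0 := by
      refine isometryMotion_coeffs_of_det_ne_zero (z := fun i => (z i : V)) hdet' fun i k => ?_
      have := congrFun h0 ((z i : V), k)
      rw [hfapp] at this
      simpa [(z i).2] using this
    subst hw
    obtain ⟨k, hk⟩ := Function.ne_iff.1 hy0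
    have := congrFun h0 (v, k)
    rw [hfapp] at this
    simp only [map_zero, Pi.zero_apply, if_true, zero_add, mul_eq_zero] at this
    have hs : s = 0 := this.resolve_right hk
    subst hs
    rfl
  have hker : ∀ a, (rigidityMatrix G p).mulVec (f a) = 0 := by
    rintro ⟨w, s⟩
    simp only [f, LinearMap.coprod_apply, Matrix.mulVec_add, rigidityMatrix_mulVec_isometryMotion,
      zero_add, LinearMap.toSpanSingleton_apply, Matrix.mulVec_smul]
    refine smul_eq_zero_of_right _ ?_
    rw [rigidityMatrix_mulVec_eq_zero_iff]
    intro a b hab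
    by_cases ha : a = v
    · subst ha
      simpa [hab.ne'] using hy b hab
    · by_cases hb : b = v
      · subst hb
        have h := hy a hab.symm
        simp only [ha, if_false, if_true, zero_sub]
        rw [← h]
        exact Finset.sum_congr rfl fun k _ => by ring
      · simp [ha, hb]
  have hle := rank_add_finrank_le _ f hf hker
  rw [Module.finrank_prod, finrank_sym2_fun, Module.finrank_self, Fintype.card_prod,
    Fintype.card_fin] at hle
  unfold InfinitesimallyRigid fullRigidityRank at hp₀
  rw [if_pos (by omega)] at hp₀
  rw [zero_smul, add_zero, hp₀] at hrank
  have := isRigid_rank_arith (n := Fintype.card V) (d := d) (by omega)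
  rw [mul_comm] at hle
  omega

end MinDegree

/-! ### A strong partition forces rigidity. -/

section Partition

variable {V : Type*} {d : ℕ}

/-- The form in which connectedness is used: a function constant along edges of `G[A, B]` is
constant on `A ∪ B`. -/
theorem eq_of_between_connected {G : SimpleGraph V} {A B : Set V}
    (h : (between G A B).Connected) (f : V → ℝ)
    (hf : ∀ u v, G.Adj u v → u ∈ A → v ∈ B → f u = f v) {u v : V} (hu : u ∈ A ∪ B)
    (hv : v ∈ A ∪ B) : f u = f v := by
  have hreach := h.coe.preconnected ⟨u, hu⟩ ⟨v, hv⟩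
  obtain ⟨w⟩ := hreach
  have key : ∀ {a b : (between G A B).verts}, (between G A B).coe.Walk a b → f a = f b := by
    intro a b w
    induction w with
    | nil => rfl
    | cons hadj _ ih =>
      refine Eq.trans ?_ ih
      rcases hadj.2 with h | h
      · exact hf _ _ hadj.1 h.1 h.2
      · exact (hf _ _ hadj.1.symm h.2 h.1).symm
  exact key w

/-- A degenerate framework on the basis vectors, one per class, is unfolded at first order in `t`.
The limit matrix `M 0` already has the full rank, and its rank bounds that of the unfolded framework
from below. -/
theorem AdmitsStrongRigidPartition.isRigid [Fintype V] {G : SimpleGraph V}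
    (hn : d + 1 ≤ Fintype.card V) (hG : AdmitsStrongRigidPartition G d) : IsRigid G d := by
  classical
  obtain ⟨P, hP⟩ := hG
  have hex : ∀ v, ∃ i, v ∈ P i := fun v => by
    simpa using (hP.cover ▸ Set.mem_univ v : v ∈ ⋃ i, P i)
  choose c hc using hex
  have hcu : ∀ {v i}, v ∈ P i → c v = i := fun {v i} hv => by
    by_contra hne
    exact Set.disjoint_left.1 (hP.disjoint _ _ hne) (hc v) hv
  choose r hr using hP.nonempty
  have hcr : ∀ i, c (r i) = i := fun i => hcu (hr i)
  obtain ⟨x, hx0, hxinj⟩ : ∃ x : V → ℝ, (∀ v, 0 ≤ x v) ∧ Function.Injective x :=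
    ⟨fun v => (Fintype.equivFin V v : ℕ), fun v => Nat.cast_nonneg _, fun u v h => by
      simpa [Fin.val_inj] using h⟩
  let p₀ : V → Fin d → ℝ := fun v => Pi.single (c v) 1
  let p₁ : V → Fin d → ℝ := fun v => Pi.single (c v) (x v)
  have hdot : ∀ (u v : V) (m : V × Fin d → ℝ) (a b : ℝ),
      ∑ k, ((Pi.single (c u) a : Fin d → ℝ) k - (Pi.single (c v) b : Fin d → ℝ) k) *
        (m (u, k) - m (v, k)) =
      a * (m (u, c u) - m (v, c u)) - b * (m (u, c v) - m (v, c v)) := by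
    intro u v m a b
    simp only [sub_mul, Finset.sum_sub_distrib, Pi.single_apply, ite_mul, zero_mul,
      Finset.sum_ite_eq', Finset.mem_univ, if_true]
  have hp : ∀ t : ℝ, ∀ v, (p₀ + t • p₁) v = Pi.single (c v) (1 + t * x v) := by
    intro t v
    funext k
    by_cases hk : k = c v
    · subst hk; simp [p₀, p₁]
    · simp [p₀, p₁, hk]
  -- For an edge inside a class the row of `p₀ + t • p₁` is `t` times that of `p₁`. Using the latter
  -- keeps the row alive at `t = 0` and, for `t ≠ 0`, changes neither kernel nor rank.
  let M : ℝ → Matrix G.edgeSet (V × Fin d) ℝ := fun t => Matrix.of fun e =>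
    if ((e : Sym2 V).map c).IsDiag then rigidityMatrix G p₁ e else rigidityMatrix G (p₀ + t • p₁) e
  have hMcont : Continuous M := by
    refine continuous_pi fun e => ?_
    by_cases he : ((e : Sym2 V).map c).IsDiag
    · have : (fun t => M t e) = fun _ => rigidityMatrix G p₁ e := funext fun t => if_pos he
      rw [this]
      exact continuous_const
    · have : (fun t => M t e) = fun t : ℝ => rigidityMatrix G (p₀ + t • p₁) e :=
        funext fun t => if_neg he
      rw [this]
      exact (continuous_pi_iff.1 (continuous_rigidityMatrix G p₀ p₁)) e
  have hMker : ∀ t m, (M t).mulVec m = 0 ↔ ∀ u v, G.Adj u v →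
      if c u = c v then x u * (m (u, c u) - m (v, c u)) - x v * (m (u, c v) - m (v, c v)) = 0
      else (1 + t * x u) * (m (u, c u) - m (v, c u)) -
        (1 + t * x v) * (m (u, c v) - m (v, c v)) = 0 := by
    intro t m
    have hrow : ∀ u v (h : G.Adj u v), (M t).mulVec m ⟨s(u, v), h⟩ =
        if c u = c v then x u * (m (u, c u) - m (v, c u)) - x v * (m (u, c v) - m (v, c v))
        else (1 + t * x u) * (m (u, c u) - m (v, c u)) -
          (1 + t * x v) * (m (u, c v) - m (v, c v)) := by
      intro u v h
      by_cases huv : c u = c v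
      · rw [if_pos huv]
        have e1 : M t ⟨s(u, v), h⟩ = rigidityRow p₁ s(u, v) := by
          funext w
          simp [M, huv, rigidityMatrix]
        rw [Matrix.mulVec, dotProduct, e1, sum_rigidityRow_mul]
        exact hdot u v m _ _
      · rw [if_neg huv]
        have e1 : M t ⟨s(u, v), h⟩ = rigidityRow (p₀ + t • p₁) s(u, v) := by
          funext w
          simp [M, huv, rigidityMatrix]
        rw [Matrix.mulVec, dotProduct, e1, sum_rigidityRow_mul]
        simp only [hp]
        exact hdot u v m _ _
    constructor
    · intro h u v huv
      have := hrow u v huv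
      rw [h] at this
      split_ifs at this ⊢ <;> exact this.symm
    · intro h
      funext ⟨e, he⟩
      induction e with
      | h u v =>
        rw [hrow u v he]
        have := h u v he
        split_ifs at this ⊢ <;> exact this
  -- the rank of the limit matrix
  have hM0 : d * Fintype.card V ≤ (M 0).rank + (d + 1).choose 2 := by
    -- Pinning: at the representative `r i` the coordinates `j ≥ i` are read off, one value for each
    -- unordered pair `{i, j}`.
    let f : (V × Fin d → ℝ) →ₗ[ℝ] (Sym2 (Fin d) → ℝ) :=
      LinearMap.pi fun e => LinearMap.proj (r e.inf, e.sup)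
    have hf : ∀ m, (M 0).mulVec m = 0 → f m = 0 → m = 0 := by
      intro m hm hfm
      rw [hMker] at hm
      have hfm' : ∀ i j, i ≤ j → m (r i, j) = 0 := fun i j hij => by
        have := congrFun hfm s(i, j)
        simpa [f, hij] using this
      have hdiag : ∀ v, m (v, c v) = 0 := by
        intro v
        have h1 : m (v, c v) = m (r (c v), c v) :=
          eq_of_between_connected (hP.connected (c v) (c v) le_rfl) (fun u => m (u, c v))
            (fun a b hab ha hb => by
              have := hm a b hab
              rw [hcu ha, hcu hb, if_pos rfl, ← sub_mul] at this
              have hne : x a - x b ≠ 0 := sub_ne_zero.2 fun h => hab.ne (hxinj h)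
              exact sub_eq_zero.1 ((mul_eq_zero.1 this).resolve_left hne))
            (Or.inl (hc v)) (Or.inl (hr _))
        rw [h1, hfm' _ _ le_rfl]
      -- The limit row between classes `i` and `j` is made from `e_i - e_j`, so only the difference
      -- of these two coordinates of the motion enters.
      have hcross : ∀ i j, i < j → ∀ v ∈ P i ∪ P j, m (v, i) - m (v, j) = 0 := by
        intro i j hij v hv
        have h1 : m (v, i) - m (v, j) = m (r i, i) - m (r i, j) :=
          eq_of_between_connected (hP.connected i j hij.le) (fun u => m (u, i) - m (u, j))
            (fun a b hab ha hb => by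
              have := hm a b hab
              rw [hcu ha, hcu hb, if_neg hij.ne] at this
              simp only [zero_mul, add_zero, one_mul] at this
              linarith) hv (Or.inl (hr i))
        rw [h1, hfm' _ _ le_rfl, hfm' _ _ hij.le, sub_zero]
      funext ⟨v, k⟩
      rcases lt_trichotomy (c v) k with h | h | h
      · have := hcross _ _ h v (Or.inl (hc v))
        rw [hdiag] at this
        simpa using this
      · subst h; exact hdiag v
      · have := hcross _ _ h v (Or.inr (hc v))
        rw [hdiag] at this
        simpa using this
    have := card_le_rank_add_finrank (M 0) f hf
    rwa [finrank_sym2_fun, Fintype.card_prod, Fintype.card_fin, mul_comm] at this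
  have hev := (eventually_rank_le hMcont.continuousAt).filter_mono
    (nhdsWithin_le_nhds (a := (0 : ℝ)) (s := Set.Ioi 0))
  obtain ⟨t, hrank, ht⟩ := (hev.and self_mem_nhdsWithin).exists
  have hy : ∀ v, 0 < 1 + t * x v := fun v => by have := hx0 v; positivity
  refine ⟨p₀ + t • p₁, ?_, ?_⟩
  · intro u v huv
    rw [hp, hp] at huv
    have hcuv : c u = c v := by
      by_contra hne
      have := congrFun huv (c u)
      rw [Pi.single_eq_same, Pi.single_eq_of_ne hne] at this
      exact (hy u).ne' this
    have := congrFun huv (c u)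
    rw [hcuv, Pi.single_eq_same, Pi.single_eq_same] at this
    have h2 : t * x u = t * x v := by linarith
    exact hxinj (mul_left_cancel₀ ht.ne' h2)
  · have hle : (M t).rank ≤ (rigidityMatrix G (p₀ + t • p₁)).rank := by
      refine rank_le_rank_of_ker_le fun m hm => ?_
      rw [rigidityMatrix_mulVec_eq_zero_iff] at hm
      rw [hMker]
      intro u v huv
      have := hm u v huv
      simp only [hp, hdot] at this
      split_ifs with h
      · rw [h] at this ⊢
        have h2 : t * ((x u * (m (u, c v) - m (v, c v))) - x v * (m (u, c v) - m (v, c v))) = 0 := by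
          linarith
        exact (mul_eq_zero.1 h2).resolve_left ht.ne'
      · exact this
    have hupper : (rigidityMatrix G (p₀ + t • p₁)).rank + (d + 1).choose 2 ≤
        d * Fintype.card V := by
      have hinj : Function.Injective (isometryMotion (p₀ + t • p₁)) := by
        rw [injective_iff_map_eq_zero]
        intro w hw
        have hval : ∀ v k, w s(k, k) + skewSign k (c v) * w s(k, c v) * (1 + t * x v) = 0 := by
          intro v k
          have := congrFun hw (v, k)
          simp only [isometryMotion, LinearMap.coe_mk, AddHom.coe_mk, hp, Pi.zero_apply] at this
          rw [← this]
          congr 1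
          rw [Finset.sum_eq_single (c v)]
          · rw [Pi.single_eq_same]
          · intro j _ hj
            rw [Pi.single_eq_of_ne hj, mul_zero]
          · simp
        -- With more vertices than classes, two points lie on one axis at different distances from
        -- the origin. They separate the translation from the linear part.
        obtain ⟨u, v, huv, hcuv⟩ : ∃ u v, u ≠ v ∧ c u = c v :=
          Fintype.exists_ne_map_eq_of_card_lt c (by rw [Fintype.card_fin]; omega)
        have hb : ∀ k, w s(k, k) = 0 := by
          intro k
          have h1 := hval u k
          have h2 := hval v k
          rw [hcuv] at h1
          have h3 : skewSign k (c v) * w s(k, c v) * (t * (x u - x v)) = 0 := by linarith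
          have h4 : t * (x u - x v) ≠ 0 :=
            mul_ne_zero ht.ne' (sub_ne_zero.2 fun h => huv (hxinj h))
          rw [(mul_eq_zero.1 h3).resolve_right h4] at h2
          simpa using h2
        refine eq_zero_of_isometry_coeffs hb fun k j => ?_
        have h1 := hval (r j) k
        rw [hb, hcr, zero_add] at h1
        exact (mul_eq_zero.1 h1).resolve_right (hy _).ne'
      have := rank_add_finrank_le (rigidityMatrix G (p₀ + t • p₁)) _ hinj
        (rigidityMatrix_mulVec_isometryMotion G _)
      rwa [finrank_sym2_fun, Fintype.card_prod, Fintype.card_fin,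
        mul_comm (Fintype.card V) d] at this
    unfold InfinitesimallyRigid fullRigidityRank
    rw [if_pos hn]
    omega

end Partition

/-! ### The local lemma for uniformly random colourings -/

section LocalLemma

open Finset

variable {α β : Type*} [Fintype α] [Fintype β]

open Classical in
/-- The number of colourings with the property `A`. -/
def colCount (A : (α → β) → Prop) : ℝ := (#{f | A f} : ℝ)

theorem colCount_nonneg (A : (α → β) → Prop) : 0 ≤ colCount A := Nat.cast_nonneg _

theorem colCount_mono {A B : (α → β) → Prop} (h : ∀ f, A f → B f) : colCount A ≤ colCount B := by
  classical
  unfold colCount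
  exact_mod_cast card_le_card (monotone_filter_right _ fun f _ => h f)

theorem colCount_or_le (A B : (α → β) → Prop) :
    colCount (fun f => A f ∨ B f) ≤ colCount A + colCount B := by
  classical
  unfold colCount
  have : (#{f | A f ∨ B f}) ≤ #{f | A f} + #{f | B f} := by
    rw [filter_or]
    exact card_union_le _ _
  exact_mod_cast (card_le_card (by intro f; simp)).trans this

theorem colCount_exists_le {ι : Type*} (s : Finset ι) (A : ι → (α → β) → Prop) :
    colCount (fun f => ∃ i ∈ s, A i f) ≤ ∑ i ∈ s, colCount (A i) := by
  classical
  induction s using Finset.induction_on with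
  | empty => simp [colCount]
  | insert a s ha ih =>
    rw [sum_insert ha]
    calc colCount (fun f => ∃ i ∈ insert a s, A i f)
        ≤ colCount (fun f => A a f ∨ ∃ i ∈ s, A i f) := colCount_mono fun f => by
          rintro ⟨i, hi, h⟩
          rcases mem_insert.1 hi with rfl | hi
          · exact Or.inl h
          · exact Or.inr ⟨i, hi, h⟩
      _ ≤ _ := (colCount_or_le _ _).trans (by gcongr)

/-- Independence of events on disjoint sets of coordinates, by bijection: in a pair of colourings,
the values off `s` are exchanged. -/
theorem colCount_and_mul_card {A B : (α → β) → Prop} {s : Set α} (hA : DependsOn A s)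
    (hB : DependsOn B sᶜ) :
    colCount (fun f => A f ∧ B f) * colCount (fun _ : α → β => True) =
      colCount A * colCount B := by
  classical
  unfold colCount
  norm_cast
  rw [← card_product, ← card_product]
  have hA' : ∀ f g : α → β, A (s.piecewise f g) = A f := fun f g =>
    hA fun i hi => Set.piecewise_eq_of_mem s f g hi
  have hB' : ∀ f g : α → β, B (s.piecewise f g) = B g := fun f g =>
    hB fun i hi => Set.piecewise_eq_of_notMem s f g hi
  have hinv : ∀ q : (α → β) × (α → β),
      s.piecewise (s.piecewise q.1 q.2) (s.piecewise q.2 q.1) = q.1 := fun q => by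
    funext i
    by_cases hi : i ∈ s <;> simp [hi]
  have hinv' : ∀ q : (α → β) × (α → β),
      s.piecewise (s.piecewise q.2 q.1) (s.piecewise q.1 q.2) = q.2 := fun q => by
    funext i
    by_cases hi : i ∈ s <;> simp [hi]
  refine card_nbij' (fun q => (s.piecewise q.1 q.2, s.piecewise q.2 q.1))
    (fun q => (s.piecewise q.1 q.2, s.piecewise q.2 q.1)) ?_ ?_ ?_ ?_
  · rintro ⟨f, g⟩ h
    simp only [coe_product, Set.mem_prod, mem_coe, mem_filter_univ, hA', hB'] at h ⊢
    exact ⟨h.1.1, h.1.2⟩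
  · rintro ⟨f, g⟩ h
    simp only [coe_product, Set.mem_prod, mem_coe, mem_filter_univ, hA', hB'] at h ⊢
    exact ⟨h, trivial⟩
  · exact fun q _ => Prod.ext (hinv q) (hinv' q)
  · exact fun q _ => Prod.ext (hinv q) (hinv' q)

variable {ι : Type*}

/-- The induction of the local lemma: conditioned on avoiding the events of `T`, `A i` has
probability at most `2 * p`. Events with support disjoint from `S i` are independent of `A i`; by
induction, the at most `D` others cost at most a factor 2, as `D * 2p ≤ 1/2`. -/
theorem colCount_and_avoid_le {A : ι → (α → β) → Prop} {S : ι → Set α}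
    (hdep : ∀ i, DependsOn (A i) (S i)) {p D : ℝ} (hp0 : 0 ≤ p)
    (hp : ∀ i, colCount (A i) ≤ p * colCount (fun _ : α → β => True)) (hpD : 4 * D * p ≤ 1)
    (hD : ∀ i (T : Finset ι), (∀ j ∈ T, ¬ Disjoint (S i) (S j)) → (#T : ℝ) ≤ D) (T : Finset ι) :
    ∀ i, colCount (fun f => A i f ∧ ∀ j ∈ T, ¬ A j f) ≤
      2 * p * colCount (fun f => ∀ j ∈ T, ¬ A j f) := by
  classical
  induction T using Finset.strongInduction with
  | H T ih =>
    intro i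
    set T₁ := T.filter fun j => ¬ Disjoint (S i) (S j) with hT₁
    set T₂ := T.filter fun j => Disjoint (S i) (S j) with hT₂
    have hB : DependsOn (fun f => ∀ j ∈ T₂, ¬ A j f) (S i)ᶜ := by
      intro f g hfg
      have : ∀ j ∈ T₂, A j f = A j g := fun j hj => hdep j fun a ha => hfg a
        fun ha' => Set.disjoint_left.1 (mem_filter.1 hj).2 ha' ha
      exact propext ⟨fun h j hj => this j hj ▸ h j hj, fun h j hj => (this j hj).symm ▸ h j hj⟩
    have hpos : colCount (fun f => A i f ∧ ∀ j ∈ T₂, ¬ A j f) ≤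
        p * colCount (fun f => ∀ j ∈ T₂, ¬ A j f) := by
      have h1 := colCount_and_mul_card (hdep i) hB
      rcases (colCount_nonneg (fun _ : α → β => True)).eq_or_lt with h0 | h0
      · have hz : ∀ B : (α → β) → Prop, colCount B = 0 := fun B =>
          le_antisymm (h0 ▸ colCount_mono fun _ _ => trivial) (colCount_nonneg B)
        simp [hz]
      · refine le_of_mul_le_mul_right ?_ h0
        rw [h1]
        calc _ ≤ _ := mul_le_mul_of_nonneg_right (hp i) (colCount_nonneg _)
          _ = _ := by ring
    have hle : colCount (fun f => A i f ∧ ∀ j ∈ T, ¬ A j f) ≤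
        p * colCount (fun f => ∀ j ∈ T₂, ¬ A j f) :=
      (colCount_mono fun f h => ⟨h.1, fun j hj => h.2 j (mem_filter.1 hj).1⟩).trans hpos
    have hhalf : colCount (fun f => ∀ j ∈ T₂, ¬ A j f) ≤
        2 * colCount (fun f => ∀ j ∈ T, ¬ A j f) := by
      by_cases hne : T₁ = ∅
      · have : T₂ = T := by
          refine filter_true_of_mem fun j hj => ?_
          by_contra hj'
          exact notMem_empty j (hne ▸ mem_filter.2 ⟨hj, hj'⟩)
        rw [this]
        linarith [colCount_nonneg (fun f : α → β => ∀ j ∈ T, ¬ A j f)]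
      · have hss : T₂ ⊂ T := by
          obtain ⟨j, hj⟩ := nonempty_iff_ne_empty.2 hne
          refine (filter_subset _ _).ssubset_of_ne fun h => ?_
          have : j ∈ T₂ := h.symm.subset (mem_filter.1 hj).1
          exact (mem_filter.1 hj).2 (mem_filter.1 this).2
        have h1 : colCount (fun f => ∀ j ∈ T₂, ¬ A j f) ≤
            colCount (fun f => ∀ j ∈ T, ¬ A j f) +
              colCount (fun f => ∃ j ∈ T₁, A j f ∧ ∀ l ∈ T₂, ¬ A l f) := by
          refine (colCount_mono fun f hf => ?_).trans (colCount_or_le _ _)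
          by_cases h : ∃ j ∈ T₁, A j f
          · obtain ⟨j, hj, hjf⟩ := h
            exact Or.inr ⟨j, hj, hjf, hf⟩
          · push Not at h
            refine Or.inl fun j hj => ?_
            by_cases hd : Disjoint (S i) (S j)
            · exact hf j (mem_filter.2 ⟨hj, hd⟩)
            · exact h j (mem_filter.2 ⟨hj, hd⟩)
        have h2 : colCount (fun f => ∃ j ∈ T₁, A j f ∧ ∀ l ∈ T₂, ¬ A l f) ≤
            #T₁ * (2 * p * colCount (fun f => ∀ j ∈ T₂, ¬ A j f)) := by
          refine (colCount_exists_le _ _).trans ?_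
          refine (sum_le_card_nsmul _ _ _ fun j _ => ih T₂ hss j).trans_eq ?_
          rw [nsmul_eq_mul]
        have h3 : (#T₁ : ℝ) ≤ D := hD i T₁ fun j hj => (mem_filter.1 hj).2
        have h4 := colCount_nonneg (fun f : α → β => ∀ j ∈ T₂, ¬ A j f)
        have h5 : #T₁ * (2 * p * colCount (fun f => ∀ j ∈ T₂, ¬ A j f)) ≤
            1 / 2 * colCount (fun f => ∀ j ∈ T₂, ¬ A j f) := by
          rw [← mul_assoc]
          refine mul_le_mul_of_nonneg_right ?_ h4
          have := mul_le_mul_of_nonneg_right h3 hp0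
          linarith
        linarith
    calc _ ≤ _ := hle
      _ ≤ p * (2 * colCount (fun f => ∀ j ∈ T, ¬ A j f)) := mul_le_mul_of_nonneg_left hhalf hp0
      _ = _ := by ring

/-- The symmetric Lovász local lemma for a uniformly random colouring. -/
theorem exists_coloring_avoiding [Nonempty β] {A : ι → (α → β) → Prop} [Fintype ι]
    {S : ι → Set α} (hdep : ∀ i, DependsOn (A i) (S i)) {p D : ℝ} (hp0 : 0 ≤ p) (hD1 : 1 ≤ D)
    (hp : ∀ i, colCount (A i) ≤ p * colCount (fun _ : α → β => True)) (hpD : 4 * D * p ≤ 1)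
    (hD : ∀ i (T : Finset ι), (∀ j ∈ T, ¬ Disjoint (S i) (S j)) → (#T : ℝ) ≤ D) :
    ∃ f : α → β, ∀ i, ¬ A i f := by
  classical
  have key : ∀ T : Finset ι, 0 < colCount (fun f : α → β => ∀ j ∈ T, ¬ A j f) := by
    intro T
    induction T using Finset.induction_on with
    | empty =>
      simp only [notMem_empty, false_imp_iff, implies_true, colCount]
      exact_mod_cast card_pos.2 ⟨fun _ => Classical.arbitrary β, by simp⟩
    | insert a T _ ih =>
      have h1 := colCount_and_avoid_le hdep hp0 hp hpD hD T a
      have h2 : colCount (fun f => ∀ j ∈ T, ¬ A j f) ≤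
          colCount (fun f => ∀ j ∈ insert a T, ¬ A j f) +
            colCount (fun f => A a f ∧ ∀ j ∈ T, ¬ A j f) := by
        refine (colCount_mono fun f hf => ?_).trans (colCount_or_le _ _)
        by_cases h : A a f
        · exact Or.inr ⟨h, hf⟩
        · refine Or.inl fun j hj => ?_
          rcases mem_insert.1 hj with rfl | hj
          exacts [h, hf j hj]
      -- Since `D ≥ 1`, each further event removes at most half of the remaining colourings.
      have hp4 : 4 * p ≤ 1 := by nlinarith
      nlinarith
  have := key univ
  unfold colCount at this
  obtain ⟨f, hf⟩ := card_pos.1 (by exact_mod_cast this)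
  have hf' : ∀ j ∈ univ, ¬ A j f := by simpa using hf
  exact ⟨f, fun i => hf' i (mem_univ i)⟩

/-- A lower tail bound for the number of points of `s` with colour `b`. -/
theorem colCount_few_le [DecidableEq β] [Nonempty β] (s : Finset α) (b : β) (k : ℕ) :
    colCount (fun f : α → β => #{a ∈ s | f a = b} ≤ k) ≤
      2 ^ k * (1 - 1 / (2 * (Fintype.card β : ℝ))) ^ #s * colCount (fun _ : α → β => True) := by
  classical
  have hβ : (0 : ℝ) < Fintype.card β := by exact_mod_cast Fintype.card_pos
  -- The exponential moment of the count with base `1/2` factorises: each point of `s` contributes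
  -- the average `1 - 1 / (2 |β|)`, every other point contributes 1.
  have hsum : ∑ f : α → β, (1 / 2 : ℝ) ^ #{a ∈ s | f a = b} =
      (1 - 1 / (2 * (Fintype.card β : ℝ))) ^ #s * colCount (fun _ : α → β => True) := by
    have h1 : ∀ f : α → β, (1 / 2 : ℝ) ^ #{a ∈ s | f a = b} =
        ∏ a, if a ∈ s ∧ f a = b then (1 / 2 : ℝ) else 1 := by
      intro f
      rw [← prod_filter, prod_const]
      congr 2
      ext a
      simp
    simp only [h1]
    have h2 := prod_univ_sum (fun _ : α => (univ : Finset β))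
      (fun a c => if a ∈ s ∧ c = b then (1 / 2 : ℝ) else 1)
    rw [Fintype.piFinset_univ] at h2
    rw [← h2]
    have h3 : ∀ a, ∑ c : β, (if a ∈ s ∧ c = b then (1 / 2 : ℝ) else 1) =
        (if a ∈ s then 1 - 1 / (2 * (Fintype.card β : ℝ)) else 1) * Fintype.card β := by
      intro a
      by_cases ha : a ∈ s
      · simp only [ha, true_and, if_true]
        have : ∀ c : β, (if c = b then (1 / 2 : ℝ) else 1) = 1 - if c = b then (1 / 2 : ℝ) else 0 :=
          fun c => by split_ifs <;> norm_num
        simp only [this, sum_sub_distrib, sum_ite_eq', mem_univ, if_true, sum_const, card_univ,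
          nsmul_eq_mul, mul_one]
        field_simp
      · simp [ha]
    simp only [h3, prod_mul_distrib, prod_const, card_univ]
    rw [← prod_filter, prod_const, filter_univ_mem]
    congr 1
    simp [colCount]
  have hle : colCount (fun f : α → β => #{a ∈ s | f a = b} ≤ k) ≤
      ∑ f : α → β, 2 ^ k * (1 / 2 : ℝ) ^ #{a ∈ s | f a = b} := by
    unfold colCount
    rw [card_eq_sum_ones, Nat.cast_sum, sum_filter]
    refine sum_le_sum fun f _ => ?_
    split_ifs with h
    · rw [Nat.cast_one, one_div, inv_pow, ← div_eq_mul_inv, one_le_div (by positivity)]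
      exact pow_le_pow_right₀ (by norm_num) h
    · positivity
  rw [← mul_sum, hsum] at hle
  rw [mul_assoc]
  exact hle

end LocalLemma

/-! ### Strong rigid partitions of pseudorandom graphs -/

section Pseudorandom

open Finset

variable {V : Type*} [Fintype V] [DecidableEq V] {G : SimpleGraph V} [DecidableRel G.Adj] {d : ℕ}

/-- A colouring in which every vertex sees every colour, and every vertex outside `S` sees every
colour many times. -/
theorem exists_rich_coloring {S : Finset V} {K Δ k : ℕ} (hd : 1 ≤ d) (hΔ : 1 ≤ Δ)
    (hmin : ∀ v, d ≤ G.degree v) (hlarge : ∀ v ∉ S, K + d ≤ G.degree v)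
    (hmax : ∀ v, G.degree v ≤ Δ)
    (hfar : ∀ s ∈ S, ∀ s' ∈ S, ∀ p : G.Walk s s', p.length ≤ 4 → s = s')
    (hnum : 4 * ((Δ : ℝ) * Δ) * (d * (2 ^ k * (1 - 1 / (2 * (d : ℝ))) ^ K)) ≤ 1) :
    ∃ c : V → Fin d, (∀ v j, ∃ w, G.Adj v w ∧ c w = j) ∧
      ∀ v ∉ S, ∀ j, k ≤ #{w ∈ G.neighborFinset v | c w = j} := by
  classical
  have : Nonempty (Fin d) := ⟨⟨0, hd⟩⟩
  have hemb : ∀ v, Nonempty (Fin d ↪ G.neighborFinset v) := fun v =>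
    Function.Embedding.nonempty_of_card_le (by
      rw [Fintype.card_fin, Fintype.card_coe]; exact hmin v)
  let e : ∀ v, Fin d ↪ G.neighborFinset v := fun v => (hemb v).some
  have hadj : ∀ v j, G.Adj v (e v j) := fun v j =>
    (G.mem_neighborFinset v _).1 (e v j).2
  -- The vertices coloured by hand: `d` neighbours of each `s ∈ S`, one per colour.
  let W : Finset V := univ.filter fun x => ∃ s ∈ S, ∃ j, (e s j : V) = x
  have hW : ∀ x, x ∈ W ↔ ∃ s ∈ S, ∃ j, (e s j : V) = x := fun x => by simp [W]
  -- A shared neighbour would be a walk of length 2 in `S`, so the prescriptions never conflict.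
  have huniq : ∀ s ∈ S, ∀ s' ∈ S, ∀ j j', (e s j : V) = e s' j' → s = s' ∧ j = j' := by
    intro s hs s' hs' j j' h
    have hss : s = s' := by
      refine hfar s hs s' hs' (.cons (hadj s j) (.cons (h ▸ (hadj s' j').symm) .nil)) ?_
      simp
    subst hss
    exact ⟨rfl, (e s).injective (Subtype.ext h)⟩
  -- Prescribed neighbours of `u` belonging to two different members of `S` would give a walk of
  -- length 4. So `u` loses at most `d` neighbours to `W`, and at least `K` remain random when `u ∉
  -- S`.
  have hNW : ∀ u, #(G.neighborFinset u ∩ W) ≤ d := by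
    intro u
    rcases (G.neighborFinset u ∩ W).eq_empty_or_nonempty with h0 | ⟨x, hx⟩
    · simp [h0]
    · rw [mem_inter, hW, SimpleGraph.mem_neighborFinset] at hx
      obtain ⟨hux, s, hs, j, hj⟩ := hx
      have hsub : G.neighborFinset u ∩ W ⊆ univ.image fun j => (e s j : V) := by
        intro y hy
        rw [mem_inter, hW, SimpleGraph.mem_neighborFinset] at hy
        obtain ⟨huy, s', hs', j', hj'⟩ := hy
        have hss : s = s' := by
          refine hfar s hs s' hs' (.cons (hadj s j) (.cons (hj ▸ hux.symm)
            (.cons (v := (e s' j' : V)) (hj' ▸ huy) (.cons (hadj s' j').symm .nil)))) ?_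
          simp
        subst hss
        exact mem_image.2 ⟨j', mem_univ _, hj'⟩
      exact (card_le_card hsub).trans (card_image_le.trans (by simp))
  let N : V → Finset V := fun u => G.neighborFinset u \ W
  have hN : ∀ u ∉ S, K ≤ #(N u) := by
    intro u hu
    have h1 := hlarge u hu
    have h2 := hNW u
    have h3 := card_sdiff_add_card_inter (G.neighborFinset u) W
    rw [SimpleGraph.card_neighborFinset_eq_degree] at h3
    simp only [N]
    omega
  have hd0 : (1 : ℝ) ≤ d := by exact_mod_cast hd
  have hfrac : 0 ≤ 1 - 1 / (2 * (d : ℝ)) ∧ 1 - 1 / (2 * (d : ℝ)) ≤ 1 := by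
    constructor
    · rw [sub_nonneg, div_le_one (by positivity)]; linarith
    · rw [sub_le_self_iff]; positivity
  -- The event at `u` depends only on the colours of `N u`. It can interact with the event at `v`
  -- only if `u` and `v` have a common neighbour, which leaves at most `Δ * Δ` choices of `v`.
  obtain ⟨f, hf⟩ := exists_coloring_avoiding (β := Fin d)
    (A := fun u f => u ∉ S ∧ ∃ j, #{w ∈ N u | f w = j} ≤ k) (S := fun u => (N u : Set V))
    (p := d * (2 ^ k * (1 - 1 / (2 * (d : ℝ))) ^ K)) (D := (Δ : ℝ) * Δ)
    (by
      intro u f g hfg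
      have : ∀ j, {w ∈ N u | f w = j} = {w ∈ N u | g w = j} := fun j =>
        filter_congr fun w hw => by rw [hfg w hw]
      simp only [this])
    (mul_nonneg (by positivity) (mul_nonneg (by positivity) (pow_nonneg hfrac.1 _)))
    (by exact_mod_cast Nat.mul_le_mul hΔ hΔ)
    (by
      intro u
      by_cases hu : u ∈ S
      · have h0 : colCount (fun f : V → Fin d => u ∉ S ∧ ∃ j, #{w ∈ N u | f w = j} ≤ k) = 0 := by
          simp [colCount, hu]
        rw [h0]
        exact mul_nonneg (mul_nonneg (by positivity)
          (mul_nonneg (by positivity) (pow_nonneg hfrac.1 _))) (colCount_nonneg _)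
      · calc colCount (fun f : V → Fin d => u ∉ S ∧ ∃ j, #{w ∈ N u | f w = j} ≤ k)
            ≤ colCount (fun f : V → Fin d => ∃ j ∈ (univ : Finset (Fin d)),
                #{w ∈ N u | f w = j} ≤ k) := colCount_mono fun f h => by simpa using h.2
          _ ≤ ∑ j : Fin d, colCount (fun f : V → Fin d => #{w ∈ N u | f w = j} ≤ k) :=
            colCount_exists_le _ _
          _ ≤ ∑ j : Fin d, 2 ^ k * (1 - 1 / (2 * (d : ℝ))) ^ K *
                colCount (fun _ : V → Fin d => True) := by
            refine sum_le_sum fun j _ => (colCount_few_le (N u) j k).trans ?_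
            rw [Fintype.card_fin]
            refine mul_le_mul_of_nonneg_right ?_ (colCount_nonneg _)
            exact mul_le_mul_of_nonneg_left
              (pow_le_pow_of_le_one hfrac.1 hfrac.2 (hN u hu)) (by positivity)
          _ = _ := by
            rw [sum_const, card_univ, Fintype.card_fin, nsmul_eq_mul]; ring)
    hnum
    (by
      intro u T hT
      have hsub : T ⊆ (G.neighborFinset u).biUnion fun x => G.neighborFinset x := by
        intro v hv
        obtain ⟨x, hxu, hxv⟩ := Set.not_disjoint_iff.1 (hT v hv)
        refine mem_biUnion.2 ⟨x, (Finset.mem_sdiff.1 hxu).1, ?_⟩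
        have := (Finset.mem_sdiff.1 hxv).1
        rw [SimpleGraph.mem_neighborFinset] at this ⊢
        exact this.symm
      have : #T ≤ Δ * Δ := (card_le_card hsub).trans
        ((card_biUnion_le_card_mul _ _ Δ fun x _ => by simpa using hmax x).trans
          (Nat.mul_le_mul_right _ (by simpa using hmax u)))
      exact_mod_cast this)
  let c : V → Fin d := fun x => if h : ∃ s ∈ S, ∃ j, (e s j : V) = x then
    h.choose_spec.2.choose else f x
  have hcW : ∀ s ∈ S, ∀ j, c (e s j) = j := by
    intro s hs j
    have h : ∃ s' ∈ S, ∃ j', (e s' j' : V) = e s j := ⟨s, hs, j, rfl⟩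
    have h1 : c (e s j) = h.choose_spec.2.choose := dif_pos h
    rw [h1]
    exact (huniq _ h.choose_spec.1 s hs _ j h.choose_spec.2.choose_spec).2
  have hcf : ∀ x ∉ W, c x = f x := fun x hx => dif_neg fun h => hx ((hW x).2 h)
  have hmany : ∀ v ∉ S, ∀ j, k < #{w ∈ G.neighborFinset v | c w = j} := by
    intro v hv j
    have h1 : k < #{w ∈ N v | f w = j} := by
      by_contra h
      exact hf v ⟨hv, j, not_lt.1 h⟩
    refine h1.trans_le (card_le_card fun w hw => ?_)
    rw [mem_filter, Finset.mem_sdiff] at hw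
    exact mem_filter.2 ⟨hw.1.1, (hcf w hw.1.2).trans hw.2⟩
  refine ⟨c, fun v j => ?_, fun v hv j => (hmany v hv j).le⟩
  by_cases hv : v ∈ S
  · exact ⟨e v j, hadj v j, hcW v hv j⟩
  · obtain ⟨w, hw⟩ := card_pos.1 ((Nat.zero_le k).trans_lt (hmany v hv j))
    rw [mem_filter, SimpleGraph.mem_neighborFinset] at hw
    exact ⟨w, hw⟩

/-- Unions of components of the graph between two colour classes are large. -/
theorem card_lt_of_closed {S : Finset V} {κ b : ℕ} {c : V → Fin d}
    (hfar : ∀ s ∈ S, ∀ s' ∈ S, ∀ p : G.Walk s s', p.length ≤ 4 → s = s')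
    (hsparse : ∀ T : Finset V, T.Nonempty → #T ≤ b →
      ∑ u ∈ T, #{w ∈ T | G.Adj u w} < 2 * κ * #T)
    (hsee : ∀ v j, ∃ w, G.Adj v w ∧ c w = j)
    (hmany : ∀ v ∉ S, ∀ j, 4 * κ ≤ #{w ∈ G.neighborFinset v | c w = j})
    {T : Finset V} (hT : T.Nonempty) (o : V → Fin d)
    (hclosed : ∀ u ∈ T, ∀ w, G.Adj u w → c w = o u → w ∈ T) : b < #T := by
  by_contra hb
  have h1 := hsparse T hT (not_lt.1 hb)
  -- All neighbours of `u ∈ T` of colour `o u` stay in `T`, and outside `S` there are at least `4κ`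
  -- of them.
  have h2 : #(T \ S) * (4 * κ) ≤ ∑ u ∈ T, #{w ∈ T | G.Adj u w} := by
    refine le_trans ?_ (sum_le_sum_of_subset (sdiff_subset : T \ S ⊆ T))
    rw [← smul_eq_mul]
    refine card_nsmul_le_sum _ _ _ fun u hu => ?_
    rw [Finset.mem_sdiff] at hu
    refine (hmany u hu.2 (o u)).trans (card_le_card fun w hw => ?_)
    rw [mem_filter, SimpleGraph.mem_neighborFinset] at hw
    exact mem_filter.2 ⟨hclosed u hu.1 w hw.1 hw.2, hw.1⟩
  -- A neighbour of `s` of colour `o s` lies in `T`. It is not in `S` and not shared with another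
  -- member of `S`, by walks of length 1 and 2. So at least half of `T` lies outside `S`.
  have h3 : #(T ∩ S) ≤ #(T \ S) := by
    choose g hg hgc using fun v => hsee v (o v)
    refine card_le_card_of_injOn g (fun s hs => ?_) fun s hs s' hs' h => ?_
    · rw [mem_coe, mem_inter] at hs
      rw [mem_coe, Finset.mem_sdiff]
      refine ⟨hclosed s hs.1 _ (hg s) (hgc s), fun hgs => ?_⟩
      exact (hg s).ne (hfar s hs.2 _ hgs (.cons (hg s) .nil) (by simp))
    · rw [mem_coe, mem_inter] at hs hs'
      refine hfar s hs.2 s' hs'.2 (.cons (hg s) (.cons (h ▸ (hg s').symm) .nil)) (by simp)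
  have h4 := card_sdiff_add_card_inter T S
  have h5 : #T ≤ 2 * #(T \ S) := by omega
  have h6 : #T * (2 * κ) ≤ 2 * #(T \ S) * (2 * κ) := Nat.mul_le_mul_right _ h5
  have h7 : 2 * κ * #T = #T * (2 * κ) := mul_comm _ _
  have h8 : 2 * #(T \ S) * (2 * κ) = #(T \ S) * (4 * κ) := by ring
  omega

/-- Applied to the component of a vertex, which is closed under adjacency. -/
theorem connected_of_closed_eq {V : Type*} {G : SimpleGraph V} {H : G.Subgraph}
    (hne : H.verts.Nonempty)
    (h : ∀ T ⊆ H.verts, T.Nonempty → (∀ u ∈ T, ∀ w, H.Adj u w → w ∈ T) → T = H.verts) :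
    H.Connected := by
  have : Nonempty H.verts := hne.to_subtype
  refine ⟨⟨fun x y => ?_⟩⟩
  have key := h (Subtype.val '' {z | H.coe.Reachable x z}) (by rintro _ ⟨z, -, rfl⟩; exact z.2)
    ⟨x, x, SimpleGraph.Reachable.refl _, rfl⟩ (by
      rintro _ ⟨z, hz, rfl⟩ w hw
      refine ⟨⟨w, H.edge_vert hw.symm⟩, ?_, rfl⟩
      exact SimpleGraph.Reachable.trans hz (SimpleGraph.Adj.reachable
        (show H.coe.Adj z ⟨w, H.edge_vert hw.symm⟩ from hw)))
  have hy : (y : V) ∈ Subtype.val '' {z | H.coe.Reachable x z} := key.symm.subset y.2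
  obtain ⟨z, hz, hzy⟩ := hy
  rw [← Subtype.ext hzy]
  exact hz

/-- A graph with minimum degree at least `d` whose vertices of small degree are far apart, whose
small sets are sparse and whose large sets are joined admits a strong `d`-rigid partition. -/
theorem admitsStrongRigidPartition_of_pseudorandom [Nonempty V] {S : Finset V} {K Δ κ a : ℕ}
    (hd : 1 ≤ d) (hΔ : 1 ≤ Δ)
    (hmin : ∀ v, d ≤ G.degree v) (hlarge : ∀ v ∉ S, K + d ≤ G.degree v)
    (hmax : ∀ v, G.degree v ≤ Δ)
    (hfar : ∀ s ∈ S, ∀ s' ∈ S, ∀ p : G.Walk s s', p.length ≤ 4 → s = s')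
    (hsparse : ∀ T : Finset V, T.Nonempty → #T ≤ 2 * a →
      ∑ u ∈ T, #{w ∈ T | G.Adj u w} < 2 * κ * #T)
    (hjoin : ∀ A B : Finset V, Disjoint A B → a ≤ #A → a ≤ #B → ∃ u ∈ A, ∃ w ∈ B, G.Adj u w)
    (hnum : 4 * ((Δ : ℝ) * Δ) * (d * (2 ^ (4 * κ) * (1 - 1 / (2 * (d : ℝ))) ^ K)) ≤ 1) :
    AdmitsStrongRigidPartition G d := by
  classical
  obtain ⟨c, hsee, hmany⟩ := exists_rich_coloring hd hΔ hmin hlarge hmax hfar hnum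
  have hbig := fun {T : Finset V} (hT : T.Nonempty) (o : V → Fin d) =>
    card_lt_of_closed hfar hsparse hsee hmany hT o
  have hclass : ∀ i, 2 * a < #{v | c v = i} := by
    intro i
    refine hbig ?_ (fun _ => i) fun u _ w _ hw => by simpa using hw
    obtain ⟨w, -, hw⟩ := hsee (Classical.arbitrary V) i
    exact ⟨w, by simpa using hw⟩
  refine ⟨fun i => {v | c v = i}, ⟨fun i => ?_, fun i j hij => ?_, ?_, fun i j _ => ?_⟩⟩
  · obtain ⟨w, hw⟩ := card_pos.1 ((Nat.zero_le _).trans_lt (hclass i))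
    exact ⟨w, by simpa using hw⟩
  · exact Set.disjoint_left.2 fun v (hi : c v = i) (hj : c v = j) => hij (hi.symm.trans hj)
  · exact Set.eq_univ_of_forall fun v => Set.mem_iUnion.2 ⟨c v, rfl⟩
  · have hAdj : ∀ u w, (between G {v | c v = i} {v | c v = j}).Adj u w ↔
        G.Adj u w ∧ ((c u = i ∧ c w = j) ∨ (c u = j ∧ c w = i)) := fun u w => Iff.rfl
    have hverts : ∀ u, u ∈ (between G {v | c v = i} {v | c v = j}).verts ↔ c u = i ∨ c u = j :=
      fun u => Iff.rfl
    refine connected_of_closed_eq ?_ fun T hTsub hTne hTcl => ?_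
    · obtain ⟨w, -, hw⟩ := hsee (Classical.arbitrary V) i
      exact ⟨w, Or.inl hw⟩
    by_contra hne
    set A : Finset V := univ.filter (· ∈ T) with hA
    set B : Finset V := univ.filter fun v => (c v = i ∨ c v = j) ∧ v ∉ T with hB
    have hmemA : ∀ v, v ∈ A ↔ v ∈ T := fun v => by simp [hA]
    have hmemB : ∀ v, v ∈ B ↔ (c v = i ∨ c v = j) ∧ v ∉ T := fun v => by simp [hB]
    clear_value A B
    -- The opposite colour in the pair `{i, j}`. For `i = j` it is `i` itself, so both cases are
    -- treated together.
    let o : V → Fin d := fun v => if c v = i then j else i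
    have ho : ∀ u w, (c u = i ∨ c u = j) → c w = o u →
        (c u = i ∧ c w = j) ∨ (c u = j ∧ c w = i) := by
      intro u w hu hw
      by_cases hui : c u = i
      · simp only [o, hui, if_true] at hw
        exact Or.inl ⟨hui, hw⟩
      · simp only [o, hui, if_false] at hw
        exact Or.inr ⟨hu.resolve_left hui, hw⟩
    have hAbig : 2 * a < #A := by
      refine hbig (by obtain ⟨x, hx⟩ := hTne; exact ⟨x, (hmemA x).2 hx⟩) o fun u hu w huw hw => ?_
      rw [hmemA] at hu ⊢
      exact hTcl u hu w ⟨huw, ho u w ((hverts u).1 (hTsub hu)) hw⟩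
    have hBbig : 2 * a < #B := by
      refine hbig ?_ o fun u hu w huw hw => ?_
      · obtain ⟨x, hx, hxT⟩ := Set.exists_of_ssubset (hTsub.ssubset_of_ne hne)
        exact ⟨x, (hmemB x).2 ⟨hx, hxT⟩⟩
      · rw [hmemB] at hu ⊢
        have h := ho u w hu.1 hw
        refine ⟨h.elim (fun h => Or.inr h.2) fun h => Or.inl h.2, fun hwT => hu.2 ?_⟩
        exact hTcl w hwT u ((hAdj w u).2 ⟨huw.symm, h.elim (fun h => Or.inr ⟨h.2, h.1⟩)
          fun h => Or.inl ⟨h.2, h.1⟩⟩)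
    have hno : ∀ i' j', (i' = i ∧ j' = j ∨ i' = j ∧ j' = i) →
        a ≤ #(A.filter (c · = i')) → a ≤ #(B.filter (c · = j')) → False := by
      intro i' j' hij h1 h2
      obtain ⟨u, hu, w, hw, huw⟩ := hjoin _ _ (disjoint_left.2 fun x hx hx' =>
        ((hmemB x).1 (mem_filter.1 hx').1).2 ((hmemA x).1 (mem_filter.1 hx).1)) h1 h2
      rw [mem_filter] at hu hw
      refine ((hmemB w).1 hw.1).2 (hTcl u ((hmemA u).1 hu.1) w ((hAdj u w).2 ⟨huw, ?_⟩))
      rcases hij with ⟨rfl, rfl⟩ | ⟨rfl, rfl⟩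
      · exact Or.inl ⟨hu.2, hw.2⟩
      · exact Or.inr ⟨hu.2, hw.2⟩
    have hAsplit : #A ≤ #(A.filter (c · = i)) + #(A.filter (c · = j)) := by
      refine (card_le_card fun x hx => ?_).trans (card_union_le _ _)
      rw [mem_union, mem_filter, mem_filter]
      exact ((hverts x).1 (hTsub ((hmemA x).1 hx))).imp (⟨hx, ·⟩) (⟨hx, ·⟩)
    have hBsplit : #B ≤ #(B.filter (c · = i)) + #(B.filter (c · = j)) := by
      refine (card_le_card fun x hx => ?_).trans (card_union_le _ _)
      rw [mem_union, mem_filter, mem_filter]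
      exact ((hmemB x).1 hx).1.imp (⟨hx, ·⟩) (⟨hx, ·⟩)
    have hsplit : ∀ l, (l = i ∨ l = j) →
        #{v | c v = l} ≤ #(A.filter (c · = l)) + #(B.filter (c · = l)) := by
      intro l hl
      refine (card_le_card fun x hx => ?_).trans (card_union_le _ _)
      rw [mem_filter_univ] at hx
      rw [mem_union, mem_filter, mem_filter, hmemA, hmemB]
      by_cases hxT : x ∈ T
      · exact Or.inl ⟨hxT, hx⟩
      · exact Or.inr ⟨⟨hl.imp hx.trans hx.trans, hxT⟩, hx⟩
    have h1 := hno i j (Or.inl ⟨rfl, rfl⟩)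
    have h2 := hno j i (Or.inr ⟨rfl, rfl⟩)
    have h3 := hsplit i (Or.inl rfl)
    have h4 := hsplit j (Or.inr rfl)
    have h5 := hclass i
    have h6 := hclass j
    -- The four parts of `A` and `B` of colours `i` and `j` have row and column sums above `2a`. If
    -- a diagonal part is smaller than `a`, both parts on the other diagonal exceed `a`, so some
    -- diagonal is joined by an edge.
    by_cases h7 : a ≤ #(A.filter (c · = i))
    · by_cases h8 : a ≤ #(B.filter (c · = j))
      · exact h1 h7 h8
      · exact h2 (by omega) (by omega)
    · exact h2 (by omega) (by omega)

end Pseudorandom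

/-! ### Probabilities of edge sets in the random graph process -/

section EdgeProbabilities

open Finset

variable {n : ℕ}

open Classical in
/-- The expectation of a random variable on the random graph process. -/
def processExp (n : ℕ) (f : EdgeOrdering n → ℝ) : ℝ :=
  (∑ σ, f σ) / Fintype.card (EdgeOrdering n)

open Classical in
/-- The indicator of an event of the random graph process. -/
def ind (A : EdgeOrdering n → Prop) (σ : EdgeOrdering n) : ℝ := if A σ then 1 else 0

theorem ind_nonneg (A : EdgeOrdering n → Prop) (σ : EdgeOrdering n) : 0 ≤ ind A σ := by
  unfold ind; split_ifs <;> norm_num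

theorem card_edgeOrdering_pos (n : ℕ) : (0 : ℝ) < Fintype.card (EdgeOrdering n) := by
  have := nonempty_edgeOrdering n
  exact_mod_cast Fintype.card_pos

theorem processProb_eq_exp (A : EdgeOrdering n → Prop) :
    processProb n A = processExp n (ind A) := by
  classical
  unfold processProb processExp ind
  rw [Nat.card_eq_fintype_card, Nat.card_eq_fintype_card, Fintype.card_subtype,
    Finset.sum_boole]

theorem processExp_mono {f g : EdgeOrdering n → ℝ} (h : ∀ σ, f σ ≤ g σ) :
    processExp n f ≤ processExp n g :=
  div_le_div_of_nonneg_right (sum_le_sum fun σ _ => h σ) (card_edgeOrdering_pos n).le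

theorem processExp_sum {ι : Type*} (s : Finset ι) (f : ι → EdgeOrdering n → ℝ) :
    processExp n (fun σ => ∑ i ∈ s, f i σ) = ∑ i ∈ s, processExp n (f i) := by
  unfold processExp
  rw [sum_comm, sum_div]

theorem processExp_const_mul (c : ℝ) (f : EdgeOrdering n → ℝ) :
    processExp n (fun σ => c * f σ) = c * processExp n f := by
  unfold processExp
  rw [← mul_sum, mul_div_assoc]

theorem processExp_const (c : ℝ) : processExp n (fun _ => c) = c := by
  unfold processExp
  rw [sum_const, card_univ, nsmul_eq_mul, mul_div_cancel_left₀ _ (card_edgeOrdering_pos n).ne']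

theorem processExp_add (f g : EdgeOrdering n → ℝ) :
    processExp n (fun σ => f σ + g σ) = processExp n f + processExp n g := by
  unfold processExp
  rw [sum_add_distrib, add_div]

theorem processProb_nonneg (A : EdgeOrdering n → Prop) : 0 ≤ processProb n A := by
  unfold processProb; positivity

theorem processProb_mono {A B : EdgeOrdering n → Prop} (h : ∀ σ, A σ → B σ) :
    processProb n A ≤ processProb n B := by
  rw [processProb_eq_exp, processProb_eq_exp]
  refine processExp_mono fun σ => ?_
  unfold ind
  split_ifs with h1 h2 h2
  · exact le_rfl
  · exact absurd (h σ h1) h2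
  · norm_num
  · exact le_rfl

theorem processProb_true : processProb n (fun _ => True) = 1 := by
  rw [processProb_eq_exp]
  exact (congrArg _ (funext fun _ => if_pos trivial)).trans (processExp_const 1)

theorem processProb_le_one (A : EdgeOrdering n → Prop) : processProb n A ≤ 1 :=
  (processProb_mono fun _ _ => trivial).trans_eq processProb_true

theorem processProb_or_le (A B : EdgeOrdering n → Prop) :
    processProb n (fun σ => A σ ∨ B σ) ≤ processProb n A + processProb n B := by
  rw [processProb_eq_exp, processProb_eq_exp, processProb_eq_exp, ← processExp_add]
  refine processExp_mono fun σ => ?_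
  unfold ind
  by_cases hA : A σ <;> by_cases hB : B σ <;> simp [hA, hB]

theorem processProb_add_not (A : EdgeOrdering n → Prop) :
    processProb n A + processProb n (fun σ => ¬ A σ) = 1 := by
  rw [processProb_eq_exp, processProb_eq_exp, ← processExp_add]
  convert processExp_const (n := n) 1 with σ
  unfold ind
  by_cases hA : A σ <;> simp [hA]

theorem processProb_exists_le {ι : Type*} (s : Finset ι) (A : ι → EdgeOrdering n → Prop) :
    processProb n (fun σ => ∃ i ∈ s, A i σ) ≤ ∑ i ∈ s, processProb n (A i) := by
  classical
  induction s using Finset.induction_on with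
  | empty => simp [processProb]
  | insert a s ha ih =>
    rw [sum_insert ha]
    calc processProb n (fun σ => ∃ i ∈ insert a s, A i σ)
        ≤ processProb n (fun σ => A a σ ∨ ∃ i ∈ s, A i σ) := processProb_mono fun σ => by
          rintro ⟨i, hi, h⟩
          rcases mem_insert.1 hi with rfl | hi
          · exact Or.inl h
          · exact Or.inr ⟨i, hi, h⟩
      _ ≤ _ := (processProb_or_le _ _).trans (by gcongr)

theorem processProb_exists_le_card_mul {ι : Type*} (s : Finset ι)
    (A : ι → EdgeOrdering n → Prop) {p : ℝ} (hp : ∀ i ∈ s, processProb n (A i) ≤ p) :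
    processProb n (fun σ => ∃ i ∈ s, A i σ) ≤ #s * p :=
  (processProb_exists_le s A).trans ((sum_le_card_nsmul s _ p hp).trans_eq (nsmul_eq_mul _ _))

theorem card_edge (n : ℕ) : Fintype.card (Edge n) = n.choose 2 := by
  classical
  obtain ⟨σ⟩ := nonempty_edgeOrdering n
  rw [← Fintype.card_congr σ, Fintype.card_fin]

/-- Revealing the position of one more edge: the position of `e` is equally likely to be that of
any other edge outside of `S`, if the event `C` does not distinguish the edges outside of `S`. -/
theorem processProb_reveal (C : EdgeOrdering n → Prop) (S : Finset (Edge n))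
    (hC : ∀ σ, C σ → ∀ e ∉ S, ∀ e' ∉ S, C (σ.trans (Equiv.swap e e')))
    (A : Fin (n.choose 2) → Prop) [DecidablePred A] {e : Edge n} (he : e ∉ S) :
    ((n.choose 2 : ℝ) - #S) * processProb n (fun σ => C σ ∧ A (σ.symm e)) =
      processExp n (fun σ => ind C σ * #{e' | e' ∉ S ∧ A (σ.symm e')}) := by
  classical
  have h1 : ∀ e' ∉ S, processProb n (fun σ => C σ ∧ A (σ.symm e')) =
      processProb n (fun σ => C σ ∧ A (σ.symm e)) := by
    intro e' he'
    have key : ∀ a ∉ S, ∀ b ∉ S, ∀ σ : EdgeOrdering n, (C σ ∧ A (σ.symm a)) →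
        C (σ.trans (Equiv.swap a b)) ∧ A ((σ.trans (Equiv.swap a b)).symm b) := by
      intro a ha b hb σ h
      refine ⟨hC σ h.1 a ha b hb, ?_⟩
      simpa [Equiv.symm_trans_apply] using h.2
    unfold processProb
    congr 2
    refine Nat.card_congr
      ⟨fun σ => ⟨σ.1.trans (Equiv.swap e' e), key e' he' e he σ.1 σ.2⟩,
       fun σ => ⟨σ.1.trans (Equiv.swap e e'), key e he e' he' σ.1 σ.2⟩, ?_, ?_⟩
    · intro σ
      apply Subtype.ext
      ext i
      simp [Equiv.swap_comm e' e]
    · intro σ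
      apply Subtype.ext
      ext i
      simp [Equiv.swap_comm e' e]
  have h2 : ∀ σ, ind C σ * (#{e' | e' ∉ S ∧ A (σ.symm e')} : ℝ) =
      ∑ e' ∈ Sᶜ, ind (fun σ => C σ ∧ A (σ.symm e')) σ := by
    intro σ
    have : #{e' | e' ∉ S ∧ A (σ.symm e')} = #{e' ∈ Sᶜ | A (σ.symm e')} := by
      congr 1
      ext e'
      simp
    rw [this, card_filter, Nat.cast_sum, mul_sum]
    refine sum_congr rfl fun e' _ => ?_
    unfold ind
    by_cases hCσ : C σ <;> by_cases hA : A (σ.symm e') <;> simp [hCσ, hA]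
  simp only [h2]
  rw [processExp_sum]
  simp only [← processProb_eq_exp]
  rw [sum_congr rfl fun e' he' => h1 e' (mem_compl.1 he'), sum_const, nsmul_eq_mul,
    card_compl, card_edge, Nat.cast_sub ((card_le_univ S).trans_eq (card_edge n))]

theorem processProb_reveal_le (C : EdgeOrdering n → Prop) (S : Finset (Edge n))
    (hC : ∀ σ, C σ → ∀ e ∉ S, ∀ e' ∉ S, C (σ.trans (Equiv.swap e e')))
    (A : Fin (n.choose 2) → Prop) [DecidablePred A] {e : Edge n} (he : e ∉ S) {b : ℝ}
    (hb : ∀ σ, C σ → (#{e' | e' ∉ S ∧ A (σ.symm e')} : ℝ) ≤ b) :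
    ((n.choose 2 : ℝ) - #S) * processProb n (fun σ => C σ ∧ A (σ.symm e)) ≤
      b * processProb n C := by
  rw [processProb_reveal C S hC A he, processProb_eq_exp, ← processExp_const_mul]
  refine processExp_mono fun σ => ?_
  by_cases hCσ : C σ
  · simpa [ind, hCσ] using hb σ hCσ
  · simp [ind, hCσ]

theorem processProb_reveal_eq (C : EdgeOrdering n → Prop) (S : Finset (Edge n))
    (hC : ∀ σ, C σ → ∀ e ∉ S, ∀ e' ∉ S, C (σ.trans (Equiv.swap e e')))
    (A : Fin (n.choose 2) → Prop) [DecidablePred A] {e : Edge n} (he : e ∉ S) {b : ℝ}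
    (hb : ∀ σ, C σ → (#{e' | e' ∉ S ∧ A (σ.symm e')} : ℝ) = b) :
    ((n.choose 2 : ℝ) - #S) * processProb n (fun σ => C σ ∧ A (σ.symm e)) =
      b * processProb n C := by
  rw [processProb_reveal C S hC A he, processProb_eq_exp, ← processExp_const_mul]
  congr 1
  funext σ
  by_cases hCσ : C σ
  · simpa [ind, hCσ] using hb σ hCσ
  · simp [ind, hCσ]

/-- The edges of `F` are present at time `m`. -/
def Early (F : Finset (Edge n)) (m : ℕ) (σ : EdgeOrdering n) : Prop :=
  ∀ e ∈ F, (σ.symm e : ℕ) < m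

/-- The edges of `R` are missing at time `m`. -/
def Late (R : Finset (Edge n)) (m : ℕ) (σ : EdgeOrdering n) : Prop :=
  ∀ e ∈ R, m ≤ (σ.symm e : ℕ)

/-- Supplies the invariance under swaps outside `S` that `processProb_reveal` requires. -/
theorem early_swap {F S : Finset (Edge n)} {m : ℕ} (hFS : F ⊆ S) {σ : EdgeOrdering n}
    (h : Early F m σ) {e e' : Edge n} (he : e ∉ S) (he' : e' ∉ S) [DecidableEq (Edge n)] :
    Early F m (σ.trans (Equiv.swap e e')) := fun a ha => by
  rw [Equiv.symm_trans_apply, Equiv.symm_swap, Equiv.swap_apply_of_ne_of_ne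
    (by rintro rfl; exact he (hFS ha)) (by rintro rfl; exact he' (hFS ha))]
  exact h a ha

theorem late_swap {R S : Finset (Edge n)} {m : ℕ} (hRS : R ⊆ S) {σ : EdgeOrdering n}
    (h : Late R m σ) {e e' : Edge n} (he : e ∉ S) (he' : e' ∉ S) [DecidableEq (Edge n)] :
    Late R m (σ.trans (Equiv.swap e e')) := fun a ha => by
  rw [Equiv.symm_trans_apply, Equiv.symm_swap, Equiv.swap_apply_of_ne_of_ne
    (by rintro rfl; exact he (hRS ha)) (by rintro rfl; exact he' (hRS ha))]
  exact h a ha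

theorem card_early (σ : EdgeOrdering n) {m : ℕ} (hm : m ≤ n.choose 2) :
    #{e : Edge n | (σ.symm e : ℕ) < m} = m := by
  classical
  have : #{e : Edge n | (σ.symm e : ℕ) < m} = #{i : Fin (n.choose 2) | (i : ℕ) < m} :=
    card_nbij' σ.symm σ (fun e he => by simpa using he) (fun i hi => by simpa using hi)
      (fun e _ => by simp) (fun i _ => by simp)
  rw [this, Fin.card_filter_val_lt, min_eq_right hm]

theorem card_late (σ : EdgeOrdering n) {m : ℕ} (hm : m ≤ n.choose 2) :
    #{e : Edge n | m ≤ (σ.symm e : ℕ)} + m = n.choose 2 := by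
  have h1 := card_early σ hm
  have h2 := card_filter_add_card_filter_not (s := (univ : Finset (Edge n)))
    (fun e => (σ.symm e : ℕ) < m)
  simp only [not_lt] at h2
  rw [card_univ, card_edge, h1] at h2
  omega

theorem card_early_le (σ : EdgeOrdering n) (m : ℕ) :
    #{e : Edge n | (σ.symm e : ℕ) < m} ≤ m := by
  rcases le_total m (n.choose 2) with h | h
  · exact (card_early σ h).le
  · exact (card_le_univ _).trans ((card_edge n).trans_le h)

/-- A given set of edges is unlikely to be present. -/
theorem processProb_early_le (F : Finset (Edge n)) (m : ℕ) (hF : 2 * #F ≤ n.choose 2) :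
    processProb n (Early F m) ≤ (2 * m / (n.choose 2 : ℝ)) ^ #F := by
  classical
  induction F using Finset.induction_on with
  | empty => simpa using processProb_le_one _
  | insert e F he ih =>
    rw [card_insert_of_notMem he] at hF ⊢
    have ih := ih (by omega)
    have h1 := processProb_reveal_le (Early F m) F
      (fun σ h e he e' he' => early_swap subset_rfl h he he') (fun i => (i : ℕ) < m) he
      (b := m) (fun σ _ => by
        exact_mod_cast (card_le_card fun e' he' => by
          rw [mem_filter_univ] at he' ⊢; exact he'.2).trans (card_early_le σ m))
    have h2 : processProb n (Early (insert e F) m) =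
        processProb n (fun σ => Early F m σ ∧ ((σ.symm e : Fin _) : ℕ) < m) := by
      congr 1
      funext σ
      simp only [Early, forall_mem_insert, and_comm]
    rw [h2]
    set P := processProb n (fun σ => Early F m σ ∧ ((σ.symm e : Fin _) : ℕ) < m)
    have hN : (0 : ℝ) < n.choose 2 := by
      exact_mod_cast (show 0 < n.choose 2 by omega)
    have hF' : 2 * (#F : ℝ) ≤ n.choose 2 := by
      exact_mod_cast (show 2 * #F ≤ n.choose 2 by omega)
    have hP0 : 0 ≤ P := processProb_nonneg _
    -- At most half of the edges have been revealed, so the conditional probability `m / (N - #F)`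
    -- is at most `2 * m / N`.
    have h3 : P * (n.choose 2 : ℝ) ≤ 2 * m * processProb n (Early F m) := by nlinarith
    have h4 : P ≤ 2 * m / (n.choose 2 : ℝ) * processProb n (Early F m) := by
      rw [div_mul_eq_mul_div, le_div_iff₀ hN]
      exact h3
    rw [pow_succ']
    exact h4.trans (mul_le_mul_of_nonneg_left ih (by positivity))

/-- With `N` edges in total, given the event for `F` and `R`, a further edge is late with
probability at most `(N - m - #R) / (N - #F - #R)`, hence at most `1 - (m - #F) / N`. The times `m'`
and `m` are separate because path edges are looked for at a later time than small degrees. -/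
theorem processProb_early_late_le (F R : Finset (Edge n)) {m m' : ℕ} (hFR : Disjoint F R)
    (hFm : #F ≤ m) (hm : m ≤ n.choose 2) :
    processProb n (fun σ => Early F m' σ ∧ Late R m σ) ≤
      (1 - ((m : ℝ) - #F) / n.choose 2) ^ #R * processProb n (Early F m') := by
  classical
  induction R using Finset.induction_on with
  | empty =>
    rw [card_empty, pow_zero, one_mul]
    exact processProb_mono fun σ h => h.1
  | insert e R he ih =>
    rw [disjoint_insert_right] at hFR
    have ih := ih hFR.2
    rw [card_insert_of_notMem he]
    have heS : e ∉ F ∪ R := by simp [hFR.1, he]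
    have h1 := processProb_reveal_le (fun σ => Early F m' σ ∧ Late R m σ) (F ∪ R)
      (fun σ h e he e' he' => ⟨early_swap subset_union_left h.1 he he',
        late_swap subset_union_right h.2 he he'⟩) (fun i => m ≤ (i : ℕ)) heS
      (b := n.choose 2 - m - #R) (fun σ hσ => by
        have h2 : #{e' | e' ∉ F ∪ R ∧ m ≤ (σ.symm e' : ℕ)} + #R ≤
            #{e' | m ≤ (σ.symm e' : ℕ)} := by
          rw [← card_union_of_disjoint]
          · refine card_le_card fun e' he' => ?_
            rw [mem_union, mem_filter_univ] at he'
            rw [mem_filter_univ]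
            exact he'.elim (fun h => h.2) fun h => hσ.2 _ h
          · refine disjoint_left.2 fun e' he' hR => ?_
            rw [mem_filter_univ] at he'
            exact he'.1 (mem_union_right _ hR)
        have h3 := card_late σ hm
        have h4 : (#{e' | e' ∉ F ∪ R ∧ m ≤ (σ.symm e' : ℕ)} : ℝ) + #R + m ≤ n.choose 2 := by
          exact_mod_cast (by omega)
        linarith)
    have h2 : processProb n (fun σ => Early F m' σ ∧ Late (insert e R) m σ) =
        processProb n (fun σ => (Early F m' σ ∧ Late R m σ) ∧ m ≤ ((σ.symm e : Fin _) : ℕ)) := by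
      congr 1
      funext σ
      simp only [Late, forall_mem_insert, eq_iff_iff]
      tauto
    rw [h2]
    set P := processProb n
      (fun σ => (Early F m' σ ∧ Late R m σ) ∧ m ≤ ((σ.symm e : Fin _) : ℕ))
    set Q := processProb n (fun σ => Early F m' σ ∧ Late R m σ)
    have hcard : #F + #R + 1 ≤ n.choose 2 := by
      rw [← card_union_of_disjoint hFR.2, ← card_insert_of_notMem heS, ← card_edge]
      exact card_le_univ _
    rw [card_union_of_disjoint hFR.2, Nat.cast_add] at h1
    have hcard' : (#F : ℝ) + #R + 1 ≤ n.choose 2 := by exact_mod_cast hcard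
    have hFm' : (#F : ℝ) ≤ m := by exact_mod_cast hFm
    have hm' : (m : ℝ) ≤ n.choose 2 := by exact_mod_cast hm
    have hN : (0 : ℝ) < n.choose 2 := by
      have : (0 : ℝ) ≤ (#F : ℝ) + #R := by positivity
      linarith
    have hQ : 0 ≤ Q := processProb_nonneg _
    set x := ((m : ℝ) - #F) / n.choose 2 with hx
    have hx0 : 0 ≤ x := div_nonneg (by linarith) hN.le
    have hxN : x * n.choose 2 = (m : ℝ) - #F := div_mul_cancel₀ _ hN.ne'
    have hx1 : x ≤ 1 := by
      rw [hx, div_le_one hN]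
      have : (0 : ℝ) ≤ #F := by positivity
      linarith
    have h3 : P ≤ (1 - x) * Q := by
      have hpos : 0 < (n.choose 2 : ℝ) - (#F + #R) := by linarith
      refine le_of_mul_le_mul_left (h1.trans ?_) hpos
      rw [← mul_assoc]
      refine mul_le_mul_of_nonneg_right ?_ hQ
      have : 0 ≤ x * (#F + #R : ℝ) := by positivity
      linarith
    calc P ≤ (1 - x) * Q := h3
      _ ≤ (1 - x) * ((1 - x) ^ #R * processProb n (Early F m')) :=
        mul_le_mul_of_nonneg_left ih (by linarith)
      _ = _ := by ring

/-- The expected value of `(1/8) ^ X` for the number `X` of edges of `F'` at time `m`. -/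
theorem processProb_early_few_le (F F' : Finset (Edge n)) {m m' : ℕ} (k : ℕ)
    (hF : Disjoint F F') (hFm : #F ≤ m) (hm : m ≤ n.choose 2) :
    processProb n (fun σ => Early F m' σ ∧ #{e ∈ F' | (σ.symm e : ℕ) < m} ≤ k) ≤
      8 ^ k * (1 - 7 / 8 * (((m : ℝ) - #F) / n.choose 2)) ^ #F' * processProb n (Early F m') := by
  classical
  set x := ((m : ℝ) - #F) / n.choose 2 with hx
  have h1 : ∀ σ : EdgeOrdering n,
      ind (fun σ => Early F m' σ ∧ #{e ∈ F' | (σ.symm e : ℕ) < m} ≤ k) σ ≤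
      8 ^ k * ∑ R ∈ F'.powerset, (7 / 8 : ℝ) ^ #R * (1 / 8) ^ (#F' - #R) *
        ind (fun σ => Early F m' σ ∧ Late R m σ) σ := by
    intro σ
    by_cases h : Early F m' σ ∧ #{e ∈ F' | (σ.symm e : ℕ) < m} ≤ k
    · set L := F'.filter fun e => m ≤ (σ.symm e : ℕ) with hL
      set X := #{e ∈ F' | (σ.symm e : ℕ) < m} with hX
      have hsplit : X + #L = #F' := by
        have := card_filter_add_card_filter_not (s := F') (fun e => (σ.symm e : ℕ) < m)
        simpa only [not_lt] using this
      -- Expansion of the product of `1/8 + (7/8) * [e late]` over `e ∈ F'`: only subsets `R` of the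
      -- late edges `L` contribute.
      have h2 : (1 / 8 : ℝ) ^ X ≤ ∑ R ∈ F'.powerset, (7 / 8 : ℝ) ^ #R * (1 / 8) ^ (#F' - #R) *
          ind (fun σ => Early F m' σ ∧ Late R m σ) σ := by
        calc (1 / 8 : ℝ) ^ X
            = (1 / 8) ^ X * ∑ R ∈ L.powerset, (7 / 8 : ℝ) ^ #R * (1 / 8) ^ (#L - #R) := by
              rw [Finset.sum_pow_mul_eq_add_pow]; norm_num
          _ = ∑ R ∈ L.powerset, (7 / 8 : ℝ) ^ #R * (1 / 8) ^ (#F' - #R) *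
                ind (fun σ => Early F m' σ ∧ Late R m σ) σ := by
              rw [mul_sum]
              refine sum_congr rfl fun R hR => ?_
              rw [mem_powerset] at hR
              have hc := card_le_card hR
              have : ind (fun σ => Early F m' σ ∧ Late R m σ) σ = 1 :=
                if_pos ⟨h.1, fun e he => (mem_filter.1 (hR he)).2⟩
              rw [this, mul_one, show #F' - #R = X + (#L - #R) by omega, pow_add]
              ring
          _ ≤ _ := sum_le_sum_of_subset_of_nonneg
              (powerset_mono.2 (filter_subset _ _))
              fun R _ _ => mul_nonneg (by positivity) (ind_nonneg _ _)
      have h3 : ind (fun σ => Early F m' σ ∧ #{e ∈ F' | (σ.symm e : ℕ) < m} ≤ k) σ = 1 :=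
        if_pos h
      rw [h3]
      refine le_trans ?_ (mul_le_mul_of_nonneg_left h2 (by positivity))
      rw [one_div, inv_pow, ← div_eq_mul_inv, one_le_div (by positivity)]
      exact pow_le_pow_right₀ (by norm_num) h.2
    · have h3 : ind (fun σ => Early F m' σ ∧ #{e ∈ F' | (σ.symm e : ℕ) < m} ≤ k) σ = 0 :=
        if_neg h
      rw [h3]
      exact mul_nonneg (by positivity) (sum_nonneg fun R _ =>
        mul_nonneg (by positivity) (ind_nonneg _ _))
  rw [processProb_eq_exp]
  refine (processExp_mono h1).trans ?_
  rw [processExp_const_mul, processExp_sum, mul_assoc]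
  refine mul_le_mul_of_nonneg_left ?_ (by positivity)
  calc ∑ R ∈ F'.powerset, processExp n (fun σ => (7 / 8 : ℝ) ^ #R * (1 / 8) ^ (#F' - #R) *
        ind (fun σ => Early F m' σ ∧ Late R m σ) σ)
      ≤ ∑ R ∈ F'.powerset, (7 / 8 * (1 - x)) ^ #R * (1 / 8) ^ (#F' - #R) *
          processProb n (Early F m') := by
        refine sum_le_sum fun R hR => ?_
        rw [processExp_const_mul, ← processProb_eq_exp]
        refine (mul_le_mul_of_nonneg_left (processProb_early_late_le F R
          (hF.mono_right (mem_powerset.1 hR)) hFm hm) (by positivity)).trans_eq ?_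
        rw [mul_pow]
        ring
    _ = _ := by
        rw [← sum_mul, Finset.sum_pow_mul_eq_add_pow]
        congr 2
        ring

/-- The exact probability that a set of edges is missing. -/
theorem processProb_late (R : Finset (Edge n)) {m : ℕ} (hm : m ≤ n.choose 2) :
    processProb n (Late R m) =
      ∏ i ∈ range #R, (((n.choose 2 : ℝ) - m - i) / ((n.choose 2 : ℝ) - i)) := by
  classical
  induction R using Finset.induction_on with
  | empty =>
    rw [card_empty, range_zero, prod_empty, ← processProb_true (n := n)]
    congr 1
    funext σ
    simp [Late]
  | insert e R he ih =>
    rw [card_insert_of_notMem he, prod_range_succ, ← ih]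
    have h1 := processProb_reveal_eq (Late R m) R
      (fun σ h e he e' he' => late_swap subset_rfl h he he') (fun i => m ≤ (i : ℕ)) he
      (b := n.choose 2 - m - #R) (fun σ hσ => by
        have h2 : #{e' | e' ∉ R ∧ m ≤ (σ.symm e' : ℕ)} + #R = #{e' | m ≤ (σ.symm e' : ℕ)} := by
          rw [← card_union_of_disjoint]
          · congr 1
            ext e'
            rw [mem_union, mem_filter_univ, mem_filter_univ]
            by_cases he' : e' ∈ R
            · simp [he', hσ e' he']
            · simp [he']
          · refine disjoint_left.2 fun e' he' hR => ?_
            rw [mem_filter_univ] at he'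
            exact he'.1 hR
        have h3 := card_late σ hm
        have h4 : (#{e' | e' ∉ R ∧ m ≤ (σ.symm e' : ℕ)} : ℝ) + #R + m = n.choose 2 := by
          exact_mod_cast (by omega)
        linarith)
    have h2 : processProb n (Late (insert e R) m) =
        processProb n (fun σ => Late R m σ ∧ m ≤ ((σ.symm e : Fin _) : ℕ)) := by
      congr 1
      funext σ
      simp only [Late, forall_mem_insert, and_comm]
    rw [h2]
    have hcard : #R + 1 ≤ n.choose 2 := by
      rw [← card_insert_of_notMem he, ← card_edge]
      exact card_le_univ _
    have hcard' : (#R : ℝ) + 1 ≤ n.choose 2 := by exact_mod_cast hcard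
    rw [mul_div_assoc', eq_div_iff (by linarith), mul_comm, h1, mul_comm]

end EdgeProbabilities

/-! ### Unlikely events of the random graph process -/

section Events

open Finset

variable {n : ℕ}

/-- The edge between two distinct vertices. -/
def mkEdge {u v : Fin n} (h : u ≠ v) : Edge n := ⟨s(u, v), h⟩

theorem processGraph_adj {σ : EdgeOrdering n} {m : ℕ} {u v : Fin n} :
    (processGraph σ m).Adj u v ↔ ∃ h : u ≠ v, (σ.symm (mkEdge h) : ℕ) < m := by
  rw [processGraph, SimpleGraph.fromEdgeSet_adj]
  constructor
  · rintro ⟨⟨i, hi, hie⟩, h⟩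
    refine ⟨h, ?_⟩
    have : σ i = mkEdge h := Subtype.ext hie
    rwa [← this, Equiv.symm_apply_apply]
  · rintro ⟨h, hlt⟩
    exact ⟨⟨_, hlt, by rw [Equiv.apply_symm_apply]; rfl⟩, h⟩

theorem processGraph_mono (σ : EdgeOrdering n) {m m' : ℕ} (h : m ≤ m') :
    processGraph σ m ≤ processGraph σ m' := fun u v huv => by
  rw [processGraph_adj] at huv ⊢
  exact huv.imp fun _ hlt => hlt.trans_le h

/-- The edges at a vertex. -/
def star (v : Fin n) : Finset (Edge n) := by
  classical exact univ.filter fun e => v ∈ (e : Sym2 (Fin n))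

theorem mem_star {v : Fin n} {e : Edge n} : e ∈ star v ↔ v ∈ (e : Sym2 (Fin n)) := by
  simp [star]

theorem card_star_filter (v : Fin n) (P : Edge n → Prop) [DecidablePred P]
    [DecidablePred fun w : Fin n => ∃ h : v ≠ w, P (mkEdge h)] :
    #{e ∈ star v | P e} = #{w : Fin n | ∃ h : v ≠ w, P (mkEdge h)} := by
  symm
  refine card_bij (fun w hw => mkEdge (mem_filter.1 hw).2.choose) ?_ ?_ ?_
  · intro w hw
    obtain ⟨h, hP⟩ := (mem_filter.1 hw).2
    exact mem_filter.2 ⟨mem_star.2 (Sym2.mem_mk_left v w), hP⟩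
  · intro w hw w' hw' h
    exact Sym2.congr_right.1 (congrArg Subtype.val h)
  · rintro ⟨e, he⟩ h
    rw [mem_filter, mem_star] at h
    obtain ⟨w, rfl⟩ := Sym2.mem_iff_exists.1 h.1
    exact ⟨w, mem_filter.2 ⟨mem_univ _, he, h.2⟩, rfl⟩

theorem card_star (v : Fin n) : #(star v) = n - 1 := by
  classical
  have := card_star_filter v fun _ => True
  rw [filter_true] at this
  have h2 : (univ.filter fun w : Fin n => ∃ _ : v ≠ w, True) = univ.erase v := by
    ext w
    simp [eq_comm]
  rw [this, h2, card_erase_of_mem (mem_univ v), card_univ, Fintype.card_fin]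

theorem card_star_inter {u v : Fin n} (h : u ≠ v) [DecidableEq (Edge n)] :
    #(star u ∩ star v) = 1 := by
  rw [card_eq_one]
  refine ⟨mkEdge h, ?_⟩
  ext ⟨e, he⟩
  rw [mem_inter, mem_star, mem_star, mem_singleton, Sym2.mem_and_mem_iff h]
  exact ⟨fun h' => Subtype.ext h', fun h' => congrArg Subtype.val h'⟩

theorem card_star_union {u v : Fin n} (h : u ≠ v) [DecidableEq (Edge n)] :
    #(star u ∪ star v) + 3 = 2 * n := by
  have h1 := card_union_add_card_inter (star u) (star v)
  rw [card_star_inter h, card_star, card_star] at h1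
  have h2 : 2 ≤ n := by
    by_contra hn
    exact h (Fin.ext (by omega))
  omega

/-- The degree of a vertex at time `m`. -/
def degAt (σ : EdgeOrdering n) (m : ℕ) (v : Fin n) : ℕ := #{e ∈ star v | (σ.symm e : ℕ) < m}

theorem degree_processGraph (σ : EdgeOrdering n) (m : ℕ) (v : Fin n)
    [DecidableRel (processGraph σ m).Adj] : (processGraph σ m).degree v = degAt σ m v := by
  classical
  rw [degAt, card_star_filter, ← SimpleGraph.card_neighborFinset_eq_degree]
  congr 1
  ext w
  rw [SimpleGraph.mem_neighborFinset, processGraph_adj, mem_filter_univ]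

theorem degAt_mono (σ : EdgeOrdering n) {m m' : ℕ} (h : m ≤ m') (v : Fin n) :
    degAt σ m v ≤ degAt σ m' v :=
  card_le_card (monotone_filter_right _ fun _ _ hlt => lt_of_lt_of_le hlt h)

theorem hasMinDegree_processGraph (hn : 0 < n) (σ : EdgeOrdering n) (m d : ℕ) :
    HasMinDegree (processGraph σ m) d ↔ ∀ v, d ≤ degAt σ m v := by
  classical
  have : Nonempty (Fin n) := ⟨⟨0, hn⟩⟩
  unfold HasMinDegree
  constructor
  · intro h v
    rw [← degree_processGraph]
    exact h.trans (SimpleGraph.minDegree_le_degree _ v)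
  · intro h
    refine SimpleGraph.le_minDegree_of_forall_le_degree _ _ fun v => ?_
    rw [degree_processGraph]
    exact h v

/-- A vertex has small degree with small probability. -/
theorem processProb_exists_degAt_le {m : ℕ} (k : ℕ) (hm : m ≤ n.choose 2) :
    processProb n (fun σ => ∃ v, degAt σ m v ≤ k) ≤
      n * (8 ^ k * (1 - 7 / 8 * ((m : ℝ) / n.choose 2)) ^ (n - 1)) := by
  classical
  have h := processProb_exists_le_card_mul (univ : Finset (Fin n))
    (fun v σ => degAt σ m v ≤ k) (p := 8 ^ k * (1 - 7 / 8 * ((m : ℝ) / n.choose 2)) ^ (n - 1))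
    (fun v _ => by
      have h1 := processProb_early_few_le (∅ : Finset (Edge n)) (star v) (m := m) (m' := 0) k
        (disjoint_empty_left _) (by simp) hm
      have h2 : processProb n (Early ∅ 0) = 1 := by
        rw [← processProb_true (n := n)]
        congr 1
        funext σ
        simp [Early]
      rw [h2, card_star, card_empty, Nat.cast_zero, sub_zero, mul_one] at h1
      refine le_trans (processProb_mono fun σ hσ => ?_) h1
      exact ⟨by simp [Early], hσ⟩)
  simpa using h

/-- A vertex has large degree with small probability. -/
theorem processProb_exists_lt_degAt {m Δ : ℕ} (hΔ : 2 * Δ ≤ n.choose 2) :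
    processProb n (fun σ => ∃ v, Δ ≤ degAt σ m v) ≤
      n * ((n - 1).choose Δ * (2 * m / (n.choose 2 : ℝ)) ^ Δ) := by
  classical
  have h := processProb_exists_le_card_mul (univ : Finset (Fin n))
    (fun v σ => Δ ≤ degAt σ m v) (p := (n - 1).choose Δ * (2 * m / (n.choose 2 : ℝ)) ^ Δ)
    (fun v _ => by
      have h1 := processProb_exists_le_card_mul ((star v).powersetCard Δ)
        (fun F σ => Early F m σ) (p := (2 * m / (n.choose 2 : ℝ)) ^ Δ) (fun F hF => by
          rw [mem_powersetCard] at hF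
          have := processProb_early_le F m (by rw [hF.2]; exact hΔ)
          rwa [hF.2] at this)
      rw [card_powersetCard, card_star] at h1
      refine le_trans (processProb_mono fun σ hσ => ?_) h1
      obtain ⟨F, hF, hFc⟩ := exists_subset_card_eq hσ
      refine ⟨F, mem_powersetCard.2 ⟨hF.trans (filter_subset _ _), hFc⟩, fun e he => ?_⟩
      exact (mem_filter.1 (hF he)).2)
  simpa using h

/-- The edges inside a set of vertices. -/
def inner (T : Finset (Fin n)) : Finset (Edge n) := by
  classical exact univ.filter fun e => ∀ v ∈ (e : Sym2 (Fin n)), v ∈ T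

theorem mem_inner {T : Finset (Fin n)} {e : Edge n} :
    e ∈ inner T ↔ ∀ v ∈ (e : Sym2 (Fin n)), v ∈ T := by
  simp [inner]

theorem card_inner_le (T : Finset (Fin n)) : #(inner T) ≤ (#T).choose 2 := by
  classical
  rw [← Sym2.card_image_offDiag]
  refine card_le_card_of_injOn Subtype.val (fun e he => ?_) Subtype.val_injective.injOn
  obtain ⟨e, hne⟩ := e
  induction e with
  | h u v =>
    rw [mem_coe, mem_inner] at he
    rw [mem_coe, mem_image]
    exact ⟨(u, v), mem_offDiag.2 ⟨he u (Sym2.mem_mk_left u v), he v (Sym2.mem_mk_right u v), hne⟩,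
      rfl⟩

open Classical in
theorem sum_degree_inside_le (σ : EdgeOrdering n) (m : ℕ) (T : Finset (Fin n)) :
    ∑ u ∈ T, #{w ∈ T | (processGraph σ m).Adj u w} ≤
      2 * #{e ∈ inner T | (σ.symm e : ℕ) < m} := by
  set I := (inner T).filter fun e => (σ.symm e : ℕ) < m with hI
  calc ∑ u ∈ T, #{w ∈ T | (processGraph σ m).Adj u w}
      ≤ ∑ u ∈ T, #(I.filter fun e : Edge n => u ∈ (e : Sym2 (Fin n))) := by
        refine sum_le_sum fun u hu => ?_
        have h1 : #(I.filter fun e : Edge n => u ∈ (e : Sym2 (Fin n))) = #{e ∈ star u | e ∈ I} := by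
          congr 1
          ext e
          simp only [mem_filter, mem_star, and_comm]
        rw [h1, card_star_filter]
        refine card_le_card fun w hw => ?_
        rw [mem_filter, processGraph_adj] at hw
        obtain ⟨hwT, h, hlt⟩ := hw
        refine mem_filter.2 ⟨mem_univ _, h, mem_filter.2 ⟨mem_inner.2 fun x hx => ?_, hlt⟩⟩
        rcases Sym2.mem_iff.1 hx with rfl | rfl
        exacts [hu, hwT]
    _ = ∑ e ∈ I, #{u ∈ T | u ∈ (e : Sym2 (Fin n))} := by
        simp only [card_filter]
        rw [sum_comm]
    _ ≤ ∑ e ∈ I, 2 := by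
        refine sum_le_sum fun e _ => ?_
        obtain ⟨e, he⟩ := e
        induction e with
        | h u v =>
          refine (card_le_card fun w hw => ?_).trans (card_le_two (a := u) (b := v))
          simpa using (mem_filter.1 hw).2
    _ = 2 * #I := by rw [sum_const, smul_eq_mul, mul_comm]

end Events

/-! ### Dense sets, unjoined pairs, short paths between low-degree vertices, isolated vertices. -/

section MoreEvents

open Finset

variable {n : ℕ}

open Classical in
/-- Some small set of vertices spans many edges with small probability. -/
theorem processProb_dense_le {m b κ : ℕ} (hb : 2 * (κ * b) ≤ n.choose 2) :
    processProb n (fun σ => ∃ T : Finset (Fin n), T.Nonempty ∧ #T ≤ b ∧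
      2 * κ * #T ≤ ∑ u ∈ T, #{w ∈ T | (processGraph σ m).Adj u w}) ≤
    ∑ t ∈ Icc 1 b, (n.choose t : ℝ) *
      (((t.choose 2).choose (κ * t) : ℕ) * (2 * m / (n.choose 2 : ℝ)) ^ (κ * t)) := by
  have h1 := processProb_exists_le (Icc 1 b) fun t (σ : EdgeOrdering n) =>
    ∃ T ∈ (univ : Finset (Fin n)).powersetCard t, ∃ F ∈ (inner T).powersetCard (κ * t), Early F m σ
  refine (processProb_mono fun σ => ?_).trans (h1.trans (sum_le_sum fun t ht => ?_))
  · rintro ⟨T, hT, hTb, hsum⟩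
    have h2 := hsum.trans (sum_degree_inside_le σ m T)
    obtain ⟨F, hF, hFc⟩ := exists_subset_card_eq (s := {e ∈ inner T | (σ.symm e : ℕ) < m})
      (n := κ * #T) (by rw [mul_assoc] at h2; omega)
    refine ⟨#T, mem_Icc.2 ⟨card_pos.2 hT, hTb⟩, T, mem_powersetCard.2 ⟨subset_univ _, rfl⟩, F,
      mem_powersetCard.2 ⟨hF.trans (filter_subset _ _), hFc⟩, fun e he => ?_⟩
    exact (mem_filter.1 (hF he)).2
  · rw [mem_Icc] at ht
    have h3 := processProb_exists_le_card_mul ((univ : Finset (Fin n)).powersetCard t)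
      (fun T (σ : EdgeOrdering n) => ∃ F ∈ (inner T).powersetCard (κ * t), Early F m σ)
      (p := ((t.choose 2).choose (κ * t) : ℕ) * (2 * m / (n.choose 2 : ℝ)) ^ (κ * t))
      (fun T hT => by
        have h4 := processProb_exists_le_card_mul ((inner T).powersetCard (κ * t))
          (fun F σ => Early F m σ) (p := (2 * m / (n.choose 2 : ℝ)) ^ (κ * t)) (fun F hF => by
            rw [mem_powersetCard] at hF
            have h5 : κ * t ≤ κ * b := Nat.mul_le_mul_left _ ht.2
            have := processProb_early_le F m (by rw [hF.2]; omega)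
            rwa [hF.2] at this)
        refine h4.trans (mul_le_mul_of_nonneg_right ?_ (by positivity))
        rw [card_powersetCard]
        have h6 := card_inner_le T
        rw [(mem_powersetCard.1 hT).2] at h6
        exact_mod_cast Nat.choose_le_choose _ h6)
    rwa [card_powersetCard, card_univ, Fintype.card_fin] at h3

/-- The edges between two sets of vertices. -/
def cross (A B : Finset (Fin n)) : Finset (Edge n) := by
  classical exact univ.filter fun e => ∃ u ∈ A, ∃ w ∈ B, (e : Sym2 (Fin n)) = s(u, w)

theorem mem_cross {A B : Finset (Fin n)} {e : Edge n} :
    e ∈ cross A B ↔ ∃ u ∈ A, ∃ w ∈ B, (e : Sym2 (Fin n)) = s(u, w) := by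
  simp [cross]

theorem card_mul_card_le_card_cross {A B : Finset (Fin n)} (h : Disjoint A B) :
    #A * #B ≤ #(cross A B) := by
  classical
  rw [← card_product]
  have h1 : #((A ×ˢ B).image fun q => s(q.1, q.2)) = #(A ×ˢ B) := by
    refine card_image_of_injOn ?_
    rintro ⟨u, w⟩ hq ⟨u', w'⟩ hq' heq
    rw [mem_coe, mem_product] at hq hq'
    rcases Sym2.eq_iff.1 heq with ⟨h1, h2⟩ | ⟨h1, h2⟩
    · exact Prod.ext h1 h2
    · exact absurd hq'.2 (disjoint_left.1 h (h1 ▸ hq.1))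
  rw [← h1]
  refine (card_le_card fun e he => ?_).trans (card_image_le (s := cross A B) (f := Subtype.val))
  obtain ⟨⟨u, w⟩, hq, rfl⟩ := mem_image.1 he
  rw [mem_product] at hq
  have hne : u ≠ w := fun heq => disjoint_left.1 h hq.1 (heq ▸ hq.2)
  exact mem_image.2 ⟨mkEdge hne, mem_cross.2 ⟨u, hq.1, w, hq.2, rfl⟩, rfl⟩

/-- Two large sets of vertices are not joined by an edge with small probability. -/
theorem processProb_not_joined_le {m a : ℕ} (hm : m ≤ n.choose 2) :
    processProb n (fun σ => ∃ A B : Finset (Fin n), Disjoint A B ∧ a ≤ #A ∧ a ≤ #B ∧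
      ∀ u ∈ A, ∀ w ∈ B, ¬ (processGraph σ m).Adj u w) ≤
    (n.choose a : ℝ) * ((n.choose a : ℝ) * (1 - m / (n.choose 2 : ℝ)) ^ (a * a)) := by
  classical
  have hx1 : (0 : ℝ) ≤ 1 - m / (n.choose 2 : ℝ) := by
    rw [sub_nonneg]
    exact div_le_one_of_le₀ (by exact_mod_cast hm) (by positivity)
  have hx2 : 1 - m / (n.choose 2 : ℝ) ≤ 1 := sub_le_self _ (by positivity)
  have h1 := processProb_exists_le_card_mul ((univ : Finset (Fin n)).powersetCard a)
    (fun A (σ : EdgeOrdering n) => ∃ B ∈ (univ : Finset (Fin n)).powersetCard a,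
      Disjoint A B ∧ Late (cross A B) m σ)
    (p := (n.choose a : ℝ) * (1 - m / (n.choose 2 : ℝ)) ^ (a * a)) (fun A hA => by
      have h2 := processProb_exists_le_card_mul ((univ : Finset (Fin n)).powersetCard a)
        (fun B (σ : EdgeOrdering n) => Disjoint A B ∧ Late (cross A B) m σ)
        (p := (1 - m / (n.choose 2 : ℝ)) ^ (a * a)) (fun B hB => by
          by_cases hAB : Disjoint A B
          -- With the empty set of early edges, the early condition is vacuous and the choice `m' =
          -- 0` is harmless.
          · have h3 := processProb_early_late_le ∅ (cross A B) (m' := 0)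
              (disjoint_empty_left _) (by simp) hm
            rw [card_empty, Nat.cast_zero, sub_zero] at h3
            refine (processProb_mono fun σ hσ => ?_).trans
              ((h3.trans (mul_le_of_le_one_right (pow_nonneg hx1 _) (processProb_le_one _))).trans
              (pow_le_pow_of_le_one hx1 hx2 ?_))
            · exact ⟨by simp [Early], hσ.2⟩
            · have h4 := card_mul_card_le_card_cross hAB
              rwa [(mem_powersetCard.1 hA).2, (mem_powersetCard.1 hB).2] at h4
          · have : processProb n (fun σ => Disjoint A B ∧ Late (cross A B) m σ) = 0 := by
              simp [processProb, hAB]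
            rw [this]
            exact pow_nonneg hx1 _)
      rwa [card_powersetCard, card_univ, Fintype.card_fin] at h2)
  rw [card_powersetCard, card_univ, Fintype.card_fin] at h1
  refine (processProb_mono fun σ => ?_).trans h1
  rintro ⟨A, B, hAB, hA, hB, hno⟩
  obtain ⟨A', hA', hA'c⟩ := exists_subset_card_eq hA
  obtain ⟨B', hB', hB'c⟩ := exists_subset_card_eq hB
  refine ⟨A', mem_powersetCard.2 ⟨subset_univ _, hA'c⟩, B',
    mem_powersetCard.2 ⟨subset_univ _, hB'c⟩, hAB.mono hA' hB', fun e he => ?_⟩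
  obtain ⟨u, hu, w, hw, heq⟩ := mem_cross.1 he
  by_contra hlt
  have hne : u ≠ w := fun h => disjoint_left.1 hAB (hA' hu) (h ▸ hB' hw)
  refine hno u (hA' hu) w (hB' hw) (processGraph_adj.2 ⟨hne, ?_⟩)
  have : e = mkEdge hne := Subtype.ext heq
  rw [← this]
  exact not_le.1 hlt

/-- The edges of a path. -/
def pathEdges {l : ℕ} {x : Fin (l + 1) → Fin n} (hx : Function.Injective x) : Finset (Edge n) := by
  classical
  exact univ.image fun i : Fin l =>
    mkEdge (u := x i.castSucc) (v := x i.succ) (hx.ne (Fin.castSucc_lt_succ (i := i)).ne)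

theorem mem_pathEdges {l : ℕ} {x : Fin (l + 1) → Fin n} {hx : Function.Injective x} {e : Edge n} :
    e ∈ pathEdges hx ↔ ∃ i : Fin l, mkEdge (u := x i.castSucc) (v := x i.succ)
      (hx.ne (Fin.castSucc_lt_succ (i := i)).ne) = e := by
  simp [pathEdges]

theorem card_pathEdges {l : ℕ} {x : Fin (l + 1) → Fin n} (hx : Function.Injective x) :
    #(pathEdges hx) = l := by
  classical
  unfold pathEdges
  rw [card_image_of_injective, card_univ, Fintype.card_fin]
  intro i j hij
  have := congrArg Subtype.val hij
  rcases Sym2.eq_iff.1 this with ⟨h1, -⟩ | ⟨h1, h2⟩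
  · exact Fin.castSucc_injective _ (hx h1)
  · have h1' := congrArg Fin.val (hx h1)
    have h2' := congrArg Fin.val (hx h2)
    simp only [Fin.val_castSucc, Fin.val_succ] at h1' h2'
    omega

/-- Union bound over vertex sequences. The `l` path edges are early at `m₁`; apart from them, the
two ends have at least `2n - 3 - l` incident edges, of which at most `2k` are present at `m₀`. -/
theorem processProb_path_le {m₀ m₁ k l : ℕ} (hl : 1 ≤ l) (hl' : 2 * l ≤ n.choose 2)
    (hlm : l ≤ m₀) (hm : m₀ ≤ n.choose 2) :
    processProb n (fun σ => ∃ x : Fin (l + 1) → Fin n, Function.Injective x ∧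
      degAt σ m₀ (x 0) ≤ k ∧ degAt σ m₀ (x (Fin.last l)) ≤ k ∧
      ∀ i : Fin l, (processGraph σ m₁).Adj (x i.castSucc) (x i.succ)) ≤
    (n : ℝ) ^ (l + 1) * (8 ^ (2 * k) *
      (1 - 7 / 8 * (((m₀ : ℝ) - l) / n.choose 2)) ^ (2 * n - 3 - l) *
      (2 * m₁ / (n.choose 2 : ℝ)) ^ l) := by
  classical
  set y := ((m₀ : ℝ) - l) / n.choose 2 with hy
  have hlm' : (l : ℝ) ≤ m₀ := by exact_mod_cast hlm
  have hm' : (m₀ : ℝ) ≤ n.choose 2 := by exact_mod_cast hm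
  have hy0 : 0 ≤ y := div_nonneg (by linarith) (by positivity)
  have hy1 : y ≤ 1 := div_le_one_of_le₀ (by
    have : (0 : ℝ) ≤ l := by positivity
    linarith) (by positivity)
  have h1 := processProb_exists_le_card_mul (univ : Finset (Fin (l + 1) → Fin n))
    (fun x (σ : EdgeOrdering n) => Function.Injective x ∧
      degAt σ m₀ (x 0) ≤ k ∧ degAt σ m₀ (x (Fin.last l)) ≤ k ∧
      ∀ i : Fin l, (processGraph σ m₁).Adj (x i.castSucc) (x i.succ))
    (p := 8 ^ (2 * k) * (1 - 7 / 8 * y) ^ (2 * n - 3 - l) *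
      (2 * m₁ / (n.choose 2 : ℝ)) ^ l) (fun x _ => by
      by_cases hx : Function.Injective x
      · set F := pathEdges hx with hF
        set F' := (star (x 0) ∪ star (x (Fin.last l))) \ F with hF'
        have hFc : #F = l := card_pathEdges hx
        have hne : x 0 ≠ x (Fin.last l) := hx.ne fun h => by
          have := congrArg Fin.val h
          rw [Fin.val_last] at this
          simp at this
          omega
        have hF'c : 2 * n - 3 - l ≤ #F' := by
          have h2 := card_star_union hne
          have h3 : #(star (x 0) ∪ star (x (Fin.last l))) - #F ≤ #F' := le_card_sdiff _ _
          omega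
        have h4 := processProb_early_few_le F F' (m := m₀) (m' := m₁) (2 * k)
          disjoint_sdiff (by rw [hFc]; exact hlm) hm
        have h5 := processProb_early_le F m₁ (by rw [hFc]; exact hl')
        rw [hFc, ← hy] at h4
        rw [hFc] at h5
        refine (processProb_mono fun σ hσ => ?_).trans (h4.trans ?_)
        · refine ⟨fun e he => ?_, ?_⟩
          · obtain ⟨i, rfl⟩ := mem_pathEdges.1 he
            exact (processGraph_adj.1 (hσ.2.2.2 i)).choose_spec
          · calc #{e ∈ F' | (σ.symm e : ℕ) < m₀}
                ≤ #({e ∈ star (x 0) | (σ.symm e : ℕ) < m₀} ∪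
                  {e ∈ star (x (Fin.last l)) | (σ.symm e : ℕ) < m₀}) := by
                  refine card_le_card fun e he => ?_
                  rw [mem_filter, hF', Finset.mem_sdiff, mem_union] at he
                  rw [mem_union, mem_filter, mem_filter]
                  exact he.1.1.imp (⟨·, he.2⟩) (⟨·, he.2⟩)
              _ ≤ degAt σ m₀ (x 0) + degAt σ m₀ (x (Fin.last l)) := card_union_le _ _
              _ ≤ 2 * k := by have := hσ.2; omega
        · have h6 : (1 - 7 / 8 * y) ^ #F' ≤ (1 - 7 / 8 * y) ^ (2 * n - 3 - l) :=
            pow_le_pow_of_le_one (by linarith) (by linarith) hF'c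
          have h7 : 0 ≤ (1 - 7 / 8 * y) ^ (2 * n - 3 - l) := pow_nonneg (by linarith) _
          have h8 : 0 ≤ processProb n (Early F m₁) := processProb_nonneg _
          gcongr
      · have h0 : processProb n (fun σ => Function.Injective x ∧
            degAt σ m₀ (x 0) ≤ k ∧ degAt σ m₀ (x (Fin.last l)) ≤ k ∧
            ∀ i : Fin l, (processGraph σ m₁).Adj (x i.castSucc) (x i.succ)) = 0 := by
          simp [processProb, hx]
        rw [h0]
        have h7 : 0 ≤ (1 - 7 / 8 * y) ^ (2 * n - 3 - l) := pow_nonneg (by linarith) _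
        positivity)
  have h2 : #(univ : Finset (Fin (l + 1) → Fin n)) = n ^ (l + 1) := by
    rw [card_univ, Fintype.card_fun, Fintype.card_fin, Fintype.card_fin]
  rw [h2, Nat.cast_pow] at h1
  simpa using h1

theorem exists_injective_path {V : Type*} {G : SimpleGraph V} {s s' : V} (p : G.Walk s s')
    (hne : s ≠ s') : ∃ l, 1 ≤ l ∧ l ≤ p.length ∧ ∃ x : Fin (l + 1) → V, Function.Injective x ∧
      x 0 = s ∧ x (Fin.last l) = s' ∧ ∀ i : Fin l, G.Adj (x i.castSucc) (x i.succ) := by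
  classical
  have hq := p.bypass_isPath
  set q := p.bypass with hqdef
  refine ⟨q.length, ?_, p.length_bypass_le_length, fun i => q.getVert i, ?_, ?_, ?_, ?_⟩
  · by_contra h
    exact hne (SimpleGraph.Walk.eq_of_length_eq_zero (p := q) (by omega))
  · intro i j hij
    exact Fin.ext (hq.getVert_injOn (Nat.lt_succ_iff.1 i.2) (Nat.lt_succ_iff.1 j.2) hij)
  · simp
  · simp
  · intro i
    simpa using q.adj_getVert_succ i.2

/-- The probability that a set of `r` edges is missing at time `m`. -/
def missProb (n m r : ℕ) : ℝ :=
  ∏ i ∈ range r, (((n.choose 2 : ℝ) - m - i) / ((n.choose 2 : ℝ) - i))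

/-- The factors `1 - m / (N - i)` decrease in `i`, so the last `s` factors are at most the first
`s`. -/
theorem missProb_add_le {m r s : ℕ} (h : m + r + s < n.choose 2) :
    missProb n m (r + s) ≤ missProb n m r * missProb n m s := by
  have h' : (m : ℝ) + r + s < n.choose 2 := by exact_mod_cast h
  unfold missProb
  rw [prod_range_add]
  refine mul_le_mul_of_nonneg_left (prod_le_prod (fun i hi => ?_) fun i hi => ?_)
    (prod_nonneg fun i hi => ?_)
  all_goals
    rw [mem_range] at hi
    have hm0 : (0 : ℝ) ≤ m := by positivity
    have hr0 : (0 : ℝ) ≤ r := by positivity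
    have hs0 : (0 : ℝ) ≤ s := by positivity
    have hi0 : (0 : ℝ) ≤ i := by positivity
  · have hi' : (i : ℝ) < s := by exact_mod_cast hi
    rw [Nat.cast_add]
    exact div_nonneg (by linarith) (by linarith)
  · have hi' : (i : ℝ) < s := by exact_mod_cast hi
    rw [Nat.cast_add, div_le_div_iff₀ (by linarith) (by linarith)]
    nlinarith [mul_nonneg hm0 hr0]
  · have hi' : (i : ℝ) < r := by exact_mod_cast hi
    exact div_nonneg (by linarith) (by linarith)

theorem missProb_ge {m r : ℕ} (h : m + r < n.choose 2) :
    (1 - m / ((n.choose 2 : ℝ) - r)) ^ r ≤ missProb n m r := by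
  have h' : (m : ℝ) + r < n.choose 2 := by exact_mod_cast h
  have hm0 : (0 : ℝ) ≤ m := by positivity
  have hr0 : (0 : ℝ) ≤ r := by positivity
  unfold missProb
  rw [← card_range r, ← prod_const, card_range]
  refine prod_le_prod (fun i hi => ?_) fun i hi => ?_
  · rw [sub_nonneg, div_le_one (by linarith)]
    linarith
  · have hi' : (i : ℝ) < r := by exact_mod_cast mem_range.1 hi
    have : ((n.choose 2 : ℝ) - m - i) / ((n.choose 2 : ℝ) - i) =
        1 - m / ((n.choose 2 : ℝ) - i) := by
      rw [eq_sub_iff_add_eq, ← add_div, div_eq_one_iff_eq (by linarith)]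
      ring
    rw [this]
    gcongr
    linarith

/-- The second moment bound for the number of isolated vertices. -/
theorem processProb_no_isolated_le {m : ℕ} (hn : 2 ≤ n) (hm : m + 2 * n < n.choose 2) :
    processProb n (fun σ => ∀ v, ¬ Late (star v) m σ) ≤
      1 / (n * missProb n m (n - 1)) + m / ((n.choose 2 : ℝ) - m - n) := by
  classical
  have hm' : (m : ℝ) + 2 * n < n.choose 2 := by exact_mod_cast hm
  have hn' : (2 : ℝ) ≤ n := by exact_mod_cast hn
  have hm0 : (0 : ℝ) ≤ m := by positivity
  have hmN : m ≤ n.choose 2 := by omega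
  set p₁ := missProb n m (n - 1) with hp₁
  set p₂ := missProb n m (2 * n - 3) with hp₂
  have hpos : 0 < p₁ := by
    refine prod_pos fun i hi => ?_
    have hi' : (i : ℝ) < n := by exact_mod_cast (by have := mem_range.1 hi; omega)
    exact div_pos (by linarith) (by linarith)
  have hP1 : ∀ v : Fin n, processProb n (Late (star v) m) = p₁ := fun v => by
    rw [processProb_late _ hmN, card_star]; rfl
  have hP2 : ∀ u v : Fin n, u ≠ v →
      processProb n (fun σ => Late (star u) m σ ∧ Late (star v) m σ) = p₂ := fun u v huv => by
    have h1 : processProb n (fun σ => Late (star u) m σ ∧ Late (star v) m σ) =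
        processProb n (Late (star u ∪ star v) m) := by
      congr 1
      funext σ
      simp only [Late, mem_union, or_imp, forall_and]
    have h2 := card_star_union huv
    rw [h1, processProb_late _ hmN, show #(star u ∪ star v) = 2 * n - 3 by omega]
    rfl
  let X : EdgeOrdering n → ℝ := fun σ => ∑ v, ind (Late (star v) m) σ
  have hEX : processExp n X = n * p₁ := by
    simp only [X]
    rw [processExp_sum]
    simp only [← processProb_eq_exp, hP1]
    simp
  have hEX2 : processExp n (fun σ => X σ * X σ) ≤ n * p₁ + n * n * p₂ := by
    have h1 : ∀ σ, X σ * X σ = ∑ u, ∑ v,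
        ind (fun σ => Late (star u) m σ ∧ Late (star v) m σ) σ := by
      intro σ
      simp only [X]
      rw [sum_mul_sum]
      refine sum_congr rfl fun u _ => sum_congr rfl fun v _ => ?_
      unfold ind
      by_cases hu : Late (star u) m σ <;> by_cases hv : Late (star v) m σ <;> simp [hu, hv]
    simp only [h1]
    rw [processExp_sum]
    simp only [processExp_sum, ← processProb_eq_exp]
    have hp2 : 0 ≤ p₂ := by
      refine prod_nonneg fun i hi => ?_
      have hi' : (i : ℝ) < 2 * n := by exact_mod_cast (by have := mem_range.1 hi; omega)
      exact div_nonneg (by linarith) (by linarith)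
    calc ∑ u : Fin n, ∑ v : Fin n, processProb n (fun σ => Late (star u) m σ ∧ Late (star v) m σ)
        ≤ ∑ u : Fin n, ∑ v : Fin n, ((if u = v then p₁ else 0) + p₂) := by
          refine sum_le_sum fun u _ => sum_le_sum fun v _ => ?_
          by_cases huv : u = v
          · subst huv
            simp only [and_self, if_true]
            have := hP1 u
            linarith [show processProb n (fun σ => Late (star u) m σ) = p₁ from this]
          · rw [hP2 u v huv, if_neg huv, zero_add]
      _ = n * p₁ + n * n * p₂ := by
          simp only [sum_add_distrib, sum_ite_eq, mem_univ, if_true, sum_const, card_univ,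
            Fintype.card_fin, nsmul_eq_mul]
          ring
  set μ := n * p₁ with hμ
  have hμ0 : 0 < μ := by positivity
  have hcheb : μ * μ * processProb n (fun σ => ∀ v, ¬ Late (star v) m σ) ≤
      n * p₁ + n * n * p₂ - μ * μ := by
    -- Chebyshev pointwise: `(X - μ) ^ 2` is at least `μ ^ 2` times the indicator of `X = 0`.
    have h1 : ∀ σ, μ * μ * ind (fun σ => ∀ v, ¬ Late (star v) m σ) σ ≤
        X σ * X σ + ((-2 * μ) * X σ + μ * μ) := by
      intro σ
      by_cases h : ∀ v, ¬ Late (star v) m σ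
      · have : X σ = 0 := sum_eq_zero fun v _ => if_neg (h v)
        have h' : ind (fun σ => ∀ v, ¬ Late (star v) m σ) σ = 1 := if_pos h
        rw [this, h']
        linarith
      · have h' : ind (fun σ => ∀ v, ¬ Late (star v) m σ) σ = 0 := if_neg h
        rw [h']
        nlinarith [sq_nonneg (X σ - μ)]
    have h2 := processExp_mono h1
    rw [processExp_const_mul, ← processProb_eq_exp, processExp_add, processExp_add,
      processExp_const_mul, processExp_const, hEX] at h2
    linarith
  -- Two stars share one edge, so `p₂` has `2n - 3 = (n - 1) + (n - 2)` factors. Comparison with `p₁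
  -- * p₁` costs only the last factor `r` of `p₁`.
  have hp2le : p₂ * ((n.choose 2 : ℝ) - m - n) ≤ p₁ * p₁ * ((n.choose 2 : ℝ) - n) := by
    have h1 : p₂ ≤ p₁ * missProb n m (n - 2) := by
      rw [hp₂, show 2 * n - 3 = (n - 1) + (n - 2) by omega]
      exact missProb_add_le (by omega)
    have h2 : p₁ = missProb n m (n - 2) * (((n.choose 2 : ℝ) - m - (n - 2 : ℕ)) /
        ((n.choose 2 : ℝ) - (n - 2 : ℕ))) := by
      rw [hp₁, show n - 1 = (n - 2) + 1 by omega]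
      exact prod_range_succ _ _
    set s := missProb n m (n - 2) with hs
    rw [Nat.cast_sub hn] at h2
    set r := ((n.choose 2 : ℝ) - m - ((n : ℝ) - (2 : ℕ))) /
      ((n.choose 2 : ℝ) - ((n : ℝ) - (2 : ℕ))) with hr
    have hden : (0 : ℝ) < (n.choose 2 : ℝ) - ((n : ℝ) - (2 : ℕ)) := by push_cast; linarith
    have hr' : ((n.choose 2 : ℝ) - m - n) / ((n.choose 2 : ℝ) - n) ≤ r := by
      rw [hr, div_le_div_iff₀ (by linarith) hden]
      push_cast
      nlinarith
    have hrpos : 0 ≤ r := by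
      refine le_trans (div_nonneg ?_ ?_) hr' <;> linarith
    have hs0 : 0 ≤ s := by
      by_contra hneg
      rw [h2] at hpos
      nlinarith
    rw [div_le_iff₀ (by linarith)] at hr'
    calc p₂ * ((n.choose 2 : ℝ) - m - n) ≤ p₁ * s * (r * ((n.choose 2 : ℝ) - n)) :=
          mul_le_mul h1 hr' (by linarith) (by positivity)
      _ = p₁ * (s * r) * ((n.choose 2 : ℝ) - n) := by ring
      _ = _ := by rw [← h2]
  have hD : 0 < (n.choose 2 : ℝ) - m - n := by linarith
  have hp2' : p₂ ≤ p₁ * p₁ * (1 + m / ((n.choose 2 : ℝ) - m - n)) := by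
    have : p₁ * p₁ * (1 + m / ((n.choose 2 : ℝ) - m - n)) =
        p₁ * p₁ * ((n.choose 2 : ℝ) - n) / ((n.choose 2 : ℝ) - m - n) := by
      field_simp
      ring
    rw [this, le_div_iff₀ hD]
    exact hp2le
  refine le_of_mul_le_mul_left (hcheb.trans ?_) (mul_pos hμ0 hμ0)
  rw [mul_add, mul_one_div, mul_div_assoc, div_self hμ0.ne']
  have h9 : (n : ℝ) * n * p₂ ≤ n * n * (p₁ * p₁ * (1 + m / ((n.choose 2 : ℝ) - m - n))) :=
    mul_le_mul_of_nonneg_left hp2' (by positivity)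
  have h10 : (n : ℝ) * n * (p₁ * p₁ * (1 + m / ((n.choose 2 : ℝ) - m - n))) =
      μ * μ + μ * μ * (m / ((n.choose 2 : ℝ) - m - n)) := by
    rw [hμ]; ring
  linarith

end MoreEvents

/-! ### Asymptotic estimates -/

section Asymptotics

open Finset

/-- A time at which there are still isolated vertices. -/
def lowerTime (n : ℕ) : ℕ := ⌊3 / 8 * n * Real.log n⌋₊

/-- A time at which the minimum degree is already large. -/
def upperTime (n : ℕ) : ℕ := ⌈n * Real.log n⌉₊

variable {n : ℕ}

theorem one_sub_pow_le_exp {x y : ℝ} {r : ℕ} (hx : x ≤ 1) (h : y ≤ x * r) :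
    (1 - x) ^ r ≤ Real.exp (-y) := by
  calc (1 - x) ^ r ≤ Real.exp (-x) ^ r :=
        pow_le_pow_left₀ (by linarith) (Real.one_sub_le_exp_neg x) r
    _ = Real.exp (-(x * r)) := by rw [← Real.exp_nat_mul]; congr 1; ring
    _ ≤ _ := Real.exp_le_exp.2 (by linarith)

/-- From `k ^ k / k! ≤ exp k`. -/
theorem choose_le_exp_mul_div_pow (n k : ℕ) (hk : 1 ≤ k) :
    (n.choose k : ℝ) ≤ (Real.exp 1 * n / k) ^ k := by
  have hk' : (0 : ℝ) < k := by exact_mod_cast hk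
  have h1 : (n.choose k : ℝ) ≤ n ^ k / k.factorial := Nat.choose_le_pow_div k n
  have h2 := Real.pow_div_factorial_le_exp (k : ℝ) hk'.le k
  have hf : (0 : ℝ) < k.factorial := by exact_mod_cast k.factorial_pos
  rw [div_le_iff₀ hf] at h2
  refine h1.trans ?_
  rw [div_le_iff₀ hf, div_pow, mul_pow, ← Real.exp_nat_mul, mul_one, div_mul_eq_mul_div,
    le_div_iff₀ (by positivity)]
  calc (n : ℝ) ^ k * k ^ k ≤ n ^ k * (Real.exp k * k.factorial) := by gcongr
    _ = _ := by ring

/-- Elementary consequences of `n` being large. -/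
theorem large_bounds (hL : 10 ^ 7 ≤ Real.log n) :
    5000 * Real.log n ≤ n ∧ (n.choose 2 : ℝ) = n * (n - 1) / 2 ∧ Real.exp (Real.log n) = n := by
  have hn : (0 : ℝ) < n := by
    rcases Nat.eq_zero_or_pos n with h | h
    · subst h; norm_num at hL
    · exact_mod_cast h
  have h1 := Real.exp_log hn
  have h2 := Real.quadratic_le_exp_of_nonneg (x := Real.log n) (by linarith)
  rw [h1] at h2
  refine ⟨by nlinarith, ?_, h1⟩
  rw [Nat.cast_choose_two]

theorem lowerTime_bounds (hL : 10 ^ 7 ≤ Real.log n) :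
    3 / 8 * n * Real.log n - 1 ≤ lowerTime n ∧ (lowerTime n : ℝ) ≤ 3 / 8 * n * Real.log n :=
  ⟨(Nat.sub_one_lt_floor _).le, Nat.floor_le (by positivity)⟩

theorem upperTime_bounds (hL : 10 ^ 7 ≤ Real.log n) :
    n * Real.log n ≤ upperTime n ∧ (upperTime n : ℝ) ≤ n * Real.log n + 1 :=
  ⟨Nat.le_ceil _, (Nat.ceil_lt_add_one (by positivity)).le⟩

theorem two_mul_upperTime_div_le (hL : 10 ^ 7 ≤ Real.log n) :
    2 * (upperTime n : ℝ) / n.choose 2 ≤ 5 * Real.log n / n := by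
  obtain ⟨h1, h2, -⟩ := large_bounds hL
  obtain ⟨-, h4⟩ := upperTime_bounds hL
  set L := Real.log n
  rw [h2, div_le_div_iff₀ (by nlinarith) (by linarith)]
  nlinarith

theorem upperTime_le (hL : 10 ^ 7 ≤ Real.log n) : upperTime n ≤ n.choose 2 := by
  obtain ⟨h1, h2, -⟩ := large_bounds hL
  obtain ⟨-, h4⟩ := upperTime_bounds hL
  have : (upperTime n : ℝ) ≤ n.choose 2 := by
    rw [h2]
    nlinarith
  exact_mod_cast this

theorem lowerTime_le_upperTime (hL : 10 ^ 7 ≤ Real.log n) : lowerTime n ≤ upperTime n := by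
  have h3 := (upperTime_bounds hL).1
  have h4 := (lowerTime_bounds hL).2
  have : (lowerTime n : ℝ) ≤ upperTime n := by
    have : (0 : ℝ) ≤ n * Real.log n := by positivity
    linarith
  exact_mod_cast this

theorem exp_one_bounds : Real.exp 1 ≤ 2.7183 ∧ 2.718 ≤ Real.exp 1 :=
  ⟨by linarith [Real.exp_one_lt_d9], by linarith [Real.exp_one_gt_d9]⟩

theorem eight_pow_le (k : ℕ) : (8 : ℝ) ^ k ≤ Real.exp (2.08 * k) := by
  have h : (8 : ℝ) ≤ Real.exp 2.08 := by
    rw [← Real.log_le_iff_le_exp (by norm_num), show (8 : ℝ) = 2 ^ 3 by norm_num, Real.log_pow]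
    have := Real.log_two_lt_d9
    push_cast
    linarith
  calc (8 : ℝ) ^ k ≤ Real.exp 2.08 ^ k := by gcongr
    _ = _ := by rw [← Real.exp_nat_mul]; congr 1; ring

theorem inv_eight_pow_le (k : ℕ) : (1 / 8 : ℝ) ^ k ≤ Real.exp (-(2 * k)) := by
  have h : (1 / 8 : ℝ) ≤ Real.exp (-2) := by
    rw [Real.exp_neg, one_div]
    refine inv_anti₀ (Real.exp_pos _) ?_
    rw [show (2 : ℝ) = 1 + 1 by norm_num, Real.exp_add]
    nlinarith [exp_one_bounds.1, exp_one_bounds.2]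
  calc (1 / 8 : ℝ) ^ k ≤ Real.exp (-2) ^ k := by gcongr
    _ = _ := by rw [← Real.exp_nat_mul]; congr 1; ring

/-- At `n log n` edges the mean degree is about `2 log n`; the base `1/8` keeps `7/8` of it, giving
exponent `1.75 > 1`. -/
theorem prob_small_degree_le (hL : 10 ^ 7 ≤ Real.log n) {d : ℕ}
    (hd : (d : ℝ) ≤ Real.log n / 100) :
    processProb n (fun σ => ∃ v, degAt σ (upperTime n) v ≤ d) ≤
      Real.exp (-(Real.log n / 2)) := by
  obtain ⟨h1, h2, h3⟩ := large_bounds hL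
  obtain ⟨h4, -⟩ := upperTime_bounds hL
  have hle := upperTime_le hL
  refine (processProb_exists_degAt_le d hle).trans ?_
  set L := Real.log n
  have hN : (0 : ℝ) < n.choose 2 := by rw [h2]; nlinarith
  have hn1 : 1 ≤ n := by
    have : (1 : ℝ) ≤ n := by linarith
    exact_mod_cast this
  have hx : (upperTime n : ℝ) / n.choose 2 ≤ 1 :=
    div_le_one_of_le₀ (by exact_mod_cast hle) hN.le
  have h5 : 1.75 * L ≤ 7 / 8 * ((upperTime n : ℝ) / n.choose 2) * (n - 1 : ℕ) := by
    rw [Nat.cast_sub hn1, Nat.cast_one]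
    have : 2 * L ≤ (upperTime n : ℝ) / n.choose 2 * (n - 1) := by
      rw [div_mul_eq_mul_div, le_div_iff₀ hN, h2]
      nlinarith
    linarith
  calc (n : ℝ) * (8 ^ d * (1 - 7 / 8 * ((upperTime n : ℝ) / n.choose 2)) ^ (n - 1))
      ≤ Real.exp L * (Real.exp (2.08 * d) * Real.exp (-(1.75 * L))) := by
        rw [h3]
        gcongr
        · exact pow_nonneg (by linarith) _
        · exact eight_pow_le d
        · exact one_sub_pow_le_exp (by linarith) h5
    _ = Real.exp (L + (2.08 * d + -(1.75 * L))) := by rw [Real.exp_add, Real.exp_add]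
    _ ≤ _ := Real.exp_le_exp.2 (by linarith)

theorem prob_large_degree_le (hL : 10 ^ 7 ≤ Real.log n) :
    processProb n (fun σ => ∃ v, ⌈40 * Real.log n⌉₊ ≤ degAt σ (upperTime n) v) ≤
      Real.exp (-Real.log n) := by
  obtain ⟨h1, h2, h3⟩ := large_bounds hL
  have hq := two_mul_upperTime_div_le hL
  set L := Real.log n
  have h4 : (40 * L : ℝ) ≤ ⌈40 * L⌉₊ := Nat.le_ceil _
  have h5 : (⌈40 * L⌉₊ : ℝ) ≤ 40 * L + 1 := (Nat.ceil_lt_add_one (by linarith)).le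
  set Δ := ⌈40 * L⌉₊
  have hΔ : 2 * Δ ≤ n.choose 2 := by
    have : 2 * (Δ : ℝ) ≤ n.choose 2 := by rw [h2]; nlinarith
    exact_mod_cast this
  refine (processProb_exists_lt_degAt hΔ).trans ?_
  have hn : (0 : ℝ) < n := by linarith
  have h6 : ((n - 1).choose Δ : ℝ) ≤ n ^ Δ / Δ.factorial := by
    refine le_trans ?_ (Nat.choose_le_pow_div Δ n)
    exact_mod_cast Nat.choose_le_choose Δ (Nat.sub_le n 1)
  have h7 := Real.pow_div_factorial_le_exp (40 * L) (by linarith) Δ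
  calc (n : ℝ) * ((n - 1).choose Δ * (2 * (upperTime n : ℝ) / n.choose 2) ^ Δ)
      ≤ n * (n ^ Δ / Δ.factorial * (5 * L / n) ^ Δ) := by gcongr
    -- Writing `5 = 40 / 8` splits off `8 ^ (-Δ) ≤ exp (-2Δ)`, which beats `exp (40 L)` because `Δ ≥
    -- 40 L`.
    _ = n * ((1 / 8) ^ Δ * ((40 * L) ^ Δ / Δ.factorial)) := by
        have e1 : (5 * L / n) ^ Δ = (1 / 8) ^ Δ * (40 * L) ^ Δ / n ^ Δ := by
          rw [← mul_pow, ← div_pow]; congr 1; ring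
        rw [e1]
        field_simp
    _ ≤ Real.exp L * (Real.exp (-(2 * Δ)) * Real.exp (40 * L)) := by
        rw [h3]
        gcongr
        exact inv_eight_pow_le Δ
    _ = Real.exp (L + (-(2 * Δ) + 40 * L)) := by rw [Real.exp_add, Real.exp_add]
    _ ≤ _ := Real.exp_le_exp.2 (by linarith)

/-- The vertices give `n ^ (l + 1)` and the path edges `(5 L / n) ^ l`, leaving one factor `n = exp
L`. The two small degrees must beat it: the mean degree at `m₀` is about `0.75 L`, and `2 * (7/8) *
0.75 > 1.3`, with only `0.104 L` lost to `8 ^ (2k)`. -/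
theorem prob_path_le (hL : 10 ^ 7 ≤ Real.log n) {k l : ℕ} (hk : (k : ℝ) ≤ Real.log n / 40)
    (hl : 1 ≤ l) (hl4 : l ≤ 4) :
    processProb n (fun σ => ∃ x : Fin (l + 1) → Fin n, Function.Injective x ∧
      degAt σ (lowerTime n) (x 0) ≤ k ∧ degAt σ (lowerTime n) (x (Fin.last l)) ≤ k ∧
      ∀ i : Fin l, (processGraph σ (upperTime n)).Adj (x i.castSucc) (x i.succ)) ≤
    625 * (Real.log n ^ 4 * Real.exp (-(0.15 * Real.log n))) := by
  obtain ⟨h1, h2, h3⟩ := large_bounds hL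
  have hq := two_mul_upperTime_div_le hL
  obtain ⟨h4, h5⟩ := lowerTime_bounds hL
  have hmN := (lowerTime_le_upperTime hL).trans (upperTime_le hL)
  set L := Real.log n
  have hn : (0 : ℝ) < n := by linarith
  have hl4' : (l : ℝ) ≤ 4 := by exact_mod_cast hl4
  have hl0 : (0 : ℝ) ≤ l := by positivity
  have hN : (0 : ℝ) < n.choose 2 := by rw [h2]; nlinarith
  have hlN : 2 * l ≤ n.choose 2 := by
    have : 2 * (l : ℝ) ≤ n.choose 2 := by rw [h2]; nlinarith
    exact_mod_cast this
  have hlm : l ≤ lowerTime n := by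
    have : (l : ℝ) ≤ lowerTime n := by nlinarith
    exact_mod_cast this
  refine (processProb_path_le hl hlN hlm hmN).trans ?_
  set y := ((lowerTime n : ℝ) - l) / n.choose 2 with hy
  have hy1 : y ≤ 1 := div_le_one_of_le₀ (by
    have : (lowerTime n : ℝ) ≤ n.choose 2 := by exact_mod_cast hmN
    linarith) hN.le
  have hylow : 0.749 * L / n ≤ y := by
    rw [hy, h2, div_le_div_iff₀ hn (by nlinarith)]
    have : 0.749 * L * (n * (n - 1) / 2) ≤ 0.3745 * L * (n * n) := by nlinarith
    have h6 : 5 ≤ 0.0005 * (n * L) := by nlinarith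
    nlinarith
  have h2n : ((2 * n - 3 - l : ℕ) : ℝ) ≥ 1.99 * n := by
    have h7 : 7 ≤ 2 * n := by
      have : (7 : ℝ) ≤ 2 * n := by linarith
      exact_mod_cast this
    have h8 : 2 * n ≤ (2 * n - 3 - l) + 7 := by omega
    have h9 : 2 * (n : ℝ) ≤ ((2 * n - 3 - l : ℕ) : ℝ) + 7 := by exact_mod_cast h8
    linarith
  have hexp : 1.3 * L ≤ 7 / 8 * y * (2 * n - 3 - l : ℕ) := by
    have h6 : 0.749 * L ≤ y * n := by rwa [div_le_iff₀ hn] at hylow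
    have hy0 : 0 ≤ y := le_trans (by positivity) hylow
    nlinarith
  have h5L : (5 * L) ^ l ≤ (5 * L) ^ 4 := pow_le_pow_right₀ (by linarith) hl4
  calc (n : ℝ) ^ (l + 1) * (8 ^ (2 * k) * (1 - 7 / 8 * y) ^ (2 * n - 3 - l) *
        (2 * (upperTime n : ℝ) / n.choose 2) ^ l)
      ≤ (n : ℝ) ^ (l + 1) * (Real.exp (2.08 * (2 * k : ℕ)) * Real.exp (-(1.3 * L)) *
        (5 * L / n) ^ l) := by
        gcongr
        · exact pow_nonneg (by linarith) _
        · exact eight_pow_le _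
        · exact one_sub_pow_le_exp (by linarith) hexp
    _ = (5 * L) ^ l * (Real.exp L * (Real.exp (2.08 * (2 * k : ℕ)) * Real.exp (-(1.3 * L)))) := by
        rw [h3, div_pow, pow_succ]
        field_simp
    _ = (5 * L) ^ l * Real.exp (L + (2.08 * (2 * k : ℕ) + -(1.3 * L))) := by
        rw [Real.exp_add, Real.exp_add]
    _ ≤ (5 * L) ^ 4 * Real.exp (-(0.15 * L)) := by
        gcongr
        push_cast
        linarith
    _ = _ := by ring

theorem sum_pow_Icc_le {r : ℝ} (hr0 : 0 ≤ r) (hr : r ≤ 1 / 2) (b : ℕ) :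
    ∑ t ∈ Icc 1 b, r ^ t ≤ 2 * r := by
  have h : ∀ b : ℕ, ∑ t ∈ Icc 1 b, r ^ t ≤ 2 * r - 2 * r * (1 / 2) ^ b := by
    intro b
    induction b with
    | zero => simp
    | succ b ih =>
      rw [sum_Icc_succ_top (by omega)]
      have h1 : r ^ (b + 1) ≤ r * (1 / 2) ^ b := by
        rw [pow_succ']
        gcongr
      have h2 : 2 * r * (1 / 2 : ℝ) ^ (b + 1) = r * (1 / 2) ^ b := by ring
      linarith
  have h3 : 0 ≤ 2 * r * (1 / 2 : ℝ) ^ b := by positivity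
  linarith [h b]

-- Sets of size `t` contribute at most `(e n / t * z ^ κ) ^ t`, where `z` is proportional to `d t /
-- n`. One factor `z` cancels `n / t`; the remaining `κ - 1 ≥ 2 log L` factors are at most `exp
-- (-2)` each and give `L ^ (-4)`.
open Classical in
theorem prob_dense_le (hL : 10 ^ 7 ≤ Real.log n) {d b κ : ℕ} (hd : 1 ≤ d)
    (hdL : (d : ℝ) ≤ Real.log n) (hκL : (κ : ℝ) ≤ Real.log n)
    (hκ : Real.log n / (5120 * d) ≤ κ) (hκℓ : 2 * Real.log (Real.log n) + 1 ≤ κ)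
    (hb : (b : ℝ) ≤ 3e-6 * n / d) :
    processProb n (fun σ => ∃ T : Finset (Fin n), T.Nonempty ∧ #T ≤ b ∧
      2 * κ * #T ≤ ∑ u ∈ T, #{w ∈ T | (processGraph σ (upperTime n)).Adj u w}) ≤
    2 * (10 ^ 5 * (Real.log n ^ 3)⁻¹) := by
  obtain ⟨h1, h2, h3⟩ := large_bounds hL
  have hq := two_mul_upperTime_div_le hL
  set L := Real.log n with hLdef
  have hn : (0 : ℝ) < n := by linarith
  have hd' : (1 : ℝ) ≤ d := by exact_mod_cast hd
  have hκ0 : (0 : ℝ) < κ := lt_of_lt_of_le (by positivity) hκ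
  have hκ1 : 1 ≤ κ := by exact_mod_cast hκ0
  have hbn : (b : ℝ) ≤ n := by
    refine hb.trans ?_
    rw [div_le_iff₀ (by linarith)]
    nlinarith
  have hbN : 2 * (κ * b) ≤ n.choose 2 := by
    have h4 : (κ : ℝ) * b ≤ L * n := mul_le_mul hκL hbn (by positivity) (by linarith)
    have : 2 * ((κ : ℝ) * b) ≤ n.choose 2 := by rw [h2]; nlinarith
    exact_mod_cast this
  refine (processProb_dense_le hbN).trans ?_
  set r := (10 : ℝ) ^ 5 * (L ^ 3)⁻¹ with hr
  have hr0 : 0 ≤ r := by positivity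
  have hr2 : r ≤ 1 / 2 := by
    rw [hr, ← div_eq_mul_inv, div_le_iff₀ (by positivity)]
    have : (10 ^ 7) ^ 3 ≤ L ^ 3 := by gcongr
    linarith
  refine (sum_le_sum fun t ht => ?_).trans (sum_pow_Icc_le hr0 hr2 b)
  rw [mem_Icc] at ht
  have ht0 : (1 : ℝ) ≤ t := by exact_mod_cast ht.1
  have htb : (t : ℝ) ≤ b := by exact_mod_cast ht.2
  have he := exp_one_bounds
  -- Here `35840 = 7 * 5120`, where `7` bounds `5 e / 2` and `5120` comes from the lower bound on
  -- `κ`.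
  set z := 35840 * d * t / (n : ℝ) with hz
  have hz0 : 0 ≤ z := by positivity
  have hz2 : z ≤ Real.exp (-2) := by
    have h4 : z ≤ 1 / 8 := by
      rw [hz, div_le_iff₀ hn]
      have : (t : ℝ) * d ≤ 3e-6 * n := by
        have := htb.trans hb
        rwa [le_div_iff₀ (by linarith)] at this
      nlinarith
    have := inv_eight_pow_le 1
    norm_num at this
    norm_num at h4
    linarith
  have hzκ : Real.exp 1 * ((t.choose 2 : ℕ) : ℝ) / (κ * t : ℕ) * (5 * L / n) ≤ z := by
    have h4 : ((t.choose 2 : ℕ) : ℝ) ≤ t * t / 2 := by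
      rw [Nat.cast_choose_two]
      nlinarith
    have h5 : L ≤ κ * (5120 * d) := by rwa [div_le_iff₀ (by positivity)] at hκ
    rw [hz, Nat.cast_mul, div_mul_div_comm, div_le_div_iff₀ (by positivity) hn]
    have h6 : Real.exp 1 * ((t.choose 2 : ℕ) : ℝ) * (5 * L) ≤
        2.7183 * (t * t / 2) * (5 * (κ * (5120 * d))) := by
      gcongr
      exact he.1
    have h7 : 2.7183 * ((t : ℝ) * t / 2) * (5 * (κ * (5120 * d))) ≤
        35840 * d * t * (κ * t) := by
      have : (0 : ℝ) ≤ t * t * (κ * d) := by positivity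
      linarith
    have h8 := mul_le_mul_of_nonneg_right (h6.trans h7) hn.le
    linarith
  have hbase : Real.exp 1 * n / t * z ^ κ ≤ r := by
    have h4 : z ^ κ ≤ z * Real.exp (-(4 * Real.log L)) := by
      rw [← Nat.sub_add_cancel hκ1, pow_succ']
      refine mul_le_mul_of_nonneg_left ?_ hz0
      calc z ^ (κ - 1) ≤ Real.exp (-2) ^ (κ - 1) := by gcongr
        _ = Real.exp (-(2 * (κ - 1 : ℕ))) := by rw [← Real.exp_nat_mul]; congr 1; ring
        _ ≤ _ := by
          refine Real.exp_le_exp.2 ?_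
          rw [Nat.cast_sub hκ1, Nat.cast_one]
          linarith
    have h5 : Real.exp (-(4 * Real.log L)) = (L ^ 4)⁻¹ := by
      rw [Real.exp_neg, show (4 : ℝ) = (4 : ℕ) by norm_num, Real.exp_nat_mul,
        Real.exp_log (by linarith)]
    rw [h5] at h4
    calc Real.exp 1 * n / t * z ^ κ ≤ Real.exp 1 * n / t * (z * (L ^ 4)⁻¹) := by gcongr
      _ = Real.exp 1 * 35840 * (d * (L ^ 4)⁻¹) := by
        rw [hz]
        field_simp
      _ ≤ 10 ^ 5 * (L * (L ^ 4)⁻¹) := by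
        have : Real.exp 1 * 35840 ≤ 10 ^ 5 := by linarith
        gcongr
      _ = r := by
        rw [hr]
        field_simp
  calc (n.choose t : ℝ) * (((t.choose 2).choose (κ * t) : ℕ) *
        (2 * (upperTime n : ℝ) / n.choose 2) ^ (κ * t))
      ≤ (Real.exp 1 * n / t) ^ t *
        ((Real.exp 1 * ((t.choose 2 : ℕ) : ℝ) / (κ * t : ℕ)) ^ (κ * t) * (5 * L / n) ^ (κ * t)) := by
        gcongr
        · exact choose_le_exp_mul_div_pow n t ht.1
        · exact choose_le_exp_mul_div_pow _ _ (Nat.mul_pos hκ1 ht.1)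
    _ = (Real.exp 1 * n / t) ^ t *
        (Real.exp 1 * ((t.choose 2 : ℕ) : ℝ) / (κ * t : ℕ) * (5 * L / n)) ^ (κ * t) := by
        rw [mul_pow (Real.exp 1 * ((t.choose 2 : ℕ) : ℝ) / (κ * t : ℕ))]
    _ ≤ (Real.exp 1 * n / t) ^ t * z ^ (κ * t) := by gcongr
    _ = (Real.exp 1 * n / t * z ^ κ) ^ t := by rw [mul_pow, pow_mul]
    _ ≤ r ^ t := by gcongr

theorem prob_not_joined_le (hL : 10 ^ 7 ≤ Real.log n) {d a : ℕ} (hd : 1 ≤ d)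
    (hdL : (d : ℝ) ≤ Real.log n) (hℓ : 1 ≤ Real.log (Real.log n))
    (hdℓ : d * Real.log (Real.log n) ≤ 1e-7 * Real.log n) (ha : 1e-6 * (n : ℝ) / d ≤ a) :
    processProb n (fun σ => ∃ A B : Finset (Fin n), Disjoint A B ∧ a ≤ #A ∧ a ≤ #B ∧
      ∀ u ∈ A, ∀ w ∈ B, ¬ (processGraph σ (lowerTime n)).Adj u w) ≤ (Real.log n)⁻¹ := by
  obtain ⟨h1, h2, h3⟩ := large_bounds hL
  obtain ⟨h4, h5⟩ := lowerTime_bounds hL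
  have hmN := (lowerTime_le_upperTime hL).trans (upperTime_le hL)
  refine (processProb_not_joined_le hmN).trans ?_
  set L := Real.log n with hLdef
  set ℓ := Real.log L with hℓdef
  have hn : (0 : ℝ) < n := by linarith
  have hd' : (1 : ℝ) ≤ d := by exact_mod_cast hd
  have hN : (0 : ℝ) < n.choose 2 := by rw [h2]; nlinarith
  have ha0 : (0 : ℝ) < a := lt_of_lt_of_le (by positivity) ha
  have ha1 : 1 ≤ a := by exact_mod_cast ha0
  have ha1' : (1 : ℝ) ≤ a := by exact_mod_cast ha1
  set x := (lowerTime n : ℝ) / n.choose 2 with hx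
  have hx1 : x ≤ 1 := div_le_one_of_le₀ (by exact_mod_cast hmN) hN.le
  have hxlow : L / (2 * n) ≤ x := by
    rw [hx, h2, div_le_div_iff₀ (by positivity) (by nlinarith)]
    have h6 : 1 ≤ 0.1 * (n * L) := by nlinarith
    have h7 : L * (n * (n - 1) / 2) ≤ 0.5 * (n * (n * L)) := by nlinarith
    nlinarith
  -- The bound `d ℓ ≤ 1e-7 L` is used here in full: `L / (2n)` times `1e-6 n / d` is `5e-7 L / d`.
  -- Each of the two choices of a set costs `2ℓ` per vertex, so `5ℓ` leaves a margin of `ℓ`.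
  have hxa : 5 * ℓ ≤ x * a := by
    calc 5 * ℓ ≤ L / (2 * n) * (1e-6 * n / d) := by
          rw [div_mul_div_comm, le_div_iff₀ (by positivity)]
          nlinarith
      _ ≤ x * a := mul_le_mul hxlow ha (by positivity) (le_trans (by positivity) hxlow)
  have hchoose : (n.choose a : ℝ) ≤ Real.exp (2 * ℓ * a) := by
    refine (choose_le_exp_mul_div_pow n a ha1).trans ?_
    have h6 : Real.exp 1 * n / a ≤ Real.exp (2 * ℓ) := by
      have h7 : Real.exp (2 * ℓ) = L * L := by
        rw [two_mul, Real.exp_add, hℓdef, Real.exp_log (by linarith)]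
      rw [h7, div_le_iff₀ ha0]
      have h8 : 1e-6 * (n : ℝ) ≤ a * d := by rwa [div_le_iff₀ (by linarith)] at ha
      calc Real.exp 1 * n ≤ 2.7183 * n := by
            have := exp_one_bounds.1
            gcongr
        _ ≤ 2.7183 * (10 ^ 6 * (a * d)) := by linarith
        _ ≤ 10 ^ 7 * (a * d) := by
            have : (0 : ℝ) ≤ a * d := by positivity
            linarith
        _ ≤ L * (a * L) := by gcongr
        _ = L * L * a := by ring
    calc _ ≤ Real.exp (2 * ℓ) ^ a := by gcongr
      _ = _ := by rw [← Real.exp_nat_mul]; congr 1; ring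
  calc (n.choose a : ℝ) * (n.choose a * (1 - x) ^ (a * a))
      ≤ Real.exp (2 * ℓ * a) * (Real.exp (2 * ℓ * a) * Real.exp (-(5 * ℓ * a))) := by
        gcongr
        · refine one_sub_pow_le_exp hx1 ?_
          push_cast
          nlinarith
    _ = Real.exp (-(ℓ * a)) := by rw [← Real.exp_add, ← Real.exp_add]; congr 1; ring
    _ ≤ Real.exp (-ℓ) := Real.exp_le_exp.2 (by nlinarith)
    _ = L⁻¹ := by rw [Real.exp_neg, hℓdef, Real.exp_log (by linarith)]

/-- At `(3/8) n log n` edges the expected number of isolated vertices is about `n ^ (1/4)`; the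
cruder bound `n ^ 0.2` suffices. -/
theorem prob_no_isolated_le (hL : 10 ^ 7 ≤ Real.log n) :
    processProb n (fun σ => ∀ v, ¬ Late (star v) (lowerTime n) σ) ≤
      Real.exp (-(0.2 * Real.log n)) + 2 * (Real.log n * Real.exp (-Real.log n)) := by
  obtain ⟨h1, h2, h3⟩ := large_bounds hL
  obtain ⟨h4, h5⟩ := lowerTime_bounds hL
  set L := Real.log n with hLdef
  have hn : (0 : ℝ) < n := by linarith
  have hn2 : 2 ≤ n := by
    have : (2 : ℝ) ≤ n := by linarith
    exact_mod_cast this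
  have hm0 : (0 : ℝ) ≤ lowerTime n := by positivity
  have hN : (0 : ℝ) < n.choose 2 := by rw [h2]; nlinarith
  have hmn : lowerTime n + 2 * n < n.choose 2 := by
    have : (lowerTime n : ℝ) + 2 * n < n.choose 2 := by rw [h2]; nlinarith
    exact_mod_cast this
  refine (processProb_no_isolated_le hn2 hmn).trans (add_le_add ?_ ?_)
  · have h6 := missProb_ge (n := n) (m := lowerTime n) (r := n - 1) (by omega)
    rw [Nat.cast_sub (by omega), Nat.cast_one] at h6
    have hden : 0 < (n.choose 2 : ℝ) - (n - 1) := by rw [h2]; nlinarith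
    set y := (lowerTime n : ℝ) / ((n.choose 2 : ℝ) - (n - 1)) with hy
    have hy0 : 0 ≤ y := by positivity
    have hyup : y * n ≤ 0.76 * L := by
      rw [hy, div_mul_eq_mul_div, div_le_iff₀ hden, h2]
      have h7 : (lowerTime n : ℝ) * n ≤ 3 / 8 * n * L * n := by gcongr
      have h8 : 0 ≤ L * n := by positivity
      nlinarith
    have hysmall : y ≤ 0.001 := by
      have h7 : y * n ≤ 0.001 * n := by linarith
      exact le_of_mul_le_mul_right h7 hn
    have hone : Real.exp (-(1.01 * y)) ≤ 1 - y := by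
      have h7 := Real.one_sub_inv_le_log_of_pos (x := 1 - y) (by linarith)
      rw [← Real.le_log_iff_exp_le (by linarith)]
      refine le_trans ?_ h7
      have h8 : (1 - y)⁻¹ ≤ 1 + 1.01 * y := by
        rw [inv_le_iff_one_le_mul₀ (by linarith)]
        nlinarith
      linarith
    have hp : Real.exp (-(0.8 * L)) ≤ missProb n (lowerTime n) (n - 1) := by
      refine le_trans ?_ h6
      calc Real.exp (-(0.8 * L)) ≤ Real.exp (-(1.01 * y) * (n - 1 : ℕ)) := by
            refine Real.exp_le_exp.2 ?_
            rw [Nat.cast_sub (by omega), Nat.cast_one]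
            nlinarith
        _ = Real.exp (-(1.01 * y)) ^ (n - 1) := by
            rw [← Real.exp_nat_mul]; congr 1; ring
        _ ≤ _ := by gcongr
    have h9 : Real.exp (0.2 * L) ≤ n * missProb n (lowerTime n) (n - 1) := by
      calc Real.exp (0.2 * L) = Real.exp L * Real.exp (-(0.8 * L)) := by
            rw [← Real.exp_add]; congr 1; ring
        _ ≤ _ := by rw [h3]; gcongr
    rw [Real.exp_neg, ← one_div]
    exact one_div_le_one_div_of_le (Real.exp_pos _) h9
  · rw [Real.exp_neg, h3, ← div_eq_mul_inv, mul_div_assoc', div_le_div_iff₀ _ hn]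
    · rw [h2]
      have h7 : (lowerTime n : ℝ) * n ≤ 3 / 8 * n * L * n := by gcongr
      have h8 : 0 ≤ L * n := by positivity
      nlinarith
    · rw [h2]
      nlinarith

end Asymptotics

/-! ### The hitting time of the minimum degree -/

section HittingTime

open Finset

variable {n : ℕ}

open Classical in
/-- If none of the unlikely events occurs, then the graph has a strong rigid partition when its
minimum degree becomes `d`. -/
theorem exists_hittingTime_partition (hn : 0 < n) {m₀ m₁ d k K Δ κ a : ℕ} (hd : 1 ≤ d)
    (hΔ : 1 ≤ Δ) (hK : K + d ≤ k + 1)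
    (hnum : 4 * ((Δ : ℝ) * Δ) * (d * (2 ^ (4 * κ) * (1 - 1 / (2 * (d : ℝ))) ^ K)) ≤ 1)
    (σ : EdgeOrdering n) (hiso : ∃ v, Late (star v) m₀ σ)
    (hmin : ∀ v, d ≤ degAt σ m₁ v) (hmax : ∀ v, degAt σ m₁ v ≤ Δ)
    (hpath : ∀ l, 1 ≤ l → l ≤ 4 → ¬ ∃ x : Fin (l + 1) → Fin n, Function.Injective x ∧
      degAt σ m₀ (x 0) ≤ k ∧ degAt σ m₀ (x (Fin.last l)) ≤ k ∧
      ∀ i : Fin l, (processGraph σ m₁).Adj (x i.castSucc) (x i.succ))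
    (hsparse : ¬ ∃ T : Finset (Fin n), T.Nonempty ∧ #T ≤ 2 * a ∧
      2 * κ * #T ≤ ∑ u ∈ T, #{w ∈ T | (processGraph σ m₁).Adj u w})
    (hjoin : ¬ ∃ A B : Finset (Fin n), Disjoint A B ∧ a ≤ #A ∧ a ≤ #B ∧
      ∀ u ∈ A, ∀ w ∈ B, ¬ (processGraph σ m₀).Adj u w) :
    ∃ τ, IsHittingTime σ (fun G => HasMinDegree G d) τ ∧
      AdmitsStrongRigidPartition (processGraph σ τ) d := by
  have : Nonempty (Fin n) := ⟨⟨0, hn⟩⟩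
  have hex : ∃ m, HasMinDegree (processGraph σ m) d :=
    ⟨m₁, (hasMinDegree_processGraph hn σ m₁ d).2 hmin⟩
  have hτ := (hasMinDegree_processGraph hn σ _ d).1 (Nat.find_spec hex)
  refine ⟨Nat.find hex, ⟨Nat.find_spec hex, fun m hm => Nat.find_min' hex hm⟩, ?_⟩
  have hτ₁ : Nat.find hex ≤ m₁ :=
    Nat.find_min' hex ((hasMinDegree_processGraph hn σ m₁ d).2 hmin)
  set τ := Nat.find hex
  -- A vertex isolated at `m₀` excludes minimum degree `d ≥ 1` up to then.
  have hτ₀ : m₀ ≤ τ := by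
    by_contra hlt
    obtain ⟨v, hv⟩ := hiso
    have h1 := (hτ v).trans (degAt_mono σ (not_le.1 hlt).le v)
    have h2 : degAt σ m₀ v = 0 :=
      card_eq_zero.2 (filter_eq_empty_iff.2 fun e he => not_lt.2 (hv e he))
    omega
  have hle := processGraph_mono σ hτ₁
  -- `S` is fixed by the degrees at `m₀`, not at `τ`: vertices outside it keep large degree at `τ`,
  -- and the path bound at `m₁` keeps its members apart.
  refine admitsStrongRigidPartition_of_pseudorandom (S := univ.filter fun v => degAt σ m₀ v ≤ k)
    (K := K) (Δ := Δ) (κ := κ) (a := a) hd hΔ ?_ ?_ ?_ ?_ ?_ ?_ hnum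
  · intro v
    rw [degree_processGraph]
    exact hτ v
  · intro v hv
    rw [mem_filter_univ, not_le] at hv
    rw [degree_processGraph]
    exact hK.trans (hv.trans_le (degAt_mono σ hτ₀ v))
  · intro v
    rw [degree_processGraph]
    exact (degAt_mono σ hτ₁ v).trans (hmax v)
  · intro s hs s' hs' p hp
    rw [mem_filter_univ] at hs hs'
    by_contra hne
    obtain ⟨l, hl, hlp, x, hx, hx0, hxl, hadj⟩ := exists_injective_path p hne
    exact hpath l hl (hlp.trans hp)
      ⟨x, hx, hx0 ▸ hs, hxl ▸ hs', fun i => hle (hadj i)⟩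
  · intro T hT hTa
    by_contra hlt
    refine hsparse ⟨T, hT, hTa, (not_lt.1 hlt).trans (sum_le_sum fun u _ => ?_)⟩
    exact card_le_card (monotone_filter_right _ fun w _ hw => hle hw)
  · intro A B hAB hA hB
    by_contra hno
    push Not at hno
    exact hjoin ⟨A, B, hAB, hA, hB, fun u hu w hw h =>
      hno u hu w hw (processGraph_mono σ hτ₀ h)⟩

/-- The parameters satisfy the requirement of the local lemma. -/
theorem local_lemma_parameters {L : ℝ} (hL : 10 ^ 7 ≤ L) (hℓ : 1 ≤ Real.log L) {d : ℕ}
    (hd : 1 ≤ d) (hdℓ : d * Real.log L ≤ 1e-7 * L) {K κ Δ : ℕ} (hK : L / 160 ≤ K)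
    (hκ : (κ : ℝ) ≤ K / (16 * d)) (hΔ : (Δ : ℝ) ≤ 41 * L) :
    4 * ((Δ : ℝ) * Δ) * (d * (2 ^ (4 * κ) * (1 - 1 / (2 * (d : ℝ))) ^ K)) ≤ 1 := by
  have hd' : (1 : ℝ) ≤ d := by exact_mod_cast hd
  have hdL : (d : ℝ) ≤ L := by nlinarith
  set ℓ := Real.log L with hℓdef
  set q : ℝ := K / d with hq
  have hqd : q * d = K := div_mul_cancel₀ _ (by linarith)
  have hκq : (κ : ℝ) ≤ q / 16 := by
    refine hκ.trans_eq ?_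
    rw [hq, div_div, mul_comm]
  -- The factor `2 ^ (4κ)` costs at most `exp (q / 4)` and the tail gains `exp (-q / 2)`. For `q ≥
  -- 16 ℓ` the product is at most `L ^ (-4)`, which beats the order `L ^ 3` of `Δ * Δ * d`.
  have hqℓ : 10 ^ 4 * ℓ ≤ q := by
    rw [hq, le_div_iff₀ (by linarith)]
    nlinarith
  have h2 : (2 : ℝ) ^ (4 * κ) ≤ Real.exp (q / 4) := by
    have h2e : (2 : ℝ) ≤ Real.exp 1 := by linarith [exp_one_bounds.2]
    calc (2 : ℝ) ^ (4 * κ) ≤ Real.exp 1 ^ (4 * κ) := by gcongr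
      _ = Real.exp (4 * κ) := by rw [← Real.exp_nat_mul]; congr 1; push_cast; ring
      _ ≤ _ := Real.exp_le_exp.2 (by linarith)
  have h3 : (1 - 1 / (2 * (d : ℝ))) ^ K ≤ Real.exp (-(q / 2)) := by
    refine one_sub_pow_le_exp ?_ ?_
    · rw [div_le_one (by linarith)]; linarith
    · rw [← hqd]
      have : (d : ℝ) ≠ 0 := by linarith
      exact le_of_eq (by field_simp)
  have h4 : Real.exp (q / 4) * Real.exp (-(q / 2)) ≤ (L ^ 4)⁻¹ := by
    rw [← Real.exp_add]
    calc Real.exp (q / 4 + -(q / 2)) ≤ Real.exp (-((4 : ℕ) * ℓ)) :=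
          Real.exp_le_exp.2 (by push_cast; linarith)
      _ = _ := by rw [Real.exp_neg, Real.exp_nat_mul, hℓdef, Real.exp_log (by linarith)]
  have hfrac : 0 ≤ 1 - 1 / (2 * (d : ℝ)) := by
    rw [sub_nonneg, div_le_one (by linarith)]; linarith
  calc 4 * ((Δ : ℝ) * Δ) * (d * (2 ^ (4 * κ) * (1 - 1 / (2 * (d : ℝ))) ^ K))
      ≤ 4 * ((41 * L) * (41 * L)) * (L * (Real.exp (q / 4) * Real.exp (-(q / 2)))) := by
        gcongr
    _ ≤ 4 * ((41 * L) * (41 * L)) * (L * (L ^ 4)⁻¹) := by gcongr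
    _ = 6724 / L := by field_simp; norm_num
    _ ≤ 1 := by rw [div_le_one (by linarith)]; linarith

/-- The error term in the probability bound. -/
def errorBound (L : ℝ) : ℝ :=
  (Real.exp (-(0.2 * L)) + 2 * (L * Real.exp (-L))) + Real.exp (-(L / 2)) + Real.exp (-L) +
    4 * (625 * (L ^ 4 * Real.exp (-(0.15 * L)))) + 2 * (10 ^ 5 * (L ^ 3)⁻¹) + L⁻¹

theorem tendsto_exp_neg_mul {b : ℝ} (hb : 0 < b) :
    Tendsto (fun L : ℝ => Real.exp (-(b * L))) atTop (𝓝 0) :=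
  Real.tendsto_exp_neg_atTop_nhds_zero.comp (tendsto_id.const_mul_atTop hb)

theorem tendsto_pow_mul_exp_neg_mul (k : ℕ) {b : ℝ} (hb : 0 < b) :
    Tendsto (fun L : ℝ => L ^ k * Real.exp (-(b * L))) atTop (𝓝 0) := by
  have h := ((Real.tendsto_pow_mul_exp_neg_atTop_nhds_zero k).comp
    (tendsto_id.const_mul_atTop hb)).const_mul ((b ^ k)⁻¹)
  rw [mul_zero] at h
  refine h.congr fun L => ?_
  simp only [Function.comp_apply, id, mul_pow]
  field_simp

theorem tendsto_errorBound : Tendsto errorBound atTop (𝓝 0) := by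
  have h1 := tendsto_exp_neg_mul (b := 0.2) (by norm_num)
  have h2 := (tendsto_pow_mul_exp_neg_mul 1 (b := 1) (by norm_num)).const_mul 2
  have h3 := tendsto_exp_neg_mul (b := 1 / 2) (by norm_num)
  have h4 := tendsto_exp_neg_mul (b := 1) (by norm_num)
  have h5 := ((tendsto_pow_mul_exp_neg_mul 4 (b := 0.15) (by norm_num)).const_mul 625).const_mul 4
  have h6 := ((tendsto_inv_atTop_zero.comp
    (tendsto_pow_atTop (α := ℝ) (n := 3) (by norm_num))).const_mul (10 ^ 5)).const_mul 2
  have h := ((((h1.add h2).add h3).add h4).add h5).add h6 |>.add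
    (tendsto_inv_atTop_zero (𝕜 := ℝ))
  simp only [mul_zero, add_zero] at h
  refine h.congr fun L => ?_
  simp only [errorBound, Function.comp_apply, pow_one, one_mul, one_div_mul_eq_div]

/-- The union bound over the bad events, one summand of `errorBound` for each; the four path lengths
account for the factor 4. -/
theorem prob_no_partition_le {d : ℕ} (hL : 10 ^ 7 ≤ Real.log n)
    (hℓ : 1 ≤ Real.log (Real.log n)) (hd : 1 ≤ d)
    (hdℓ : d * Real.log (Real.log n) ≤ 1e-7 * Real.log n) :
    processProb n (fun σ => ¬ ∃ τ, IsHittingTime σ (fun G => HasMinDegree G d) τ ∧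
      AdmitsStrongRigidPartition (processGraph σ τ) d) ≤ errorBound (Real.log n) := by
  classical
  obtain ⟨h1, h2, h3⟩ := large_bounds hL
  have hd' : (1 : ℝ) ≤ d := by exact_mod_cast hd
  have hdL : (d : ℝ) ≤ 1e-7 * Real.log n := by nlinarith
  have b1 := prob_no_isolated_le hL
  have b2 := prob_small_degree_le hL (d := d) (by linarith)
  have b3 := prob_large_degree_le hL
  set L := Real.log n with hLdef
  have hn : (0 : ℝ) < n := by linarith
  -- `K` is about half of `k`, leaving room for the `d` neighbours coloured by hand. `κ` is a
  -- truncated quotient; the loss of less than 1 is absorbed in passing from `2560` to `5120`.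
  set k := ⌊L / 40⌋₊
  set K := ⌊L / 80⌋₊
  set Δ := ⌈40 * L⌉₊
  set κ := K / (16 * d)
  set a := ⌈1e-6 * (n : ℝ) / d⌉₊
  have hk : (k : ℝ) ≤ L / 40 := Nat.floor_le (by linarith)
  have hK₁ : (K : ℝ) ≤ L / 80 := Nat.floor_le (by linarith)
  have hK₂ : L / 160 ≤ K := by
    have := Nat.sub_one_lt_floor (L / 80)
    linarith
  have hKd : K + d ≤ k + 1 := by
    have h4 := Nat.sub_one_lt_floor (L / 40)
    have h5 : (K : ℝ) + d ≤ k + 1 := by linarith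
    exact_mod_cast h5
  have hΔ₁ : (Δ : ℝ) ≤ 41 * L := by
    have := (Nat.ceil_lt_add_one (show 0 ≤ 40 * L by linarith)).le
    linarith
  have hΔ₂ : 1 ≤ Δ := Nat.one_le_ceil_iff.2 (by linarith)
  have hκ₁ : (κ : ℝ) ≤ K / (16 * d) := by
    have := Nat.cast_div_le (α := ℝ) (m := K) (n := 16 * d)
    push_cast at this
    exact this
  have hLd : 10 ^ 7 * Real.log L ≤ L / d := by
    rw [le_div_iff₀ (by linarith)]
    linarith
  have hκ₂ : L / (5120 * d) ≤ κ ∧ 2 * Real.log L + 1 ≤ κ := by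
    have h4 : K < 16 * d * (κ + 1) := Nat.lt_mul_div_succ K (by omega)
    have h5 : (K : ℝ) < 16 * d * (κ + 1) := by exact_mod_cast h4
    have h6 : L / 160 / (16 * d) ≤ κ + 1 := by
      rw [div_le_iff₀ (by linarith)]
      linarith
    have h7 : L / 160 / (16 * d) = L / d / 2560 := by field_simp; norm_num
    have h8 : L / (5120 * d) = L / d / 5120 := by field_simp
    rw [h7] at h6
    rw [h8]
    constructor <;> linarith
  have hκL : (κ : ℝ) ≤ L := by
    refine hκ₁.trans ((div_le_self (by positivity) (by linarith)).trans ?_)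
    linarith
  have ha₁ : 1e-6 * (n : ℝ) / d ≤ a := Nat.le_ceil _
  have ha₂ : ((2 * a : ℕ) : ℝ) ≤ 3e-6 * n / d := by
    have h4 : (a : ℝ) ≤ 1e-6 * (n : ℝ) / d + 1 :=
      (Nat.ceil_lt_add_one (show 0 ≤ 1e-6 * (n : ℝ) / d by positivity)).le
    have h6 : 1e-6 * (n : ℝ) / d = 1e-6 * (n / d) := by ring
    have h7 : 3e-6 * (n : ℝ) / d = 3e-6 * (n / d) := by ring
    have h8 : 2e6 ≤ (n : ℝ) / d := by
      rw [le_div_iff₀ (by linarith)]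
      nlinarith
    rw [h6] at h4
    rw [h7]
    push_cast
    linarith
  have b4 := fun l (hl : l ∈ Icc 1 4) =>
    prob_path_le hL hk (mem_Icc.1 hl).1 (mem_Icc.1 hl).2
  have b5 := prob_dense_le hL hd (by linarith) hκL hκ₂.1 hκ₂.2 ha₂
  have b6 := prob_not_joined_le hL hd (by linarith) hℓ hdℓ ha₁
  have b4' := processProb_exists_le_card_mul (Icc 1 4) _ b4
  rw [Nat.card_Icc, show ((4 + 1 - 1 : ℕ) : ℝ) = 4 by norm_num] at b4'
  refine le_trans (processProb_mono fun σ hσ => ?_)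
    ((processProb_or_le _ _).trans (add_le_add ((processProb_or_le _ _).trans
      (add_le_add ((processProb_or_le _ _).trans (add_le_add ((processProb_or_le _ _).trans
        (add_le_add ((processProb_or_le _ _).trans (add_le_add b1 b2)) b3)) b4')) b5)) b6))
  contrapose! hσ
  obtain ⟨⟨⟨⟨⟨c1, c2⟩, c3⟩, c4⟩, c5⟩, c6⟩ := hσ
  refine exists_hittingTime_partition (a := a) (by exact_mod_cast hn) hd hΔ₂ hKd
    (local_lemma_parameters hL hℓ hd hdℓ hK₂ hκ₁ hΔ₁) σ c1
    (fun v => (c2 v).le) (fun v => (c3 v).le) (fun l hl hl4 => ?_) ?_ ?_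
  · rintro ⟨x, h4, h5, h6, h7⟩
    obtain ⟨i, hi⟩ := c4 l (mem_Icc.2 ⟨hl, hl4⟩) x h4 h5 h6
    exact hi (h7 i)
  · rintro ⟨T, h4, h5, h6⟩
    exact absurd h6 (not_le.2 (c5 T h4 h5))
  · rintro ⟨A, B, h4, h5, h6, h7⟩
    obtain ⟨u, hu, w, hw, huw⟩ := c6 A B h4 h5 h6
    exact h7 u hu w hw huw

theorem whp_of_prob_not_le {A : (n : ℕ) → EdgeOrdering n → Prop} {g : ℕ → ℝ}
    (hg : Tendsto g atTop (𝓝 0))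
    (h : ∀ᶠ n in atTop, processProb n (fun σ => ¬ A n σ) ≤ g n) : Whp A := by
  have h1 : Tendsto (fun n => 1 - g n) atTop (𝓝 1) := by
    simpa using hg.const_sub 1
  refine tendsto_of_tendsto_of_tendsto_of_le_of_le' h1 tendsto_const_nhds ?_
    (Eventually.of_forall fun n => processProb_le_one _)
  filter_upwards [h] with n hn
  have := processProb_add_not (A n)
  linarith

end HittingTime

end RigidPartition

end

/-- The second claim needs no further probability: at the time `τ` of the first claim the graph is
rigid, and whenever it is rigid its minimum degree is at least `d`, so no earlier time qualifies. -/
theorem theorem1p7 :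
    ∃ c : ℝ, 0 < c ∧ ∀ d : ℕ → ℕ,
      (∀ᶠ n : ℕ in Filter.atTop,
        1 ≤ d n ∧ (d n : ℝ) ≤ c * Real.log (n : ℝ) / Real.log (Real.log (n : ℝ))) →
      RigidPartition.Whp (fun n σ =>
        ∃ τ : ℕ,
          RigidPartition.IsHittingTime σ (fun G => RigidPartition.HasMinDegree G (d n)) τ ∧
          RigidPartition.AdmitsStrongRigidPartition
            (RigidPartition.processGraph σ τ) (d n)) ∧
      RigidPartition.Whp (fun n σ =>
        ∃ τ : ℕ,
          RigidPartition.IsHittingTime σ (fun G => RigidPartition.HasMinDegree G (d n)) τ ∧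
          RigidPartition.IsHittingTime σ (fun G => RigidPartition.IsRigid G (d n)) τ) := by
  -- The constant is dictated by the edges between sets of size about `1e-6 n / d` in
  -- `prob_not_joined_le`.
  refine ⟨1e-7, by norm_num, fun d hd => ?_⟩
  have hlog : Tendsto (fun n : ℕ => Real.log n) atTop atTop :=
    Real.tendsto_log_atTop.comp tendsto_natCast_atTop_atTop
  have hloglog : Tendsto (fun n : ℕ => Real.log (Real.log n)) atTop atTop :=
    Real.tendsto_log_atTop.comp hlog
  have hg := RigidPartition.tendsto_errorBound.comp hlog
  have hbound : ∀ᶠ n : ℕ in atTop, d n + 2 ≤ n ∧ RigidPartition.processProb n (fun σ =>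
      ¬ ∃ τ : ℕ, RigidPartition.IsHittingTime σ
        (fun G => RigidPartition.HasMinDegree G (d n)) τ ∧
        RigidPartition.AdmitsStrongRigidPartition (RigidPartition.processGraph σ τ) (d n)) ≤
      RigidPartition.errorBound (Real.log n) := by
    filter_upwards [hd, hlog.eventually_ge_atTop (10 ^ 7), hloglog.eventually_ge_atTop 1]
      with n hdn hL hℓ
    rw [le_div_iff₀ (by linarith)] at hdn
    refine ⟨?_, RigidPartition.prob_no_partition_le hL hℓ hdn.1 hdn.2⟩
    have h1 := (RigidPartition.large_bounds hL).1
    have hd1 : (1 : ℝ) ≤ d n := by exact_mod_cast hdn.1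
    have h2 : (d n : ℝ) + 2 ≤ n := by nlinarith [hdn.2]
    exact_mod_cast h2
  refine ⟨RigidPartition.whp_of_prob_not_le hg (hbound.mono fun n h => h.2),
    RigidPartition.whp_of_prob_not_le hg (hbound.mono fun n h => ?_)⟩
  refine (RigidPartition.processProb_mono fun σ hσ => ?_).trans h.2
  contrapose! hσ
  obtain ⟨τ, hτ, hpart⟩ := hσ
  refine ⟨τ, hτ, ?_, fun m hm => hτ.2 ?_⟩
  · exact hpart.isRigid (by rw [Fintype.card_fin]; omega)
  · exact RigidPartition.IsRigid.hasMinDegree (by rw [Fintype.card_fin]; exact h.1) hm
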